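/- Let $\mathcal A=C^\infty(\mathbb R^N)$, let $\alpha$ be a formal parameter, and let $\omega_0^{ij}\in\mathcal A$ be a Poisson structure ($\omega_0^{ij}=-\omega_0^{ji}$, $\omega_0^{kl}\partial_l\omega_0^{ij}+\omega_0^{jl}\partial_l\omega_0^{ki}+\omega_0^{il}\partial_l\omega_0^{jk}=0$; repeated indices are summed). *Weyl ordering.* For operators $\hat x^i=x^i+\sum_{p\ge1,k\ge0}\alpha^{p+k}\Gamma_k^{ii_1\dots i_p}(x)\,\partial_{i_1}\cdots\partial_{i_p}$ and $f\in\mathcal A$ let $W(f)=\hat f(\hat x)$ be the symmetrically ordered operator: at a point $a$, in the Taylor expansion of $f$ about $a$ the monomials $(x-a)^{i_1}\cdots(x-a)^{i_n}$ are replaced by the symmetrised products of the $\hat x^i-a^i$, and the value at $a$ is taken (in each order of $\alpha$ the sum is finite). For series, $W(\sum_m\alpha^m\varphi_m)=\sum_m\alpha^mW(\varphi_m)$. *Iteration.* For $\omega=\omega_0+\alpha^2\omega_2$ put $\hat x_0^i=x^i$. Given $\hat x_n$ let $G_{n+1}^{ij}$ be the $\alpha^{n+1}$-term of $2\alpha\,\hat\omega^{ij}(\hat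 x_n)-[\hat x_n^i,\hat x_n^j]$, where $\hat\omega^{ij}(\hat x_n)=W(\omega^{ij})$ is formed with $\hat x_n$; write $G_{n+1}^{ij}=\sum_pG_{n+1}^{iji_2\dots i_p}\partial_{i_2}\cdots\partial_{i_p}$ with coefficients symmetric in $i_2,\dots,i_p$, and for $p+k=n+1$ set $$\alpha^{n+1}\Gamma_k^{ji_1\dots i_p}=\tfrac1{p(p+1)}\big(G_{n+1}^{ji_1i_2\dots i_p}+G_{n+1}^{ji_2i_1i_3\dots i_p}+\dots+G_{n+1}^{ji_pi_1\dots i_{p-1}}\big),\qquad \hat x_{n+1}^i=\hat x_n^i+\alpha^{n+1}\sum_{p+k=n+1}\Gamma_k^{ii_1\dots i_p}\partial_{i_1}\cdots\partial_{i_p}.$$ The consistency condition of order $n$ is $[\hat x_n^i,\hat\omega^{jk}(\hat x_n)]+\mathrm{cycl.}(ijk)=o(\alpha^n)$. A skew-symmetric $\omega_2^{ij}\in\mathcal A$ is called an admissible correction if the condition of order $3$ holds for $\omega_0+\alpha^2\omega_2$. **Theorem.** (a) $\omega_2^{bc}=\frac1{12}\partial_m\omega_0^{nl}\partial_n\omega_0^{mk}\partial_l\partial_k\omega_0^{bc}-\frac16\partial_n\partial_k\omega_0^{bm}\partial_m\partial_l\omega_0^{cn}\omega_0^{kl}$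 is an admissible correction. (b) Let $\omega_2$ be any admissible correction. Then: 1. The $\alpha^4$-coefficient of $\hat x_4^i$ is $\Gamma_2^{ijk}\partial_j\partial_k+\Gamma_1^{ijkl}\partial_j\partial_k\partial_l+\Gamma_0^{ijklm}\partial_j\partial_k\partial_l\partial_m$; moreover $[\hat x_4^i,\hat x_4^j]=2\alpha\hat\omega^{ij}(\hat x_4)+o(\alpha^4)$, and $W((c_ix^i)^n)=(c_i\hat x_4^i)^n$ for all $c\in\mathbb R^N$, $n\ge0$. 2. The $\alpha^4$ part of the star product $f\star g=W(f)g$, $W$ formed with $\hat x_4$, is $f\star_4g=\alpha^4\sum_{m,n}L_{m,n}(f,g)$ for all $f,g\in\mathcal A$, where $L_{m,n}(f,g)=L_{n,m}(g,f)$ for all $m,n$ and the non-vanishing $L_{m,n}$ with $m\le n$ are $$\begin{aligned} L_{1,2}&=\partial_if\,\Gamma_2^{ijk}\,\partial_j\partial_kg,\qquad L_{1,3}=\partial_if\,\Gamma_1^{ijkl}\,\partial_j\partial_k\partial_lg,\qquad L_{1,4}=\partial_if\,\Gamma_0^{ijklm}\,\partial_j\partial_k\partial_l\partial_mg,\\ L_{2,2}&=\partial_i\partial_mf\big(\Gamma_1^{ijl}\partial_j\omega_0^{mn}+\tfrac32\Gamma_0^{ijkl}\partial_j\partial_k\omega_0^{mn}+\tfrac12\omega_0^{ij}\partial_j\Gamma_1^{mnl}+\tfrac12\Gamma_0^{ijk}\partial_j\partial_k\Gamma_0^{mnl}+\tfrac32\Gamma_1^{imnl}+\omega_0^{il}\omega_2^{mn}\big)\partial_l\partial_ng,\\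 L_{2,3}&=\partial_i\partial_mf\big(\tfrac12\omega_0^{ij}\partial_j\Gamma_0^{mnkl}+\Gamma_1^{ilk}\omega_0^{mn}+\tfrac32\Gamma_0^{ijkl}\partial_j\omega_0^{mn}+\Gamma_0^{ijk}\partial_j\Gamma_0^{mnl}+2\Gamma_0^{imkln}\big)\partial_k\partial_l\partial_ng,\\ L_{2,4}&=\partial_i\partial_mf\big(\omega_0^{ij}\Gamma_0^{mnkl}+\tfrac12\Gamma_0^{ijk}\Gamma_0^{mnl}\big)\partial_j\partial_k\partial_l\partial_ng,\\ L_{3,3}&=\partial_i\partial_j\partial_mf\big(\tfrac12\omega_0^{ia}\partial_a\omega_0^{jk}\Gamma_0^{mnl}+\tfrac12\omega_0^{ia}\omega_0^{jk}\partial_a\Gamma_0^{mnl}+\omega_0^{ik}\Gamma_0^{jal}\partial_a\omega_0^{mn}+\Gamma_0^{mnl}\Gamma_0^{ijk}+\tfrac32\omega_0^{mn}\Gamma_0^{ijkl}\big)\partial_k\partial_l\partial_ng,\\ L_{3,4}&=\tfrac12\,\partial_i\partial_j\partial_mf\;\omega_0^{ia}\omega_0^{jk}\Gamma_0^{mnl}\;\partial_a\partial_k\partial_l\partial_ng,\\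 L_{4,4}&=\tfrac1{24}\,\partial_i\partial_j\partial_m\partial_nf\;\omega_0^{ik}\omega_0^{jl}\omega_0^{ma}\omega_0^{nb}\;\partial_k\partial_l\partial_a\partial_bg . \end{aligned}$$ 3. $f\star_4g=g\star_4f$ for all $f,g\in\mathcal A$, and the consistency condition of order $4$ holds for $\omega=\omega_0+\alpha^2\omega_2$, so that $\omega$ needs no further correction. -/

import Mathlib

namespace WeylStar

noncomputable section

/-- The commutative algebra of smooth real functions on `ℝ^N`. -/
def Smooth (N : ℕ) : Subalgebra ℝ ((Fin N → ℝ) → ℝ) where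
  carrier := {f | ContDiff ℝ (⊤ : ℕ∞) f}
  mul_mem' {f g} hf hg := show ContDiff ℝ (⊤ : ℕ∞) (f * g) from
    ContDiff.mul (show ContDiff ℝ (⊤ : ℕ∞) f from hf) (show ContDiff ℝ (⊤ : ℕ∞) g from hg)
  add_mem' {f g} hf hg := show ContDiff ℝ (⊤ : ℕ∞) (f + g) from
    ContDiff.add (show ContDiff ℝ (⊤ : ℕ∞) f from hf) (show ContDiff ℝ (⊤ : ℕ∞) g from hg)
  algebraMap_mem' c := show ContDiff ℝ (⊤ : ℕ∞) (fun _ : Fin N → ℝ => c) from contDiff_const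

lemma smooth_contDiff {N : ℕ} (f : Smooth N) :
    ContDiff ℝ (⊤ : ℕ∞) (f : (Fin N → ℝ) → ℝ) := f.2

/-- The Cartesian coordinate `x^i`. -/
def coord {N : ℕ} (i : Fin N) : Smooth N :=
  ⟨fun x => x i, show ContDiff ℝ (⊤ : ℕ∞) (fun x : Fin N → ℝ => x i) from contDiff_apply ℝ ℝ i⟩

/-- Linear operators on smooth functions. -/
abbrev Op (N : ℕ) : Type := Module.End ℝ (Smooth N)

/-- Formal power series in the deformation parameter `α` (the variable `PowerSeries.X`),
with operator coefficients. -/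
abbrev FormalOp (N : ℕ) : Type := PowerSeries (Op N)

/-- Formal power series in `α` with smooth coefficients. -/
abbrev FormalFn (N : ℕ) : Type := PowerSeries (Smooth N)

/-- Multiplication by a function. -/
def mulOp {N : ℕ} (f : Smooth N) : Op N := LinearMap.mulLeft ℝ f

lemma contDiff_partial {N : ℕ} (i : Fin N) (f : Smooth N) :
    ContDiff ℝ (⊤ : ℕ∞) (fun x => fderiv ℝ (f : (Fin N → ℝ) → ℝ) x (Pi.single i 1)) :=
  (ContDiff.fderiv_right (m := (⊤ : ℕ∞)) (n := (⊤ : ℕ∞)) (smooth_contDiff f) (by simp)).clm_apply contDiff_const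

lemma smooth_differentiableAt {N : ℕ} (f : Smooth N) (x : Fin N → ℝ) :
    DifferentiableAt ℝ (f : (Fin N → ℝ) → ℝ) x :=
  ((smooth_contDiff f).differentiable (by simp)) x

/-- The partial derivative `∂_i`. -/
def partialOp {N : ℕ} (i : Fin N) : Op N where
  toFun f := ⟨fun x => fderiv ℝ (f : (Fin N → ℝ) → ℝ) x (Pi.single i 1), contDiff_partial i f⟩
  map_add' f g := by
    ext x
    have h := fderiv_add (smooth_differentiableAt f x) (smooth_differentiableAt g x)
    change fderiv ℝ ((f : (Fin N → ℝ) → ℝ) + (g : (Fin N → ℝ) → ℝ)) x _ = _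
    rw [h]
    rfl
  map_smul' c f := by
    ext x
    have h := fderiv_const_smul (smooth_differentiableAt f x) c
    change fderiv ℝ (c • (f : (Fin N → ℝ) → ℝ)) x _ = _
    rw [h]
    rfl

/-- The iterated derivative `∂_{i₁} ⋯ ∂_{i_p}` for `I = [i₁, …, i_p]`. -/
def D {N : ℕ} (I : List (Fin N)) : Op N := (I.map partialOp).prod

/-- The iterated commutator `[…[[P, x^{i₁}], x^{i₂}], …, x^{i_p}]`. -/
def bracketCoord {N : ℕ} (P : Op N) (I : List (Fin N)) : Op N :=
  I.foldl (fun Q i => Q * mulOp (coord i) - mulOp (coord i) * Q) P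

/-- For a differential operator `P = ∑_p P^{i₁…i_p} ∂_{i₁} ⋯ ∂_{i_p}` whose coefficients are
symmetric in their indices, this is the coefficient `P^{i₁…i_p}`: the `p`-fold commutator with
the coordinates, applied to `1`, is `p!` times that coefficient. -/
def symCoeff {N : ℕ} (P : Op N) (I : List (Fin N)) : Smooth N :=
  (1 / (I.length.factorial : ℝ)) • bracketCoord P I 1

/-- The product of the differences `x̂^i - x^i`, `i ∈ I`, in which every undeformed coordinate is
written to the left of all operators. At a point `a`, the function `(centered X I) g` takes the
value of the product of the operators `x̂^i - a^i` applied to `g`. -/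
def centered {N : ℕ} (X : Fin N → FormalOp N) : List (Fin N) → FormalOp N
  | [] => 1
  | i :: I => centered X I * X i - PowerSeries.C (mulOp (coord i)) * centered X I

/-- The Weyl (symmetrically) ordered operator `W(f) = f̂(x̂)` of a smooth function `f`: in the Taylor
expansion of `f` at the point `a` the monomials `(x - a)^{i₁} ⋯ (x - a)^{i_n}` are replaced by the
symmetrised products of the operators `x̂^i - a^i`, and the resulting function is evaluated at `a`.
The symmetrisation is done by the symmetric derivatives of `f`.
Whenever the `α^l`-coefficient of `X i - x^i` is a differential operator of order at most `l` and
vanishes for `l = 0`, the products of more than `2 * k` factors do not contribute in the order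
`α^k`, so that the finite sum is the whole Taylor expansion. -/
def weyl {N : ℕ} (X : Fin N → FormalOp N) (f : Smooth N) : FormalOp N :=
  PowerSeries.mk fun k => ∑ n ∈ Finset.range (2 * k + 1),
    (1 / (n.factorial : ℝ)) • ∑ I : Fin n → Fin N,
      mulOp (D (List.ofFn I) f) * PowerSeries.coeff k (centered X (List.ofFn I))

/-- The Weyl ordered operator of an `α`-dependent function, `W(∑ α^m φ_m) = ∑ α^m W(φ_m)`. -/
def weylSeries {N : ℕ} (X : Fin N → FormalOp N) (φ : FormalFn N) : FormalOp N :=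
  PowerSeries.mk fun k => ∑ q ∈ Finset.HasAntidiagonal.antidiagonal k,
    PowerSeries.coeff q.2 (weyl X (PowerSeries.coeff q.1 φ))

/-- The `α^{n+1}`-coefficient of `2 α ω̂^{ij} - [x̂_n^i, x̂_n^j]`, i.e. `α^{-(n+1)} G_{n+1}^{ij}`. -/
def defect {N : ℕ} (ω : Fin N → Fin N → FormalFn N) (n : ℕ) (X : Fin N → FormalOp N)
    (i j : Fin N) : Op N :=
  PowerSeries.coeff (n + 1)
    (2 * PowerSeries.X * weylSeries X (ω i j) - (X i * X j - X j * X i))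

/-- For `I = [i₁, …, i_p]` and the operators `G^{ij} = ∑ G^{ij i₂…i_p} ∂_{i₂} ⋯ ∂_{i_p}`, the tensor
`(G^{j i₁ i₂ … i_p} + G^{j i₂ i₁ i₃ … i_p} + ⋯ + G^{j i_p i₁ … i_{p-1}}) / (p (p + 1))`. -/
def gammaOf {N : ℕ} (G : Fin N → Fin N → Op N) (j : Fin N) (I : List (Fin N)) : Smooth N :=
  (1 / ((I.length : ℝ) * ((I.length : ℝ) + 1))) •
    ∑ s : Fin I.length, symCoeff (G j (I.get s)) (I.eraseIdx s)

/-- The deformed coordinates `x̂_n^i` up to the order `α^n`, built iteratively: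
`x̂_0^i = x^i` and `x̂_{n+1}^i = x̂_n^i + α^{n+1} ∑_{p+k=n+1} Γ_k^{i i₁…i_p} ∂_{i₁} ⋯ ∂_{i_p}`. -/
def xhat {N : ℕ} (ω : Fin N → Fin N → FormalFn N) : ℕ → Fin N → FormalOp N
  | 0 => fun i => PowerSeries.C (mulOp (coord i))
  | n + 1 => fun i => xhat ω n i +
      PowerSeries.X ^ (n + 1) * PowerSeries.C
        (∑ p ∈ Finset.Icc 1 (n + 1), ∑ I : Fin p → Fin N,
          mulOp (gammaOf (defect ω n (xhat ω n)) i (List.ofFn I)) * D (List.ofFn I))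

/-- The coefficient function `Γ_k^{i i₁…i_p}` of the deformed coordinates, `I = [i₁, …, i_p]`,
`p ≥ 1`. It appears in `x̂^i` in the order `α^{k+p}`. -/
def Gam {N : ℕ} (ω : Fin N → Fin N → FormalFn N) (k : ℕ) (i : Fin N) (I : List (Fin N)) :
    Smooth N :=
  gammaOf (defect ω (k + I.length - 1) (xhat ω (k + I.length - 1))) i I

/-- The part of order `α^k` of the star product `f ⋆ g = W(f) g` (without the factor `α^k`). -/
def starPart {N : ℕ} (ω : Fin N → Fin N → FormalFn N) (k : ℕ) (f g : Smooth N) : Smooth N :=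
  PowerSeries.coeff k (weyl (xhat ω k) f) g

/-- `ω₀` is a Poisson structure on `ℝ^N`. -/
structure IsPoisson {N : ℕ} (ω₀ : Fin N → Fin N → Smooth N) : Prop where
  skew : ∀ i j, ω₀ i j = -ω₀ j i
  jacobi : ∀ i j k, ∑ l, (ω₀ k l * D [l] (ω₀ i j) + ω₀ j l * D [l] (ω₀ k i)
    + ω₀ i l * D [l] (ω₀ j k)) = 0

/-- The series `ω^{ij} = ω₀^{ij} + α² ω₂^{ij}`. -/
def correctedOmega {N : ℕ} (ω₀ ω₂ : Fin N → Fin N → Smooth N) (i j : Fin N) : FormalFn N :=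
  PowerSeries.C (ω₀ i j) + PowerSeries.X ^ 2 * PowerSeries.C (ω₂ i j)

/-- The commutation relation `[x̂_n^i, x̂_n^j] = 2 α ω̂^{ij}(x̂_n) + o(α^n)`. -/
def CommutationRelation {N : ℕ} (ω : Fin N → Fin N → FormalFn N) (n : ℕ) : Prop :=
  ∀ i j : Fin N, ∀ k ≤ n,
    PowerSeries.coeff k (xhat ω n i * xhat ω n j - xhat ω n j * xhat ω n i) =
      PowerSeries.coeff k (2 * PowerSeries.X * weylSeries (xhat ω n) (ω i j))

/-- The commutator `[x̂_n^i, ω̂^{jk}(x̂_n)]`. -/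
def coordOmegaComm {N : ℕ} (ω : Fin N → Fin N → FormalFn N) (n : ℕ) (i j k : Fin N) :
    FormalOp N :=
  xhat ω n i * weylSeries (xhat ω n) (ω j k) - weylSeries (xhat ω n) (ω j k) * xhat ω n i

/-- The consistency condition in the order `α^n`:
`[x̂_n^i, ω̂^{jk}(x̂_n)] + cycl.(ijk) = o(α^n)`. -/
def ConsistencyCondition {N : ℕ} (ω : Fin N → Fin N → FormalFn N) (n : ℕ) : Prop :=
  ∀ i j k : Fin N, ∀ m ≤ n,
    PowerSeries.coeff m
      (coordOmegaComm ω n i j k + coordOmegaComm ω n j k i + coordOmegaComm ω n k i j) = 0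

/-- `ω₂` is an admissible correction of the Poisson structure `ω₀`: it is skew-symmetric and
`ω₀ + α² ω₂` satisfies the consistency condition in the third order. -/
structure IsCorrection {N : ℕ} (ω₀ ω₂ : Fin N → Fin N → Smooth N) : Prop where
  skew : ∀ i j, ω₂ i j = -ω₂ j i
  consistent : ConsistencyCondition (correctedOmega ω₀ ω₂) 3

/-- The universal correction
`(1/12) ∂_m ω₀^{nl} ∂_n ω₀^{mk} ∂_l ∂_k ω₀^{bc} - (1/6) ∂_n ∂_k ω₀^{bm} ∂_m ∂_l ω₀^{cn} ω₀^{kl}`. -/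
def omegaTwo {N : ℕ} (ω₀ : Fin N → Fin N → Smooth N) (b c : Fin N) : Smooth N :=
  ∑ k, ∑ l, ∑ m, ∑ n,
    ((1 / 12 : ℝ) • (D [m] (ω₀ n l) * D [n] (ω₀ m k) * D [l, k] (ω₀ b c))
      - (1 / 6 : ℝ) • (D [n, k] (ω₀ b m) * D [m, l] (ω₀ c n) * ω₀ k l))

section Fourth

variable {N : ℕ} (ω₀ ω₂ : Fin N → Fin N → Smooth N)

/-- The functions `Γ_k^{i i₁…i_p}` belonging to `ω₀ + α² ω₂`. -/
def Γ (k : ℕ) (i : Fin N) (I : List (Fin N)) : Smooth N := Gam (correctedOmega ω₀ ω₂) k i I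

def L12 (f g : Smooth N) : Smooth N :=
  ∑ i, ∑ j, ∑ k, D [i] f * Γ ω₀ ω₂ 2 i [j, k] * D [j, k] g

def L13 (f g : Smooth N) : Smooth N :=
  ∑ i, ∑ j, ∑ k, ∑ l, D [i] f * Γ ω₀ ω₂ 1 i [j, k, l] * D [j, k, l] g

def L14 (f g : Smooth N) : Smooth N :=
  ∑ i, ∑ j, ∑ k, ∑ l, ∑ m, D [i] f * Γ ω₀ ω₂ 0 i [j, k, l, m] * D [j, k, l, m] g

def L22 (f g : Smooth N) : Smooth N :=
  ∑ i, ∑ m, ∑ l, ∑ n, D [i, m] f *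
    ((∑ j, Γ ω₀ ω₂ 1 i [j, l] * D [j] (ω₀ m n))
      + (3 / 2 : ℝ) • (∑ j, ∑ k, Γ ω₀ ω₂ 0 i [j, k, l] * D [j, k] (ω₀ m n))
      + (1 / 2 : ℝ) • (∑ j, ω₀ i j * D [j] (Γ ω₀ ω₂ 1 m [n, l]))
      + (1 / 2 : ℝ) • (∑ j, ∑ k, Γ ω₀ ω₂ 0 i [j, k] * D [j, k] (Γ ω₀ ω₂ 0 m [n, l]))
      + (3 / 2 : ℝ) • Γ ω₀ ω₂ 1 i [m, n, l]
      + ω₀ i l * ω₂ m n) * D [l, n] g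

def L23 (f g : Smooth N) : Smooth N :=
  ∑ i, ∑ m, ∑ k, ∑ l, ∑ n, D [i, m] f *
    ((1 / 2 : ℝ) • (∑ j, ω₀ i j * D [j] (Γ ω₀ ω₂ 0 m [n, k, l]))
      + Γ ω₀ ω₂ 1 i [l, k] * ω₀ m n
      + (3 / 2 : ℝ) • (∑ j, Γ ω₀ ω₂ 0 i [j, k, l] * D [j] (ω₀ m n))
      + (∑ j, Γ ω₀ ω₂ 0 i [j, k] * D [j] (Γ ω₀ ω₂ 0 m [n, l]))
      + (2 : ℝ) • Γ ω₀ ω₂ 0 i [m, k, l, n]) * D [k, l, n] g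

def L24 (f g : Smooth N) : Smooth N :=
  ∑ i, ∑ m, ∑ j, ∑ k, ∑ l, ∑ n, D [i, m] f *
    (ω₀ i j * Γ ω₀ ω₂ 0 m [n, k, l]
      + (1 / 2 : ℝ) • (Γ ω₀ ω₂ 0 i [j, k] * Γ ω₀ ω₂ 0 m [n, l])) * D [j, k, l, n] g

def L33 (f g : Smooth N) : Smooth N :=
  ∑ i, ∑ j, ∑ m, ∑ k, ∑ l, ∑ n, D [i, j, m] f *
    ((1 / 2 : ℝ) • (∑ a, ω₀ i a * D [a] (ω₀ j k) * Γ ω₀ ω₂ 0 m [n, l])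
      + (1 / 2 : ℝ) • (∑ a, ω₀ i a * ω₀ j k * D [a] (Γ ω₀ ω₂ 0 m [n, l]))
      + (∑ a, ω₀ i k * Γ ω₀ ω₂ 0 j [a, l] * D [a] (ω₀ m n))
      + Γ ω₀ ω₂ 0 m [n, l] * Γ ω₀ ω₂ 0 i [j, k]
      + (3 / 2 : ℝ) • (ω₀ m n * Γ ω₀ ω₂ 0 i [j, k, l])) * D [k, l, n] g

def L34 (f g : Smooth N) : Smooth N :=
  (1 / 2 : ℝ) • ∑ i, ∑ j, ∑ m, ∑ a, ∑ k, ∑ l, ∑ n,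
    D [i, j, m] f * (ω₀ i a * ω₀ j k * Γ ω₀ ω₂ 0 m [n, l]) * D [a, k, l, n] g

def L44 (f g : Smooth N) : Smooth N :=
  (1 / 24 : ℝ) • ∑ i, ∑ j, ∑ m, ∑ n, ∑ k, ∑ l, ∑ a, ∑ b,
    D [i, j, m, n] f * (ω₀ i k * ω₀ j l * ω₀ m a * ω₀ n b) * D [k, l, a, b] g

/-- The terms `L_{m,n}(f, g)`, with `m` derivatives of `f` and `n` derivatives of `g`. -/
def L (m n : ℕ) (f g : Smooth N) : Smooth N :=
  match m, n with
  | 1, 2 => L12 ω₀ ω₂ f g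
  | 1, 3 => L13 ω₀ ω₂ f g
  | 1, 4 => L14 ω₀ ω₂ f g
  | 2, 2 => L22 ω₀ ω₂ f g
  | 2, 3 => L23 ω₀ ω₂ f g
  | 2, 4 => L24 ω₀ ω₂ f g
  | 3, 3 => L33 ω₀ ω₂ f g
  | 3, 4 => L34 ω₀ ω₂ f g
  | 4, 4 => L44 ω₀ f g
  | 2, 1 => L12 ω₀ ω₂ g f
  | 3, 1 => L13 ω₀ ω₂ g f
  | 4, 1 => L14 ω₀ ω₂ g f
  | 3, 2 => L23 ω₀ ω₂ g f
  | 4, 2 => L24 ω₀ ω₂ g f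
  | 4, 3 => L34 ω₀ ω₂ g f
  | _, _ => 0

end Fourth

end

end WeylStar

/-!
# The star product of fourth order by Weyl ordering

Differential operators are written through their full symbols, polynomials in dual variables `p_i`
with smooth coefficients (`op`, `op_injective`); composition is the bidifferential expression `bid`
(`op_mul_op`). A commutator with the coordinate `x^j` is, up to sign, the derivative of the symbol in
`p_j`.

*The iteration.* The coefficients that define `x̂_{n+1}` form the homotopy of the Poincaré lemma in the
dual variables (`gam`, `pderiv_gam_sub`), applied to the symbols `g^{ij}` of the defect of the
commutation relation. Since `g` is skew-symmetric, the corrections satisfy `∑ p_i γ^i = 0`, and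
this identity says that `c · x̂` acts on powers of `c · x` as multiplication by `c · x`
(`IsDeformed`, `isDeformed_xhat`). Hence `W((c · x)^n) = (c · x̂)^n` (`weyl_lin_pow`); as differential
operators are determined by their values on powers of linear functions (`eq_zero_of_op_lin_pow`), many
facts on `W` need to be checked only there. The consistency condition makes `g` closed, by the Jacobi
identity for commutators, so that the next coordinates satisfy the commutation relation
(`CommutationRelation.succ`).

*Parity.* If `ω` is even in `α`, the deformed coordinates `x̂^i` commute with the coordinates `x̂^j`
in which `α` is replaced by `-α` (`eqMod_commute_altX`), as long as the commutation relation
holds. Evaluating on `1` the commuting operators `W(f)` and `W(g)` at opposite parameters shows that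
`f ⋆ g` turns into `g ⋆ f` under `α ↦ -α` (`coeff_weyl_apply_comm`). So the order `α^4` of the star
product is symmetric. Moreover the cyclic sum in the consistency condition commutes with the
coordinates of the opposite parameter, so it is determined by its value on `1`, which is odd
in `α`: in even orders the consistency condition is automatic (`ConsistencyCondition.succ_of_even`), and
in odd orders it is an identity between functions (`CommutationRelation.consistencyCondition`).

*The correction.* Consequently `ω₂` is admissible if and only if one identity between functions holds in
the order `α^3`. From the explicit symbols up to third order (`ys_one`, `ys_two`, `ys_three`) it
becomes an identity between contractions of derivatives of `ω₀`, which is a combination of contracted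
derivatives of the Jacobi identity (`PoissonJet.sum_graph_eq_zero`, `isCorrection_omegaTwo`).

*The fourth order.* The order `α^4` of the star product and the operators `L_{m,n}` are bidifferential,
hence determined by their values on exponential functions (`IsBidiff.ext`), where each homogeneous part
becomes a function of two covectors (`bisymbol`). The parts with `m ≤ n` are computed by the
composition formula (`component_cs_two_four`, `component_cs_three_four`, `component_cs_four_four` and
the lemmas `bisymbol_two_two` to `bisymbol_one_one`), and the others follow from symmetry
(`bisymbol_symm`). The vector field in the order `α^4` of the coordinates, and with it `L_{1,1}`,
vanishes because `ω` has no `α^3`-term (`Γ_three_singleton`).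
-/

namespace WeylStar

noncomputable section

open MvPolynomial Finset

variable {N : ℕ}

/-! ### Partial derivatives of smooth functions -/

/-! The next two instances serve `ring`, `norm_num` and `field_simp` over `Smooth N`. -/

instance : Nontrivial (Smooth N) :=
  ⟨0, 1, fun h => zero_ne_one (α := ℝ)
    (congrFun (congrArg (fun f : Smooth N => (f : (Fin N → ℝ) → ℝ)) h) 0)⟩

instance : CharZero (Smooth N) :=
  charZero_of_injective_algebraMap (algebraMap ℝ (Smooth N)).injective

lemma partialOp_apply (i : Fin N) (f : Smooth N) (x : Fin N → ℝ) :
    (partialOp i f : (Fin N → ℝ) → ℝ) x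
      = fderiv ℝ (f : (Fin N → ℝ) → ℝ) x (Pi.single i 1) := rfl

lemma partialOp_mul (i : Fin N) (f g : Smooth N) :
    partialOp i (f * g) = f * partialOp i g + g * partialOp i f := by
  ext x
  have h := fderiv_mul (smooth_differentiableAt f x) (smooth_differentiableAt g x)
  change fderiv ℝ ((f : (Fin N → ℝ) → ℝ) * (g : (Fin N → ℝ) → ℝ)) x _ = _
  rw [h]
  rfl

/-- The partial derivative as a derivation of the algebra of smooth functions. -/
def pd (i : Fin N) : Derivation ℝ (Smooth N) (Smooth N) :=
  Derivation.mk' (partialOp i) fun f g => by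
    simpa only [smul_eq_mul] using partialOp_mul i f g

lemma pd_apply (i : Fin N) (f : Smooth N) : pd i f = partialOp i f := rfl

lemma pd_comm (i j : Fin N) (f : Smooth N) : pd i (pd j f) = pd j (pd i f) := by
  ext x
  have hs : IsSymmSndFDerivAt ℝ (f : (Fin N → ℝ) → ℝ) x :=
    (smooth_contDiff f).contDiffAt.isSymmSndFDerivAt (by
      simp only [minSmoothness_of_isRCLikeNormedField]; exact WithTop.coe_le_coe.mpr le_top)
  have hd : DifferentiableAt ℝ (fderiv ℝ (f : (Fin N → ℝ) → ℝ)) x :=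
    (((smooth_contDiff f).fderiv_right (m := (⊤ : ℕ∞)) (by simp)).differentiable (by simp)) x
  have key : ∀ a b : Fin N, (pd a (pd b f) : (Fin N → ℝ) → ℝ) x
      = fderiv ℝ (fderiv ℝ (f : (Fin N → ℝ) → ℝ)) x (Pi.single a 1) (Pi.single b 1) := by
    intro a b
    change fderiv ℝ (fun y => fderiv ℝ (f : (Fin N → ℝ) → ℝ) y (Pi.single b 1)) x _ = _
    rw [fderiv_clm_apply hd (differentiableAt_const _)]
    simp
  rw [key, key, hs]

lemma pd_coord (i j : Fin N) : pd i (coord j) = if j = i then (1 : Smooth N) else 0 := by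
  ext x
  change fderiv ℝ (fun y : Fin N → ℝ => y j) x (Pi.single i 1) = _
  rw [(hasFDerivAt_apply j x).fderiv]
  by_cases h : j = i
  · subst h; simp
  · simp [h]

lemma partialOp_commute (i j : Fin N) : Commute (partialOp i) (partialOp j) :=
  LinearMap.ext fun f => pd_comm i j f

lemma D_cons (i : Fin N) (I : List (Fin N)) : D (i :: I) = partialOp i * D I := by
  simp [D]

lemma D_nil : D ([] : List (Fin N)) = 1 := rfl

lemma D_append (I J : List (Fin N)) : D (I ++ J) = D I * D J := by
  simp [D]

lemma D_perm {I J : List (Fin N)} (h : I.Perm J) : D I = D J := by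
  refine List.Perm.prod_eq' (h.map _) ?_
  refine List.pairwise_of_forall_mem_list fun a ha b hb => ?_
  rw [List.mem_map] at ha hb
  obtain ⟨i, -, rfl⟩ := ha
  obtain ⟨j, -, rfl⟩ := hb
  exact partialOp_commute i j

lemma mulOp_apply (f g : Smooth N) : mulOp f g = f * g := rfl

lemma mulOp_mul (f g : Smooth N) : mulOp (f * g) = mulOp f * mulOp g :=
  LinearMap.ext fun h => mul_assoc f g h

lemma mulOp_add (f g : Smooth N) : mulOp (f + g) = mulOp f + mulOp g :=
  LinearMap.ext fun h => add_mul f g h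

lemma mulOp_smul (c : ℝ) (f : Smooth N) : mulOp (c • f) = c • mulOp f :=
  LinearMap.ext fun h => smul_mul_assoc c f h

lemma mulOp_sum {ι : Type*} (s : Finset ι) (f : ι → Smooth N) :
    mulOp (∑ i ∈ s, f i) = ∑ i ∈ s, mulOp (f i) :=
  LinearMap.ext fun h => by simp [mulOp_apply, Finset.sum_mul]

lemma mulOp_one : mulOp (1 : Smooth N) = 1 := LinearMap.ext fun h => one_mul h

lemma mulOp_zero : mulOp (0 : Smooth N) = 0 := LinearMap.ext fun h => zero_mul h

lemma partialOp_mul_mulOp (i : Fin N) (f : Smooth N) :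
    partialOp i * mulOp f = mulOp f * partialOp i + mulOp (pd i f) :=
  LinearMap.ext fun h => by
    have := partialOp_mul i f h
    simp only [Module.End.mul_apply, LinearMap.add_apply, mulOp_apply, pd_apply] at *
    rw [this]; ring

lemma mulOp_comm (f g : Smooth N) : mulOp f * mulOp g = mulOp g * mulOp f := by
  rw [← mulOp_mul, mul_comm, mulOp_mul]

/-! ### Symbols of differential operators -/

/-- Full symbols of differential operators: polynomials in the dual variables `p_i` with smooth
coefficients. -/
abbrev Sym (N : ℕ) : Type := MvPolynomial (Fin N) (Smooth N)

/-- The derivative `∂^m` for a multi-index `m`. -/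
def dmon (m : Fin N →₀ ℕ) : Op N := D (Finsupp.toMultiset m).toList

lemma dmon_zero : dmon (0 : Fin N →₀ ℕ) = 1 := by simp [dmon, D]

lemma dmon_add (m n : Fin N →₀ ℕ) : dmon (m + n) = dmon m * dmon n := by
  rw [dmon, dmon, dmon, ← D_append]
  refine D_perm ?_
  rw [← Multiset.coe_eq_coe]
  simp [← Multiset.coe_add]

lemma dmon_single (i : Fin N) : dmon (Finsupp.single i 1) = partialOp i := by
  simp [dmon, D]

lemma dmon_commute_partialOp (m : Fin N →₀ ℕ) (i : Fin N) :
    dmon m * partialOp i = partialOp i * dmon m := by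
  rw [← dmon_single, ← dmon_add, add_comm, dmon_add]

/-- The differential operator with a given full symbol, coefficients written to the left. -/
def op : Sym N →ₗ[ℝ] Op N where
  toFun q := ∑ m ∈ q.support, mulOp (coeff m q) * dmon m
  map_add' p q := by
    classical
    have key : ∀ r : Sym N, r.support ⊆ p.support ∪ q.support →
        ∑ m ∈ r.support, mulOp (coeff m r) * dmon m
          = ∑ m ∈ p.support ∪ q.support, mulOp (coeff m r) * dmon m := fun r hr =>
      Finset.sum_subset hr fun m _ hm => by
        rw [notMem_support_iff.mp hm, mulOp_zero, zero_mul]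
    rw [key _ support_add, key _ subset_union_left, key _ subset_union_right,
      ← Finset.sum_add_distrib]
    simp only [coeff_add, mulOp_add, add_mul]
  map_smul' c q := by
    have : (c • q).support ⊆ q.support := support_smul
    rw [Finset.sum_subset this fun m _ hm => by
      rw [notMem_support_iff.mp hm, mulOp_zero, zero_mul], RingHom.id_apply, Finset.smul_sum]
    refine Finset.sum_congr rfl fun m _ => ?_
    rw [coeff_smul, mulOp_smul, smul_mul_assoc]

lemma op_monomial (m : Fin N →₀ ℕ) (a : Smooth N) : op (monomial m a) = mulOp a * dmon m := by
  classical
  change ∑ n ∈ (monomial m a).support, mulOp (coeff n (monomial m a)) * dmon n = _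
  rw [Finset.sum_subset support_monomial_subset fun n _ hn => by
    rw [notMem_support_iff.mp hn, mulOp_zero, zero_mul]]
  simp

lemma op_C (a : Smooth N) : op (C a) = mulOp a := by
  rw [C_apply, op_monomial, dmon_zero, mul_one]

lemma op_one : op (1 : Sym N) = 1 := by rw [← C_1, op_C, mulOp_one]

lemma op_C_mul (a : Smooth N) (q : Sym N) : op (C a * q) = mulOp a * op q := by
  induction q using MvPolynomial.induction_on' with
  | monomial m b => rw [C_mul_monomial, op_monomial, op_monomial, mulOp_mul, mul_assoc]
  | add p q hp hq => rw [mul_add, map_add, map_add, hp, hq, mul_add]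

lemma op_X_mul (i : Fin N) (q : Sym N) : op (X i * q) = op q * partialOp i := by
  induction q using MvPolynomial.induction_on' with
  | monomial m b =>
    rw [X, monomial_mul, one_mul, op_monomial, op_monomial, add_comm, dmon_add, dmon_single,
      mul_assoc]
  | add p q hp hq => rw [mul_add, map_add, map_add, hp, hq, add_mul]

lemma op_X (i : Fin N) : op (X i : Sym N) = partialOp i := by
  rw [← mul_one (X i), op_X_mul, op_one, one_mul]

/-- The derivative of the coefficients of a symbol. -/
def cpd (i : Fin N) : Sym N →ₗ[ℝ] Sym N where
  toFun q := ∑ m ∈ q.support, monomial m (pd i (coeff m q))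
  map_add' p q := by
    classical
    have key : ∀ r : Sym N, r.support ⊆ p.support ∪ q.support →
        ∑ m ∈ r.support, monomial m (pd i (coeff m r))
          = ∑ m ∈ p.support ∪ q.support, monomial m (pd i (coeff m r)) := fun r hr =>
      Finset.sum_subset hr fun m _ hm => by
        rw [notMem_support_iff.mp hm, map_zero, map_zero]
    rw [key _ support_add, key _ subset_union_left, key _ subset_union_right,
      ← Finset.sum_add_distrib]
    simp only [coeff_add, map_add]
  map_smul' c q := by
    have : (c • q).support ⊆ q.support := support_smul
    rw [Finset.sum_subset this fun m _ hm => by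
      rw [notMem_support_iff.mp hm, map_zero, map_zero], RingHom.id_apply, Finset.smul_sum]
    refine Finset.sum_congr rfl fun m _ => ?_
    rw [coeff_smul, (pd i).map_smul, smul_monomial]

lemma cpd_monomial (i : Fin N) (m : Fin N →₀ ℕ) (a : Smooth N) :
    cpd i (monomial m a) = monomial m (pd i a) := by
  classical
  change ∑ n ∈ (monomial m a).support, monomial n (pd i (coeff n (monomial m a))) = _
  rw [Finset.sum_subset support_monomial_subset fun n _ hn => by
    rw [notMem_support_iff.mp hn, map_zero, map_zero]]
  simp

lemma coeff_cpd (i : Fin N) (m : Fin N →₀ ℕ) (q : Sym N) :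
    coeff m (cpd i q) = pd i (coeff m q) := by
  classical
  induction q using MvPolynomial.induction_on' with
  | monomial n b =>
    rw [cpd_monomial, coeff_monomial, coeff_monomial]
    split_ifs <;> simp
  | add p q hp hq => rw [map_add, coeff_add, coeff_add, map_add, hp, hq]

lemma cpd_C (i : Fin N) (a : Smooth N) : cpd i (C a) = C (pd i a) := by
  rw [C_apply, cpd_monomial, C_apply]

lemma cpd_X_mul (i j : Fin N) (q : Sym N) : cpd i (X j * q) = X j * cpd i q := by
  induction q using MvPolynomial.induction_on' with
  | monomial m b => rw [X, monomial_mul, cpd_monomial, cpd_monomial, monomial_mul, one_mul, one_mul]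
  | add p q hp hq => rw [mul_add, map_add, map_add, hp, hq, mul_add]

lemma cpd_mul (i : Fin N) (p q : Sym N) : cpd i (p * q) = p * cpd i q + q * cpd i p := by
  induction p using MvPolynomial.induction_on generalizing q with
  | C a =>
    rw [cpd_C]
    induction q using MvPolynomial.induction_on' with
    | monomial m b =>
      rw [C_mul_monomial, cpd_monomial, cpd_monomial, C_mul_monomial, Derivation.leibniz,
        map_add, smul_eq_mul, smul_eq_mul, mul_comm _ (C _), C_mul_monomial, mul_comm b]
    | add p q hp hq => rw [mul_add, map_add, map_add, hp, hq]; ring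
  | add p r hp hr => rw [add_mul, map_add, map_add, hp, hr]; ring
  | mul_X p j hp =>
    rw [mul_assoc, hp, cpd_X_mul, mul_comm p (X j), cpd_X_mul]; ring

lemma cpd_X (i j : Fin N) : cpd i (X j : Sym N) = 0 := by
  rw [X, cpd_monomial]; simp

lemma cpd_comm (i j : Fin N) (q : Sym N) : cpd i (cpd j q) = cpd j (cpd i q) := by
  ext1 m; simp only [coeff_cpd, pd_comm i j]

lemma cpd_pderiv (i j : Fin N) (q : Sym N) : cpd i (pderiv j q) = pderiv j (cpd i q) := by
  ext1 m
  rw [coeff_cpd, coeff_pderiv, coeff_pderiv, coeff_cpd, Derivation.leibniz,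
    map_add, Derivation.map_natCast, Derivation.map_one_eq_zero, add_zero, smul_zero, zero_add,
    smul_eq_mul, mul_comm]

lemma partialOp_mul_op (i : Fin N) (q : Sym N) :
    partialOp i * op q = op (X i * q + cpd i q) := by
  rw [map_add, op_X_mul]
  induction q using MvPolynomial.induction_on' with
  | monomial m b =>
    rw [cpd_monomial, op_monomial, op_monomial, ← mul_assoc, partialOp_mul_mulOp, add_mul,
      mul_assoc, mul_assoc, dmon_commute_partialOp]
  | add p q hp hq => simp only [mul_add, map_add, hp, hq, add_mul]; abel

lemma op_mul_mulOp_coord (k : Fin N) (q : Sym N) :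
    op q * mulOp (coord k) = mulOp (coord k) * op q + op (pderiv k q) := by
  induction q using MvPolynomial.induction_on with
  | C a => rw [pderiv_C, op_C, map_zero, add_zero, mulOp_comm]
  | add p q hp hq => simp only [map_add, add_mul, mul_add, hp, hq]; abel
  | mul_X p j hp =>
    rw [mul_comm, op_X_mul, mul_assoc, partialOp_mul_mulOp, mul_add, ← mul_assoc, hp,
      Derivation.leibniz, pd_coord, map_add, smul_eq_mul, smul_eq_mul, op_X_mul, pderiv_X]
    by_cases h : j = k
    · subst h; simp [mulOp_one]; noncomm_ring
    · simp [h, mulOp_zero, Ne.symm h]; noncomm_ring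

/-- Symbols of degree `< n`. -/
def degLT (N n : ℕ) : Submodule ℝ (Sym N) where
  carrier := {q | ∀ m : Fin N →₀ ℕ, n ≤ m.degree → coeff m q = 0}
  zero_mem' := fun m _ => coeff_zero m
  add_mem' := fun {p q} hp hq m hm => by rw [coeff_add, hp m hm, hq m hm, add_zero]
  smul_mem' := fun c q hq m hm => by rw [coeff_smul, hq m hm, smul_zero]

lemma degLT_mono {a b : ℕ} (h : a ≤ b) {q : Sym N} (hq : q ∈ degLT N a) : q ∈ degLT N b :=
  fun m hm => hq m (h.trans hm)

lemma eq_zero_of_mem_degLT_zero {q : Sym N} (hq : q ∈ degLT N 0) : q = 0 := by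
  ext1 m; exact hq m (Nat.zero_le _)

lemma mul_mem_degLT {a b : ℕ} {q r : Sym N} (hq : q ∈ degLT N a) (hr : r ∈ degLT N b) :
    q * r ∈ degLT N (a + b - 1) := by
  classical
  intro m hm
  rw [coeff_mul]
  refine Finset.sum_eq_zero fun x hx => ?_
  rw [HasAntidiagonal.mem_antidiagonal] at hx
  by_cases h : a ≤ x.1.degree
  · rw [hq _ h, zero_mul]
  · rw [hr x.2, mul_zero]
    have : x.1.degree + x.2.degree = m.degree := by rw [← hx, map_add]
    omega

lemma pderiv_mem_degLT {a : ℕ} {q : Sym N} (hq : q ∈ degLT N a) (i : Fin N) :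
    pderiv i q ∈ degLT N (a - 1) := by
  intro m hm
  rw [coeff_pderiv, hq, zero_mul]
  rw [map_add, Finsupp.degree_single]
  omega

lemma cpd_mem_degLT {a : ℕ} {q : Sym N} (hq : q ∈ degLT N a) (i : Fin N) :
    cpd i q ∈ degLT N a := by
  intro m hm
  rw [coeff_cpd, hq m hm, map_zero]

lemma exists_mem_degLT (q : Sym N) : ∃ n, q ∈ degLT N n := by
  refine ⟨q.totalDegree + 1, fun m hm => ?_⟩
  refine coeff_eq_zero_of_totalDegree_lt ?_
  rw [← Finsupp.degree_apply]; omega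

lemma isHomogeneous_mem_degLT {d : ℕ} {q : Sym N} (hq : q.IsHomogeneous d) :
    q ∈ degLT N (d + 1) := fun m hm => hq.coeff_eq_zero (by omega)

lemma C_mem_degLT (a : Smooth N) : C a ∈ degLT N 1 :=
  isHomogeneous_mem_degLT (isHomogeneous_C _ a)

lemma X_mem_degLT (i : Fin N) : X i ∈ degLT N 2 :=
  isHomogeneous_mem_degLT (isHomogeneous_X _ i)

lemma sum_homogeneousComponent_of_mem_degLT {n : ℕ} {q : Sym N} (hq : q ∈ degLT N n) :
    ∑ d ∈ range n, homogeneousComponent d q = q := by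
  classical
  ext1 m
  simp only [coeff_sum, coeff_homogeneousComponent]
  rw [Finset.sum_ite_eq]
  split_ifs with h
  · rfl
  · exact (hq m (by simpa using h)).symm

/-- The symbol of the composition of two operators is `∑_k bid k q r`, where `bid k q r` is
`1 / k! ∑ ∂_{p_{i₁}} ⋯ ∂_{p_{i_k}} q · ∂_{i₁} ⋯ ∂_{i_k} r`. -/
def bid : ℕ → Sym N → Sym N → Sym N
  | 0, q, r => q * r
  | k + 1, q, r => (1 / ((k : ℝ) + 1)) • ∑ l, bid k (pderiv l q) (cpd l r)

lemma bid_zero (q r : Sym N) : bid 0 q r = q * r := rfl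

lemma bid_succ (k : ℕ) (q r : Sym N) :
    bid (k + 1) q r = (1 / ((k : ℝ) + 1)) • ∑ l, bid k (pderiv l q) (cpd l r) := rfl

lemma bid_add_left (k : ℕ) (p q r : Sym N) : bid k (p + q) r = bid k p r + bid k q r := by
  induction k generalizing p q r with
  | zero => exact add_mul p q r
  | succ k ih => simp only [bid_succ, map_add, ih, Finset.sum_add_distrib, smul_add]

lemma bid_zero_left (k : ℕ) (r : Sym N) : bid k 0 r = 0 := by
  induction k generalizing r with
  | zero => exact zero_mul r
  | succ k ih => simp only [bid_succ, map_zero, ih, Finset.sum_const_zero, smul_zero]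

lemma bid_mem_degLT {a b : ℕ} (k : ℕ) {q r : Sym N} (hq : q ∈ degLT N a) (hr : r ∈ degLT N b) :
    bid k q r ∈ degLT N (a - k + b - 1) := by
  induction k generalizing a q r with
  | zero => exact mul_mem_degLT hq hr
  | succ k ih =>
    refine Submodule.smul_mem _ _ (Submodule.sum_mem _ fun l _ => ?_)
    have := ih (pderiv_mem_degLT hq l) (cpd_mem_degLT hr l)
    rwa [Nat.sub_sub, add_comm 1 k] at this

lemma bid_eq_zero {k : ℕ} {q : Sym N} (hq : q ∈ degLT N k) (r : Sym N) : bid k q r = 0 := by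
  induction k generalizing q r with
  | zero => rw [eq_zero_of_mem_degLT_zero hq, bid_zero_left]
  | succ k ih =>
    rw [bid_succ, Finset.sum_eq_zero fun l _ => ih (pderiv_mem_degLT hq l) _, smul_zero]

lemma bid_X_mul_right (k : ℕ) (q r : Sym N) (j : Fin N) :
    bid k q (X j * r) = X j * bid k q r := by
  induction k generalizing q r with
  | zero => simp only [bid_zero]; ring
  | succ k ih => simp only [bid_succ, cpd_X_mul, ih, mul_smul_comm, Finset.mul_sum]

lemma pderiv_X_mul (i l : Fin N) (q : Sym N) :
    pderiv l (X i * q) = X i * pderiv l q + if l = i then q else 0 := by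
  rw [pderiv_mul, pderiv_X, add_comm]
  by_cases h : l = i
  · subst h; simp
  · simp [h, Ne.symm h]

lemma smul_add_one_smul {M : Type*} [AddCommGroup M] [Module ℝ M] (t : ℝ) (a : M) :
    t • a + a = (t + 1) • a := by rw [add_smul, one_smul]

/-- Leibniz rule for `bid` in a dual variable. It is the step of the induction for the composition
formula: `p_i` is differentiated once or not at all. -/
lemma bid_succ_X_mul_left (k : ℕ) (q r : Sym N) (i : Fin N) :
    bid (k + 1) (X i * q) r = X i * bid (k + 1) q r + bid k q (cpd i r) := by
  have aux : ∀ (k : ℕ) (q r : Sym N),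
      ∑ l, bid k (if l = i then q else 0) (cpd l r) = bid k q (cpd i r) := by
    intro k q r
    rw [Finset.sum_eq_single i (fun l _ hl => by rw [if_neg hl, bid_zero_left])
      (fun h => absurd (Finset.mem_univ i) h), if_pos rfl]
  induction k generalizing q r with
  | zero =>
    simp only [bid_succ, pderiv_X_mul, bid_add_left, Finset.sum_add_distrib, aux]
    simp only [bid_zero, Nat.cast_zero, zero_add, div_one, one_smul, Finset.mul_sum, mul_assoc]
  | succ k ih =>
    rw [bid_succ]
    simp only [pderiv_X_mul, bid_add_left, Finset.sum_add_distrib, aux, ih, cpd_comm i]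
    rw [bid_succ (k + 1) q r, mul_smul_comm, ← Finset.mul_sum]
    have h : ∑ l, bid k (pderiv l q) (cpd l (cpd i r))
        = ((k : ℝ) + 1) • bid (k + 1) q (cpd i r) := by
      rw [bid_succ, smul_smul, mul_one_div_cancel (by positivity), one_smul]
    rw [h, add_assoc, smul_add]
    congr 1
    rw [smul_add_one_smul (M := Sym N), smul_smul]
    push_cast
    rw [one_div_mul_cancel (by positivity), one_smul]

/-- The composition formula for differential operators. -/
theorem op_mul_op {K : ℕ} {q : Sym N} (hq : q ∈ degLT N K) (r : Sym N) :
    op q * op r = op (∑ k ∈ range K, bid k q r) := by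
  have key : ∀ (q r : Sym N), ∃ K₀, ∀ K ≥ K₀, op q * op r = op (∑ k ∈ range K, bid k q r) := by
    intro q
    induction q using MvPolynomial.induction_on with
    | C a =>
      refine fun r => ⟨1, fun K hK => ?_⟩
      rw [Finset.sum_eq_single_of_mem 0 (by simp; omega) fun k _ hk => bid_eq_zero
        (degLT_mono (by omega) (C_mem_degLT a)) r, bid_zero, op_C_mul, op_C]
    | add p q hp hq =>
      intro r
      obtain ⟨K₁, h₁⟩ := hp r
      obtain ⟨K₂, h₂⟩ := hq r
      refine ⟨max K₁ K₂, fun K hK => ?_⟩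
      rw [map_add, add_mul, h₁ K (le_of_max_le_left hK), h₂ K (le_of_max_le_right hK), ← map_add,
        ← Finset.sum_add_distrib]
      simp only [bid_add_left]
    | mul_X q i hq =>
      intro r
      obtain ⟨K₁, h₁⟩ := hq (X i * r)
      obtain ⟨K₂, h₂⟩ := hq (cpd i r)
      refine ⟨max K₁ K₂ + 1, fun K hK => ?_⟩
      obtain ⟨L, rfl⟩ : ∃ L, K = L + 1 := ⟨K - 1, by omega⟩
      have h3 : max K₁ K₂ ≤ L := by omega
      rw [mul_comm q, op_X_mul, mul_assoc, partialOp_mul_op, map_add, mul_add,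
        h₁ (L + 1) ((le_of_max_le_left h3).trans (Nat.le_succ _)),
        h₂ L (le_of_max_le_right h3), ← map_add]
      congr 1
      rw [Finset.sum_range_succ' _ L, Finset.sum_range_succ' _ L]
      simp only [bid_succ_X_mul_left, bid_X_mul_right, Finset.sum_add_distrib, bid_zero]
      ring
  obtain ⟨K₀, h⟩ := key q r
  rw [h (max K K₀) (le_max_right _ _)]
  congr 1
  refine (Finset.sum_subset (Finset.range_mono (le_max_left _ _)) fun k _ hk => ?_).symm
  exact bid_eq_zero (degLT_mono (by simpa using hk) hq) r

/-! ### Values of symbols, and uniqueness of the symbol -/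

lemma op_apply_one (q : Sym N) : op q 1 = constantCoeff q := by
  induction q using MvPolynomial.induction_on with
  | C a => rw [op_C, mulOp_apply, mul_one, constantCoeff_C]
  | add p q hp hq => rw [map_add, LinearMap.add_apply, hp, hq, map_add]
  | mul_X q i _ =>
    rw [mul_comm, op_X_mul, map_mul, constantCoeff_X, zero_mul, Module.End.mul_apply]
    have : partialOp i (1 : Smooth N) = 0 := (pd i).map_one_eq_zero
    rw [this, map_zero]

/-- The value of a symbol at a constant covector. -/
def val (c : Fin N → ℝ) : Sym N →ₐ[Smooth N] Smooth N :=
  aeval fun i => algebraMap ℝ (Smooth N) (c i)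

lemma val_C (c : Fin N → ℝ) (a : Smooth N) : val c (C a) = a := by simp [val]

lemma val_X (c : Fin N → ℝ) (i : Fin N) : val c (X i) = algebraMap ℝ (Smooth N) (c i) := by
  simp [val]

lemma val_smul (c : Fin N → ℝ) (t : ℝ) (q : Sym N) : val c (t • q) = t • val c q := by
  rw [← smul_one_smul (Smooth N) t q, map_smul, smul_one_smul]

lemma val_scale {d : ℕ} {q : Sym N} (hq : q.IsHomogeneous d) (t : ℝ) (c : Fin N → ℝ) :
    val (t • c) q = t ^ d • val c q := by
  simp only [val, aeval_def, eval₂_eq', Algebra.algebraMap_self, RingHom.id_apply,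
    Finset.smul_sum]
  refine Finset.sum_congr rfl fun m hm => ?_
  have hd : ∑ i, m i = d := by
    simpa [Finsupp.weight_apply, Finsupp.sum_fintype] using hq (mem_support_iff.mp hm)
  simp only [Pi.smul_apply, smul_eq_mul, map_mul, mul_pow, Finset.prod_mul_distrib,
    Finset.prod_pow_eq_pow_sum, hd]
  rw [← map_pow, Algebra.smul_def]
  ring

lemma eq_zero_of_val_eq_zero {q : Sym N} (h : ∀ c, val c q = 0) : q = 0 := by
  ext1 m
  ext x
  let ev : Smooth N →+* ℝ := (Pi.evalRingHom (fun _ : Fin N → ℝ => ℝ) x).comp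
    (Smooth N).val.toRingHom
  have h1 : MvPolynomial.map ev q = 0 := by
    refine MvPolynomial.funext fun c => ?_
    have h2 := congrArg ev (h c)
    rw [map_zero, val, aeval_def, hom_eval₂] at h2
    rw [map_zero, eval_map]
    exact h2
  have := congrArg (coeff m) h1
  rw [coeff_map, coeff_zero] at this
  exact this

/-- The derivative of a symbol in the direction of a constant covector. -/
def dirD (c : Fin N → ℝ) (q : Sym N) : Sym N := ∑ i, c i • pderiv i q

lemma dirD_add (c : Fin N → ℝ) (p q : Sym N) : dirD c (p + q) = dirD c p + dirD c q := by
  simp only [dirD, map_add, smul_add, Finset.sum_add_distrib]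

lemma dirD_zero (c : Fin N → ℝ) : dirD c (0 : Sym N) = 0 := by
  simp [dirD]

lemma dirD_C (c : Fin N → ℝ) (a : Smooth N) : dirD c (C a) = 0 := by
  simp [dirD]

lemma dirD_X_mul (c : Fin N → ℝ) (i : Fin N) (q : Sym N) :
    dirD c (X i * q) = X i * dirD c q + c i • q := by
  simp only [dirD, pderiv_X_mul, smul_add, Finset.sum_add_distrib, Finset.mul_sum,
    mul_smul_comm, smul_ite, smul_zero]
  simp

lemma dirD_mem_degLT {a : ℕ} {q : Sym N} (hq : q ∈ degLT N a) (c : Fin N → ℝ) :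
    dirD c q ∈ degLT N (a - 1) :=
  Submodule.sum_mem _ fun i _ => Submodule.smul_mem _ _ (pderiv_mem_degLT hq i)

lemma dirD_smul (c : Fin N → ℝ) (t : ℝ) (q : Sym N) : dirD c (t • q) = t • dirD c q := by
  simp only [dirD, Derivation.map_smul_of_tower, Finset.smul_sum, smul_comm t]

lemma dirD_iterate_add (c : Fin N → ℝ) (k : ℕ) (p q : Sym N) :
    (dirD c)^[k] (p + q) = (dirD c)^[k] p + (dirD c)^[k] q := by
  induction k generalizing p q with
  | zero => rfl
  | succ k ih => simp only [Function.iterate_succ_apply, dirD_add, ih]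

lemma dirD_iterate_smul (c : Fin N → ℝ) (k : ℕ) (t : ℝ) (q : Sym N) :
    (dirD c)^[k] (t • q) = t • (dirD c)^[k] q := by
  induction k generalizing q with
  | zero => rfl
  | succ k ih => simp only [Function.iterate_succ_apply, dirD_smul, ih]

lemma dirD_iterate_X_mul (c : Fin N → ℝ) (k : ℕ) (i : Fin N) (q : Sym N) :
    (dirD c)^[k + 1] (X i * q)
      = X i * (dirD c)^[k + 1] q + ((k : ℝ) + 1) • c i • (dirD c)^[k] q := by
  induction k generalizing q with
  | zero => simp [dirD_X_mul]
  | succ k ih =>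
    rw [Function.iterate_succ_apply, dirD_X_mul, dirD_iterate_add, ih, dirD_iterate_smul,
      ← Function.iterate_succ_apply, ← Function.iterate_succ_apply, add_assoc]
    push_cast
    congr 1
    exact smul_add_one_smul (M := Sym N) _ _

lemma dirD_iterate_eq_zero {k : ℕ} {q : Sym N} (hq : q ∈ degLT N k) (c : Fin N → ℝ) :
    (dirD c)^[k] q = 0 := by
  induction k generalizing q with
  | zero => exact eq_zero_of_mem_degLT_zero hq
  | succ k ih => exact ih (dirD_mem_degLT hq c)

lemma constantCoeff_smul_real (t : ℝ) (q : Sym N) :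
    constantCoeff (t • q) = t • constantCoeff q := by
  rw [constantCoeff_eq, coeff_smul]

/-- Taylor's formula at the zero covector. -/
lemma val_eq_sum_dirD {K : ℕ} {q : Sym N} (hq : q ∈ degLT N K) (c : Fin N → ℝ) :
    val c q = ∑ m ∈ range K, (1 / (m.factorial : ℝ)) • constantCoeff ((dirD c)^[m] q) := by
  have key : ∀ q : Sym N, ∃ K₀, ∀ K ≥ K₀, val c q
      = ∑ m ∈ range K, (1 / (m.factorial : ℝ)) • constantCoeff ((dirD c)^[m] q) := by
    intro q
    induction q using MvPolynomial.induction_on with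
    | C a =>
      refine ⟨1, fun K hK => ?_⟩
      rw [Finset.sum_eq_single_of_mem 0 (by simp; omega) fun k _ hk => ?_]
      · simp
      · obtain ⟨j, rfl⟩ := Nat.exists_eq_succ_of_ne_zero hk
        rw [dirD_iterate_eq_zero (degLT_mono (by omega) (C_mem_degLT a)), map_zero, smul_zero]
    | add p q hp hq =>
      obtain ⟨K₁, h₁⟩ := hp
      obtain ⟨K₂, h₂⟩ := hq
      refine ⟨max K₁ K₂, fun K hK => ?_⟩
      rw [map_add, h₁ K (le_of_max_le_left hK), h₂ K (le_of_max_le_right hK),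
        ← Finset.sum_add_distrib]
      simp only [dirD_iterate_add, map_add, smul_add]
    | mul_X q i hq =>
      obtain ⟨K₁, h₁⟩ := hq
      refine ⟨K₁ + 1, fun K hK => ?_⟩
      obtain ⟨L, rfl⟩ : ∃ L, K = L + 1 := ⟨K - 1, by omega⟩
      rw [mul_comm, map_mul, val_X, h₁ L (by omega), Finset.sum_range_succ', Finset.mul_sum]
      simp only [dirD_iterate_X_mul, map_add, map_mul, constantCoeff_X, zero_mul, zero_add,
        constantCoeff_smul_real, Function.iterate_zero, id, smul_zero, add_zero]
      refine Finset.sum_congr rfl fun m _ => ?_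
      rw [← Algebra.smul_def, smul_smul, smul_smul, smul_smul, Nat.factorial_succ]
      congr 1
      push_cast
      field_simp
  obtain ⟨K₀, h⟩ := key q
  rw [h (max K K₀) (le_max_right _ _)]
  refine (Finset.sum_subset (Finset.range_mono (le_max_left _ _)) fun k _ hk => ?_).symm
  rw [dirD_iterate_eq_zero (degLT_mono (by simpa using hk) hq), map_zero, smul_zero]

/-- The linear function `c · x`. -/
def lin (c : Fin N → ℝ) : Smooth N := ∑ i, c i • coord i

lemma op_mul_mulOp_lin (c : Fin N → ℝ) (q : Sym N) :
    op q * mulOp (lin c) = mulOp (lin c) * op q + op (dirD c q) := by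
  simp only [lin, dirD, mulOp_sum, mulOp_smul, Finset.mul_sum, Finset.sum_mul, map_sum, map_smul,
    mul_smul_comm, smul_mul_assoc, ← Finset.sum_add_distrib, ← smul_add, op_mul_mulOp_coord]

/-- A differential operator that annihilates the powers of all linear functions vanishes. -/
theorem eq_zero_of_op_lin_pow {q : Sym N} (h : ∀ (c : Fin N → ℝ) (n : ℕ), op q (lin c ^ n) = 0) :
    q = 0 := by
  refine eq_zero_of_val_eq_zero fun c => ?_
  obtain ⟨K, hK⟩ := exists_mem_degLT q
  -- the commutator with `c · x` differentiates the symbol in the direction `c`, so that all terms of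
  -- the Taylor expansion of the symbol at the zero covector vanish
  rw [val_eq_sum_dirD hK]
  refine Finset.sum_eq_zero fun m _ => ?_
  have key : ∀ m n, op ((dirD c)^[m] q) (lin c ^ n) = 0 := by
    intro m
    induction m with
    | zero => exact h c
    | succ m ih =>
      intro n
      have h1 := LinearMap.congr_fun (op_mul_mulOp_lin c ((dirD c)^[m] q)) (lin c ^ n)
      simp only [Module.End.mul_apply, LinearMap.add_apply, mulOp_apply, ih n, mul_zero,
        zero_add, ← pow_succ', ih (n + 1)] at h1
      rw [Function.iterate_succ_apply', ← h1]
  rw [← op_apply_one, ← pow_zero (lin c), key, smul_zero]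

lemma op_injective : Function.Injective (op : Sym N → Op N) := by
  refine (injective_iff_map_eq_zero _).mpr fun q hq => eq_zero_of_op_lin_pow fun c n => ?_
  rw [hq, LinearMap.zero_apply]

/-- The exponential function `e^{c · x}`. -/
def expo (c : Fin N → ℝ) : Smooth N :=
  ⟨fun x => Real.exp ((lin c : (Fin N → ℝ) → ℝ) x), (smooth_contDiff (lin c)).exp⟩

lemma pd_lin (i : Fin N) (c : Fin N → ℝ) : pd i (lin c) = algebraMap ℝ (Smooth N) (c i) := by
  simp only [lin, map_sum, Derivation.map_smul, pd_coord]
  simp [Algebra.algebraMap_eq_smul_one]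

lemma partialOp_expo (i : Fin N) (c : Fin N → ℝ) : partialOp i (expo c) = c i • expo c := by
  ext x
  rw [partialOp_apply]
  change fderiv ℝ (fun y => Real.exp ((lin c : (Fin N → ℝ) → ℝ) y)) x _ = _
  rw [fderiv_exp (smooth_differentiableAt _ _)]
  have h := congrArg (fun f : Smooth N => (f : (Fin N → ℝ) → ℝ) x) (pd_lin i c)
  simp only [pd_apply, partialOp_apply] at h
  simp only [smul_apply, h, smul_eq_mul]
  exact mul_comm _ _

lemma op_expo (c : Fin N → ℝ) (q : Sym N) : op q (expo c) = val c q * expo c := by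
  induction q using MvPolynomial.induction_on with
  | C a => rw [op_C, val_C, mulOp_apply]
  | add p q hp hq => rw [map_add, LinearMap.add_apply, hp, hq, map_add, add_mul]
  | mul_X q i hq =>
    rw [mul_comm, op_X_mul, Module.End.mul_apply, partialOp_expo, map_smul, hq, map_mul, val_X,
      mul_assoc, ← Algebra.smul_def]

lemma expo_mul_expo_neg (c : Fin N → ℝ) : expo c * expo (-c) = 1 := by
  have : lin (-c) = -lin c := by simp [lin]
  ext x
  change Real.exp _ * Real.exp _ = 1
  rw [← Real.exp_add, this]
  simp

lemma expo_mul_cancel {c : Fin N → ℝ} {f g : Smooth N} (h : f * expo c = g * expo c) : f = g := by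
  have := congrArg (· * expo (-c)) h
  simpa only [mul_assoc, expo_mul_expo_neg, mul_one] using this

section

/-! Shortcuts for instance search: the algebraic structures on operators, formal operators and symbols
are used through these instances. -/

local instance opRing (N : ℕ) : Ring (Op N) := inferInstance
local instance opAddCommGroup (N : ℕ) : AddCommGroup (Op N) := Ring.toAddCommGroup
local instance opSub (N : ℕ) : Sub (Op N) := Ring.toSub
local instance formalOpRing (N : ℕ) : Ring (FormalOp N) := inferInstance
local instance symCommRing (N : ℕ) : CommRing (Sym N) := inferInstance
local instance symAddCommGroup (N : ℕ) : AddCommGroup (Sym N) := Ring.toAddCommGroup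
local instance symSub (N : ℕ) : Sub (Sym N) := Ring.toSub

/-! ### Orders of differential operators -/

/-- Differential operators of order `< n`. -/
def ordLT (N n : ℕ) : Submodule ℝ (Op N) := (degLT N n).map op

lemma op_mem_ordLT {n : ℕ} {q : Sym N} (hq : q ∈ degLT N n) : op q ∈ ordLT N n :=
  Submodule.mem_map_of_mem hq

lemma ordLT_mono {a b : ℕ} (h : a ≤ b) {P : Op N} (hP : P ∈ ordLT N a) : P ∈ ordLT N b :=
  Submodule.map_mono (fun _ hq => degLT_mono h hq) hP

lemma eq_zero_of_mem_ordLT_zero {P : Op N} (hP : P ∈ ordLT N 0) : P = 0 := by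
  obtain ⟨q, hq, rfl⟩ := hP
  rw [eq_zero_of_mem_degLT_zero hq, map_zero]

lemma mulOp_mem_ordLT (f : Smooth N) : mulOp f ∈ ordLT N 1 := by
  rw [← op_C]; exact op_mem_ordLT (C_mem_degLT f)

lemma mul_mem_ordLT {a b : ℕ} {P Q : Op N} (hP : P ∈ ordLT N a) (hQ : Q ∈ ordLT N b) :
    P * Q ∈ ordLT N (a + b - 1) := by
  obtain ⟨q, hq, rfl⟩ := hP
  obtain ⟨r, hr, rfl⟩ := hQ
  rw [op_mul_op hq]
  exact op_mem_ordLT (Submodule.sum_mem _ fun k _ =>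
    degLT_mono (by omega) (bid_mem_degLT k hq hr))

lemma commutator_mem_ordLT {a b : ℕ} {P Q : Op N} (hP : P ∈ ordLT N a) (hQ : Q ∈ ordLT N b) :
    P * Q - Q * P ∈ ordLT N (a + b - 2) := by
  rcases a with _ | a
  · rw [eq_zero_of_mem_ordLT_zero hP, zero_mul, mul_zero, sub_zero]; exact zero_mem _
  rcases b with _ | b
  · rw [eq_zero_of_mem_ordLT_zero hQ, zero_mul, mul_zero, sub_zero]; exact zero_mem _
  obtain ⟨q, hq, rfl⟩ := hP
  obtain ⟨r, hr, rfl⟩ := hQ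
  rw [op_mul_op hq, op_mul_op hr, ← map_sub, Finset.sum_range_succ', Finset.sum_range_succ',
    bid_zero, bid_zero, mul_comm r q, add_sub_add_right_eq_sub]
  refine op_mem_ordLT (Submodule.sub_mem _ (Submodule.sum_mem _ fun k _ => ?_)
    (Submodule.sum_mem _ fun k _ => ?_))
  · exact degLT_mono (by omega) (bid_mem_degLT (k + 1) hq hr)
  · exact degLT_mono (by omega) (bid_mem_degLT (k + 1) hr hq)

/-- Commutators with the coordinates lower the order. -/
lemma bracket_coord_mem_ordLT {n : ℕ} {P : Op N} (hP : P ∈ ordLT N n) (i : Fin N) :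
    P * mulOp (coord i) - mulOp (coord i) * P ∈ ordLT N (n - 1) := by
  have := commutator_mem_ordLT hP (mulOp_mem_ordLT (coord i))
  exact ordLT_mono (by omega) this

lemma partialOp_mem_ordLT (i : Fin N) : partialOp i ∈ ordLT N 2 := by
  rw [← op_X]; exact op_mem_ordLT (X_mem_degLT i)

lemma D_mem_ordLT (I : List (Fin N)) : D I ∈ ordLT N (I.length + 1) := by
  induction I with
  | nil => rw [D_nil, ← mulOp_one]; exact mulOp_mem_ordLT 1
  | cons i I ih =>
    rw [D_cons]
    exact ordLT_mono (by simp only [List.length_cons]; omega)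
      (mul_mem_ordLT (partialOp_mem_ordLT i) ih)

/-- The differential operators of arbitrary finite order. -/
def diffOp (N : ℕ) : Subalgebra ℝ (Op N) where
  carrier := {P | ∃ n, P ∈ ordLT N n}
  mul_mem' := fun ⟨_, ha⟩ ⟨_, hb⟩ => ⟨_, mul_mem_ordLT ha hb⟩
  add_mem' := fun {P Q} ⟨a, ha⟩ ⟨b, hb⟩ => ⟨max a b, Submodule.add_mem _
    (ordLT_mono (le_max_left _ _) ha) (ordLT_mono (le_max_right _ _) hb)⟩
  algebraMap_mem' c := ⟨1, by
    rw [Algebra.algebraMap_eq_smul_one, ← mulOp_one, ← mulOp_smul]; exact mulOp_mem_ordLT _⟩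

lemma mem_diffOp {n : ℕ} {P : Op N} (h : P ∈ ordLT N n) : P ∈ diffOp N := ⟨n, h⟩

lemma eq_zero_of_lin_pow {P : Op N} (hP : P ∈ diffOp N)
    (h : ∀ (c : Fin N → ℝ) (n : ℕ), P (lin c ^ n) = 0) : P = 0 := by
  obtain ⟨n, q, hq, rfl⟩ := hP
  rw [eq_zero_of_op_lin_pow h, map_zero]

lemma eq_zero_of_expo {P : Op N} (hP : P ∈ diffOp N)
    (h : ∀ c : Fin N → ℝ, P (expo c) = 0) : P = 0 := by
  obtain ⟨n, q, hq, rfl⟩ := hP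
  rw [eq_zero_of_val_eq_zero (q := q) fun c => ?_, map_zero]
  have := h c
  rw [op_expo] at this
  exact expo_mul_cancel (this.trans (zero_mul _).symm)

/-- A differential operator that commutes with the coordinates and annihilates `1` vanishes. -/
lemma eq_zero_of_commute_coord {P : Op N} (hP : P ∈ diffOp N)
    (hc : ∀ i, P * mulOp (coord i) = mulOp (coord i) * P) (h : P 1 = 0) : P = 0 := by
  refine eq_zero_of_lin_pow hP fun c n => ?_
  have hl : P * mulOp (lin c) = mulOp (lin c) * P := by
    simp only [lin, mulOp_sum, mulOp_smul, Finset.mul_sum, Finset.sum_mul, mul_smul_comm,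
      smul_mul_assoc, hc]
  induction n with
  | zero => rw [pow_zero, h]
  | succ n ih =>
    have := LinearMap.congr_fun hl (lin c ^ n)
    simp only [Module.End.mul_apply, mulOp_apply, ih, mul_zero] at this
    rwa [pow_succ']

/-! ### Formal operators -/

/-- Formal operators whose `α^k`-coefficient is a differential operator of order at most `k`. -/
def Adm (Z : FormalOp N) : Prop := ∀ k, PowerSeries.coeff k Z ∈ ordLT N (k + 1)

lemma Adm.mul {Z Z' : FormalOp N} (h : Adm Z) (h' : Adm Z') : Adm (Z * Z') := by
  intro k
  rw [PowerSeries.coeff_mul]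
  refine Submodule.sum_mem _ fun x hx => ?_
  rw [HasAntidiagonal.mem_antidiagonal] at hx
  exact ordLT_mono (by omega) (mul_mem_ordLT (h x.1) (h' x.2))

lemma Adm.add {Z Z' : FormalOp N} (h : Adm Z) (h' : Adm Z') : Adm (Z + Z') := fun k => by
  rw [map_add]; exact Submodule.add_mem _ (h k) (h' k)

lemma Adm.sub {Z Z' : FormalOp N} (h : Adm Z) (h' : Adm Z') : Adm (Z - Z') := fun k => by
  rw [map_sub]; exact Submodule.sub_mem _ (h k) (h' k)

lemma adm_C_mulOp (f : Smooth N) : Adm (PowerSeries.C (mulOp f)) := fun k => by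
  rw [PowerSeries.coeff_C]
  split_ifs
  · exact ordLT_mono (by omega) (mulOp_mem_ordLT f)
  · exact zero_mem _

lemma adm_one : Adm (1 : FormalOp N) := by
  have := adm_C_mulOp (1 : Smooth N)
  rwa [mulOp_one, map_one] at this

/-- Deformations of the coordinates: `X i = x^i + O(α)`, the `α^k`-coefficient is a differential
operator of order at most `k` that annihilates constants, and, with `X i = x^i + Y i`, the
symbols satisfy `∑ p_i Y^i(p) = 0`, here formulated as `(c · Y) (c · x)^n = 0`. -/
structure IsDeformed (X : Fin N → FormalOp N) : Prop where
  zero : ∀ i, PowerSeries.coeff 0 (X i) = mulOp (coord i)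
  adm : ∀ i, Adm (X i)
  one : ∀ i k, k ≠ 0 → PowerSeries.coeff k (X i) 1 = 0
  contract : ∀ (c : Fin N → ℝ) (n k : ℕ), k ≠ 0 →
    ∑ i, c i • PowerSeries.coeff k (X i) (lin c ^ n) = 0

lemma adm_centered {X : Fin N → FormalOp N} (hX : IsDeformed X) (I : List (Fin N)) :
    Adm (centered X I) := by
  induction I with
  | nil => exact adm_one
  | cons i I ih => exact (ih.mul (hX.adm i)).sub ((adm_C_mulOp _).mul ih)

/-- Centered products of more than `2 k` factors do not contribute to the order `α^k`. -/
lemma coeff_centered_mem {X : Fin N → FormalOp N} (hX : IsDeformed X) (I : List (Fin N))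
    (k : ℕ) : PowerSeries.coeff k (centered X I) ∈ ordLT N (2 * k + 1 - I.length) := by
  induction I generalizing k with
  | nil => exact ordLT_mono (by simp; omega) (adm_one k)
  | cons i I ih =>
    rw [centered, map_sub, PowerSeries.coeff_mul, PowerSeries.coeff_C_mul]
    rw [Finset.Nat.sum_antidiagonal_eq_sum_range_succ
      (fun a b => PowerSeries.coeff a (centered X I) * PowerSeries.coeff b (X i)),
      Finset.sum_range_succ, Nat.sub_self, hX.zero, add_sub_assoc]
    refine Submodule.add_mem _ (Submodule.sum_mem _ fun a ha => ?_) ?_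
    · rw [Finset.mem_range] at ha
      by_cases h : 2 * a + 1 ≤ I.length
      · rw [eq_zero_of_mem_ordLT_zero (ordLT_mono (by omega) (ih a)), zero_mul]
        exact zero_mem _
      · exact ordLT_mono (by simp only [List.length_cons]; omega)
          (mul_mem_ordLT (ih a) (hX.adm i (k - a)))
    · exact ordLT_mono (by simp only [List.length_cons]; omega) (bracket_coord_mem_ordLT (ih k) i)

/-- Sums over tuples, split at one position. -/
lemma sum_insertNth {ι M : Type*} [Fintype ι] [AddCommMonoid M] {n : ℕ} (p : Fin (n + 1))
    (F : (Fin (n + 1) → ι) → M) :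
    ∑ I, F I = ∑ i, ∑ J : Fin n → ι, F (Fin.insertNth p i J) := by
  rw [← Fintype.sum_prod_type', ← (Fin.insertNthEquiv (fun _ => ι) p).sum_comp]
  rfl

lemma sum_cons {ι M : Type*} [Fintype ι] [AddCommMonoid M] {n : ℕ}
    (F : (Fin (n + 1) → ι) → M) :
    ∑ I, F I = ∑ i, ∑ J : Fin n → ι, F (Fin.cons i J) := by
  simp only [sum_insertNth 0, Fin.insertNth_zero']

/-- The contraction `c · X`. -/
def dot (c : Fin N → ℝ) (X : Fin N → FormalOp N) : FormalOp N := ∑ i, c i • X i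

/-- The contraction of the centered products of `m` factors with `c`. -/
def cen (X : Fin N → FormalOp N) (c : Fin N → ℝ) (m : ℕ) : FormalOp N :=
  ∑ I : Fin m → Fin N, (∏ s, c (I s)) • centered X (List.ofFn I)

lemma cen_zero (X : Fin N → FormalOp N) (c : Fin N → ℝ) : cen X c 0 = 1 := by
  simp [cen, centered]

lemma cen_succ (X : Fin N → FormalOp N) (c : Fin N → ℝ) (m : ℕ) :
    cen X c (m + 1) = cen X c m * dot c X - PowerSeries.C (mulOp (lin c)) * cen X c m := by
  have h : PowerSeries.C (mulOp (lin c)) = ∑ i, c i • PowerSeries.C (mulOp (coord i)) := by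
    ext1 k
    simp only [map_sum, PowerSeries.coeff_C, PowerSeries.coeff_smul, lin, mulOp_sum, mulOp_smul]
    split_ifs <;> simp
  rw [cen, sum_cons, cen, dot, h]
  simp only [List.ofFn_cons, centered, Fin.prod_univ_succ, Fin.cons_zero, Fin.cons_succ, smul_sub,
    Finset.sum_sub_distrib, Finset.sum_mul, Finset.mul_sum, smul_mul_assoc, mul_smul_comm]
  congr 1
  · simp only [Finset.smul_sum, smul_smul]
  · rw [Finset.sum_comm]
    simp only [Finset.smul_sum, smul_smul, mul_comm]

/-- The contracted form of `coeff_centered_mem`: an operator of order `< 0` vanishes. -/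
lemma coeff_cen_eq_zero {X : Fin N → FormalOp N} (hX : IsDeformed X) (c : Fin N → ℝ) {k m : ℕ}
    (h : 2 * k < m) : PowerSeries.coeff k (cen X c m) = 0 := by
  rw [cen, map_sum]
  refine Finset.sum_eq_zero fun I _ => ?_
  rw [PowerSeries.coeff_smul, eq_zero_of_mem_ordLT_zero
    (ordLT_mono (by rw [List.length_ofFn]; omega) (coeff_centered_mem hX (List.ofFn I) k)),
    smul_zero]

lemma D_lin_pow (c : Fin N → ℝ) (n : ℕ) (I : List (Fin N)) :
    D I (lin c ^ n) = ((n.descFactorial I.length : ℝ) * (I.map c).prod) •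
      lin c ^ (n - I.length) := by
  induction I with
  | nil => simp [D_nil]
  | cons i I ih =>
    rw [D_cons, Module.End.mul_apply, ih, ← pd_apply, Derivation.map_smul, Derivation.leibniz_pow,
      pd_lin, List.length_cons, List.map_cons, List.prod_cons, Nat.descFactorial_succ]
    rw [Algebra.algebraMap_eq_smul_one, smul_comm _ (c i), smul_eq_mul, mul_one,
      ← Nat.cast_smul_eq_nsmul ℝ, smul_smul, smul_smul, Nat.sub_sub]
    congr 1
    push_cast
    ring

/-- On powers of linear functions, Weyl ordering is `(c · x)^n ↦ (c · X)^n`. -/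
theorem weyl_lin_pow {X : Fin N → FormalOp N} (hX : IsDeformed X) (c : Fin N → ℝ) (n : ℕ) :
    weyl X (lin c ^ n) = dot c X ^ n := by
  -- the binomial formula for `R = (R - L) + L`, where `R` is right multiplication by `c · X`
  -- and `L` is left multiplication by `c · x`
  have hbin : dot c X ^ n = ∑ m ∈ range (n + 1), (n.choose m : ℝ) •
      (PowerSeries.C (mulOp (lin c ^ (n - m))) * cen X c m) := by
    let L : Module.End ℝ (FormalOp N) := LinearMap.mulLeft ℝ (PowerSeries.C (mulOp (lin c)))
    let R : Module.End ℝ (FormalOp N) := LinearMap.mulRight ℝ (dot c X)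
    have hLR : Commute (R - L) L := by
      refine Commute.sub_left (LinearMap.ext fun Z => ?_) (Commute.refl L)
      exact mul_assoc _ _ _
    have hR : ∀ m, (R ^ m) 1 = dot c X ^ m := by
      intro m
      induction m with
      | zero => rfl
      | succ m ih => rw [pow_succ', Module.End.mul_apply, ih, pow_succ]; rfl
    have hcen : ∀ m, ((R - L) ^ m) 1 = cen X c m := by
      intro m
      induction m with
      | zero => rw [cen_zero]; rfl
      | succ m ih => rw [pow_succ', Module.End.mul_apply, ih, cen_succ]; rfl
    have hL : ∀ m Z, (L ^ m) Z = PowerSeries.C (mulOp (lin c ^ m)) * Z := by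
      intro m
      induction m with
      | zero => intro Z; rw [pow_zero, pow_zero, mulOp_one, map_one, one_mul]; rfl
      | succ m ih =>
        intro Z
        rw [pow_succ, Module.End.mul_apply, ih, pow_succ, mulOp_mul, map_mul, mul_assoc]; rfl
    have h1 := hLR.add_pow n
    rw [sub_add_cancel] at h1
    rw [← hR, h1, LinearMap.sum_apply]
    refine Finset.sum_congr rfl fun m _ => ?_
    rw [(hLR.pow_pow m (n - m)).eq, mul_assoc, Module.End.mul_apply, hL,
      (Nat.commute_cast ((R - L) ^ m) _).eq, Module.End.mul_apply, hcen, Module.End.natCast_apply,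
      Nat.cast_smul_eq_nsmul ℝ, mul_smul_comm]
  ext1 k
  rw [weyl, PowerSeries.coeff_mk, hbin, map_sum]
  have hterm : ∀ m, (1 / (m.factorial : ℝ)) • ∑ I : Fin m → Fin N,
      mulOp (D (List.ofFn I) (lin c ^ n)) * PowerSeries.coeff k (centered X (List.ofFn I))
      = PowerSeries.coeff k ((n.choose m : ℝ) •
        (PowerSeries.C (mulOp (lin c ^ (n - m))) * cen X c m)) := by
    intro m
    rw [PowerSeries.coeff_smul, PowerSeries.coeff_C_mul, cen, map_sum, Finset.mul_sum,
      Finset.smul_sum, Finset.smul_sum]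
    refine Finset.sum_congr rfl fun I _ => ?_
    rw [D_lin_pow, mulOp_smul, PowerSeries.coeff_smul, List.length_ofFn, List.map_ofFn,
      List.prod_ofFn, smul_mul_assoc, mul_smul_comm, smul_smul, smul_smul,
      Nat.descFactorial_eq_factorial_mul_choose]
    congr 1
    push_cast
    have : (m.factorial : ℝ) ≠ 0 := by positivity
    field_simp
    rfl
  rw [Finset.sum_congr rfl fun m _ => hterm m]
  refine (Finset.sum_subset (Finset.range_mono (le_max_left _ (n + 1))) fun m _ hm => ?_).trans
    (Finset.sum_subset (Finset.range_mono (le_max_right (2 * k + 1) _)) fun m _ hm => ?_).symm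
  · rw [PowerSeries.coeff_smul, PowerSeries.coeff_C_mul, coeff_cen_eq_zero hX c (by simpa using hm),
      mul_zero, smul_zero]
  · rw [Nat.choose_eq_zero_of_lt (by simpa using hm), Nat.cast_zero, zero_smul, map_zero]

/-! ### Symmetric coefficients and the homotopy formula -/

/-- The iterated derivative of a symbol in the dual variables. -/
def pdl (I : List (Fin N)) (q : Sym N) : Sym N := I.foldl (fun q i => pderiv i q) q

lemma bracketCoord_op (I : List (Fin N)) (q : Sym N) : bracketCoord (op q) I = op (pdl I q) := by
  induction I generalizing q with
  | nil => rfl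
  | cons i I ih =>
    rw [pdl, List.foldl_cons, ← pdl, ← ih, bracketCoord, List.foldl_cons, bracketCoord]
    congr 1
    change op q * mulOp (coord i) - mulOp (coord i) * op q = _
    rw [op_mul_mulOp_coord]
    exact add_sub_cancel_left _ _

lemma symCoeff_op (I : List (Fin N)) (q : Sym N) :
    symCoeff (op q) I = (1 / (I.length.factorial : ℝ)) • constantCoeff (pdl I q) := by
  rw [symCoeff, bracketCoord_op, op_apply_one]

lemma pderiv_homogeneousComponent (i : Fin N) (d : ℕ) (q : Sym N) :
    pderiv i (homogeneousComponent (d + 1) q) = homogeneousComponent d (pderiv i q) := by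
  classical
  ext1 m
  rw [coeff_pderiv, coeff_homogeneousComponent, coeff_homogeneousComponent, coeff_pderiv, map_add,
    Finsupp.degree_single]
  by_cases h : m.degree = d
  · simp [h]
  · simp [h]

lemma homogeneousComponent_X_mul (e : ℕ) (i : Fin N) (q : Sym N) :
    homogeneousComponent (e + 1) (X i * q) = X i * homogeneousComponent e q := by
  obtain ⟨n, hn⟩ := exists_mem_degLT q
  conv_lhs => rw [← sum_homogeneousComponent_of_mem_degLT hn]
  have h : ∀ d, homogeneousComponent (e + 1) (X i * homogeneousComponent d q)
      = if d = e then X i * homogeneousComponent e q else 0 := by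
    intro d
    have hd : (X i * homogeneousComponent d q).IsHomogeneous (d + 1) := by
      have := (isHomogeneous_X (Smooth N) i).mul (homogeneousComponent_isHomogeneous d q)
      rwa [add_comm] at this
    rw [homogeneousComponent_of_mem hd]
    by_cases hde : d = e
    · subst hde; simp
    · rw [if_neg hde, if_neg (by omega)]
  rw [Finset.mul_sum, map_sum, Finset.sum_congr rfl fun d _ => h d, Finset.sum_ite_eq']
  split_ifs with he
  · rfl
  · have : homogeneousComponent e q = 0 := by
      ext1 m
      rw [coeff_homogeneousComponent, coeff_zero]
      split_ifs with hm
      · exact hn m (by simp at he; omega)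
      · rfl
    rw [this, mul_zero]

lemma constantCoeff_pdl (I : List (Fin N)) (q : Sym N) :
    constantCoeff (pdl I (homogeneousComponent I.length q)) = constantCoeff (pdl I q) := by
  induction I generalizing q with
  | nil => simp [pdl, constantCoeff_eq]
  | cons i I ih =>
    rw [List.length_cons, pdl, List.foldl_cons, pderiv_homogeneousComponent, ← pdl, ih]; rfl

/-- The monomial `p_{i₁} ⋯ p_{i_k}`. -/
def mon (I : List (Fin N)) : Sym N := (I.map X).prod

lemma op_mon (I : List (Fin N)) : op (mon I) = D I := by
  induction I with
  | nil => exact op_one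
  | cons i I ih =>
    rw [mon, List.map_cons, List.prod_cons, ← mon, op_X_mul, ih, D_cons]
    have h : (D I : Op N) * partialOp i = D (I ++ [i]) := by rw [D_append]; simp [D]
    rw [h, D_perm (List.perm_append_singleton i I), D_cons]

lemma op_C_mul_mon (a : Smooth N) (I : List (Fin N)) : op (C a * mon I) = mulOp a * D I := by
  rw [op_C_mul, op_mon]

lemma sum_pdl_mon {d : ℕ} {q : Sym N} (hq : q.IsHomogeneous d) :
    ∑ I : Fin d → Fin N, C (constantCoeff (pdl (List.ofFn I) q)) * mon (List.ofFn I)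
      = (d.factorial : ℝ) • q := by
  induction d generalizing q with
  | zero =>
    have : q = C (coeff 0 q) := by
      rw [← totalDegree_zero_iff_isHomogeneous, totalDegree_eq_zero_iff_eq_C] at hq
      exact hq
    rw [this]
    simp [pdl, mon]
  | succ d ih =>
    rw [sum_cons]
    have h : ∀ i, ∑ J : Fin d → Fin N, C (constantCoeff (pdl (List.ofFn
        (Fin.cons i J : Fin (d + 1) → Fin N)) q)) * mon (List.ofFn (Fin.cons i J : Fin (d + 1) → Fin N))
        = (d.factorial : ℝ) • (X i * pderiv i q) := by
      intro i
      have h1 := ih (q := pderiv i q) (by simpa using hq.pderiv (i := i))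
      rw [← mul_smul_comm, ← h1, Finset.mul_sum]
      refine Finset.sum_congr rfl fun J _ => ?_
      rw [List.ofFn_cons, pdl, List.foldl_cons, ← pdl, mon, List.map_cons, List.prod_cons, ← mon]
      ring
    rw [Finset.sum_congr rfl fun i _ => h i, ← Finset.smul_sum, hq.sum_X_mul_pderiv,
      ← Nat.cast_smul_eq_nsmul ℝ, smul_smul, Nat.factorial_succ]
    push_cast
    rw [mul_comm]

/-- An operator is recovered, in each degree, from its symmetric coefficients. -/
lemma sum_symCoeff_mon (d : ℕ) (q : Sym N) :
    ∑ I : Fin d → Fin N, C (symCoeff (op q) (List.ofFn I)) * mon (List.ofFn I)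
      = homogeneousComponent d q := by
  have h := sum_pdl_mon (homogeneousComponent_isHomogeneous d q)
  have hd : (d.factorial : ℝ) ≠ 0 := by positivity
  rw [← inv_smul_smul₀ hd (homogeneousComponent d q), ← h, Finset.smul_sum]
  refine Finset.sum_congr rfl fun I _ => ?_
  have h1 := constantCoeff_pdl (List.ofFn I) q
  rw [List.length_ofFn] at h1
  rw [symCoeff_op, h1, List.length_ofFn, one_div, ← smul_mul_assoc]
  congr 1
  ext1 m; simp [coeff_C]

lemma eraseIdx_ofFn {ι : Type*} {m : ℕ} (I : Fin (m + 1) → ι) (s : Fin (m + 1)) :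
    (List.ofFn I).eraseIdx s = List.ofFn (s.removeNth I) := by
  refine List.ext_getElem (by simp [List.length_eraseIdx]; omega) fun k h₁ h₂ => ?_
  rw [List.length_ofFn] at h₂
  rw [List.getElem_eraseIdx]
  simp only [List.getElem_ofFn, Fin.removeNth]
  split_ifs with h
  · congr 1
    rw [Fin.succAbove_of_castSucc_lt _ _ (by simpa [Fin.lt_def] using h)]
    rfl
  · congr 1
    rw [Fin.succAbove_of_le_castSucc _ _ (by simpa [Fin.le_def] using h)]
    rfl

lemma gammaOf_ofFn (G : Fin N → Fin N → Op N) (j : Fin N) {m : ℕ} (I : Fin (m + 1) → Fin N) :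
    gammaOf G j (List.ofFn I) = (1 / (((m : ℝ) + 1) * ((m : ℝ) + 2))) •
      ∑ s, symCoeff (G j (I s)) (List.ofFn (s.removeNth I)) := by
  have h : (List.ofFn I).length = m + 1 := List.length_ofFn
  rw [gammaOf]
  congr 1
  · rw [h]; push_cast; ring_nf
  · rw [← (finCongr h.symm).sum_comp]
    refine Finset.sum_congr rfl fun s _ => ?_
    rw [← eraseIdx_ofFn]
    simp only [finCongr_apply, List.get_eq_getElem, Fin.val_cast, List.getElem_ofFn]

lemma mon_ofFn_insertNth {m : ℕ} (s : Fin (m + 1)) (i : Fin N) (J : Fin m → Fin N) :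
    mon (List.ofFn (Fin.insertNth s i J : Fin (m + 1) → Fin N)) = X i * mon (List.ofFn J) := by
  rw [mon, mon, List.map_ofFn, List.map_ofFn, List.prod_ofFn, List.prod_ofFn,
    Fin.prod_univ_succAbove _ s]
  simp

/-- The part of degree `m + 1` of the operator with the coefficients `gammaOf G`. -/
lemma sum_gammaOf_mon {g : Fin N → Fin N → Sym N} {G : Fin N → Fin N → Op N}
    (hG : ∀ i j, G i j = op (g i j)) (j : Fin N) (m : ℕ) :
    ∑ I : Fin (m + 1) → Fin N, C (gammaOf G j (List.ofFn I)) * mon (List.ofFn I)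
      = (1 / ((m : ℝ) + 2)) • ∑ i, X i * homogeneousComponent m (g j i) := by
  have hC : ∀ (t : ℝ) (a : Smooth N), C (t • a) = t • (C a : Sym N) := fun t a => by
    ext1 m; simp only [coeff_C, coeff_smul, smul_ite, smul_zero]
  have key : ∀ s : Fin (m + 1), ∑ I : Fin (m + 1) → Fin N,
      C (symCoeff (G j (I s)) (List.ofFn (s.removeNth I))) * mon (List.ofFn I)
      = ∑ i, X i * homogeneousComponent m (g j i) := by
    intro s
    rw [sum_insertNth s]
    refine Finset.sum_congr rfl fun i _ => ?_
    rw [← sum_symCoeff_mon, Finset.mul_sum]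
    refine Finset.sum_congr rfl fun J _ => ?_
    rw [mon_ofFn_insertNth, Fin.insertNth_apply_same, hG, Fin.removeNth_insertNth]
    exact mul_left_comm _ _ _
  simp only [gammaOf_ofFn, hC, map_sum, Finset.sum_mul, smul_mul_assoc]
  rw [← Finset.smul_sum, Finset.sum_comm, Finset.sum_congr rfl fun s _ => key s,
    Finset.sum_const, Finset.card_univ, Fintype.card_fin, ← Nat.cast_smul_eq_nsmul ℝ, smul_smul]
  congr 1
  push_cast
  field_simp

/-- The solution `(E + 1)⁻¹ ∑ p_j g^{ij}` of the equations `∂_{p_j} γ^i - ∂_{p_i} γ^j = g^{ij}`,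
where `E` is the Euler operator, in degrees `≤ n`. -/
def gam (g : Fin N → Fin N → Sym N) (n : ℕ) (i : Fin N) : Sym N :=
  ∑ m ∈ range n, (1 / ((m : ℝ) + 2)) • ∑ j, X j * homogeneousComponent m (g i j)

/-- The coefficients `gammaOf G` are those of the homotopy operator `gam`, applied to the symbols of `G`. -/
lemma sum_gammaOf_D {g : Fin N → Fin N → Sym N} {G : Fin N → Fin N → Op N}
    (hG : ∀ i j, G i j = op (g i j)) (i : Fin N) (n : ℕ) :
    ∑ p ∈ Finset.Icc 1 n, ∑ I : Fin p → Fin N,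
      mulOp (gammaOf G i (List.ofFn I)) * D (List.ofFn I) = op (gam g n i) := by
  rw [gam, map_sum, Finset.range_eq_Ico, Finset.sum_Ico_eq_sum_range, ← Finset.Ico_succ_right_eq_Icc,
    Finset.sum_Ico_eq_sum_range]
  refine Finset.sum_congr rfl fun m _ => ?_
  rw [Nat.zero_add, ← sum_gammaOf_mon hG, map_sum, Nat.add_comm 1 m]
  simp only [op_C_mul_mon]

lemma gam_mem_degLT (g : Fin N → Fin N → Sym N) (n : ℕ) (i : Fin N) :
    gam g n i ∈ degLT N (n + 1) := by
  refine Submodule.sum_mem _ fun m hm => Submodule.smul_mem _ _ (Submodule.sum_mem _ fun j _ => ?_)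
  rw [Finset.mem_range] at hm
  exact degLT_mono (by omega) (mul_mem_degLT (X_mem_degLT j)
    (isHomogeneous_mem_degLT (homogeneousComponent_isHomogeneous m _)))

lemma constantCoeff_gam (g : Fin N → Fin N → Sym N) (n : ℕ) (i : Fin N) :
    constantCoeff (gam g n i) = 0 := by
  simp [gam]

/-- Since `g` is skew-symmetric, `∑ p_i p_j g^{ij} = 0`. This is what makes the deformed coordinates
symmetrically ordered. -/
lemma sum_X_mul_gam {g : Fin N → Fin N → Sym N} (hg : ∀ i j, g i j = -g j i) (n : ℕ) :
    ∑ i, X i * gam g n i = 0 := by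
  simp only [gam, Finset.mul_sum, mul_smul_comm, Finset.smul_sum]
  rw [Finset.sum_comm]
  refine Finset.sum_eq_zero fun m _ => ?_
  simp only [← Finset.smul_sum]
  have h : ∑ i, ∑ j, X i * (X j * homogeneousComponent m (g i j))
      = -∑ i, ∑ j, X i * (X j * homogeneousComponent m (g i j)) := by
    conv_lhs => rw [Finset.sum_comm]
    rw [← Finset.sum_neg_distrib]
    refine Finset.sum_congr rfl fun i _ => ?_
    rw [← Finset.sum_neg_distrib]
    refine Finset.sum_congr rfl fun j _ => ?_
    rw [hg j i, map_neg]
    ring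
  have h2 : (2 : ℝ) • ∑ i, ∑ j, X i * (X j * homogeneousComponent m (g i j)) = 0 := by
    rw [two_smul]
    nth_rewrite 1 [h]
    exact neg_add_cancel _
  rw [(smul_eq_zero_iff_right (by norm_num)).mp h2, smul_zero]

/-- The Poincaré lemma in the dual variables: if `g` is closed, `gam g n` is a potential of it. -/
lemma pderiv_gam_sub {g : Fin N → Fin N → Sym N} (hg : ∀ i j, g i j = -g j i)
    (hc : ∀ i j k, pderiv i (g j k) + pderiv j (g k i) + pderiv k (g i j) = 0)
    {n : ℕ} (hn : ∀ i j, g i j ∈ degLT N n) (i j : Fin N) :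
    pderiv j (gam g n i) - pderiv i (gam g n j) = g i j := by
  rw [← sum_homogeneousComponent_of_mem_degLT (hn i j)]
  simp only [gam, map_sum, Derivation.map_smul_of_tower]
  rw [← Finset.sum_sub_distrib]
  refine Finset.sum_congr rfl fun m _ => ?_
  rw [← smul_sub]
  simp only [pderiv_X_mul, Finset.sum_add_distrib, Finset.sum_ite_eq, Finset.mem_univ, if_true]
  have h1 : ∀ l, X l * pderiv j (homogeneousComponent m (g i l))
      - X l * pderiv i (homogeneousComponent m (g j l))
      = X l * pderiv l (homogeneousComponent m (g i j)) := by
    intro l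
    rw [← mul_sub]
    congr 1
    rcases m with _ | m
    · simp
    · rw [pderiv_homogeneousComponent, pderiv_homogeneousComponent, pderiv_homogeneousComponent,
        ← map_sub]
      congr 1
      have := hc i j l
      rw [hg l i, map_neg] at this
      rw [sub_eq_iff_eq_add, ← sub_eq_zero, ← neg_eq_zero, ← this]
      ring
  have h2 := (homogeneousComponent_isHomogeneous m (g i j)).sum_X_mul_pderiv
  rw [hg j i, map_neg]
  have h3 : ∀ a b c : Sym N, (a + b) - (c + -b) = (a - c) + (2 : ℝ) • b := fun a b c => by
    rw [two_smul]; ring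
  rw [h3, ← Finset.sum_sub_distrib, Finset.sum_congr rfl fun l _ => h1 l, h2,
    ← Nat.cast_smul_eq_nsmul ℝ, ← add_smul, smul_smul, one_div_mul_cancel (by positivity), one_smul]

/-! ### Congruences modulo powers of the formal parameter -/

/-- Congruence modulo `α^n`. -/
def EqMod (n : ℕ) (Z Z' : FormalOp N) : Prop :=
  ∀ k < n, PowerSeries.coeff k Z = PowerSeries.coeff k Z'

namespace EqMod

variable {n : ℕ} {Z Z' W W' Z'' : FormalOp N}

lemma refl (n : ℕ) (Z : FormalOp N) : EqMod n Z Z := fun _ _ => rfl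

lemma symm (h : EqMod n Z Z') : EqMod n Z' Z := fun k hk => (h k hk).symm

lemma trans (h : EqMod n Z Z') (h' : EqMod n Z' Z'') : EqMod n Z Z'' :=
  fun k hk => (h k hk).trans (h' k hk)

lemma mono {m : ℕ} (h : EqMod n Z Z') (hm : m ≤ n) : EqMod m Z Z' :=
  fun k hk => h k (hk.trans_le hm)

lemma add (h : EqMod n Z Z') (h' : EqMod n W W') : EqMod n (Z + W) (Z' + W') := fun k hk => by
  rw [map_add, map_add, h k hk, h' k hk]

lemma sub (h : EqMod n Z Z') (h' : EqMod n W W') : EqMod n (Z - W) (Z' - W') := fun k hk => by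
  rw [map_sub, map_sub, h k hk, h' k hk]

lemma mul (h : EqMod n Z Z') (h' : EqMod n W W') : EqMod n (Z * W) (Z' * W') := fun k hk => by
  rw [PowerSeries.coeff_mul, PowerSeries.coeff_mul]
  refine Finset.sum_congr rfl fun x hx => ?_
  rw [HasAntidiagonal.mem_antidiagonal] at hx
  rw [h x.1 (by omega), h' x.2 (by omega)]

lemma smul (c : ℝ) (h : EqMod n Z Z') : EqMod n (c • Z) (c • Z') := fun k hk => by
  rw [PowerSeries.coeff_smul, PowerSeries.coeff_smul, h k hk]

lemma sum {ι : Type*} (s : Finset ι) {F F' : ι → FormalOp N} (h : ∀ i ∈ s, EqMod n (F i) (F' i)) :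
    EqMod n (∑ i ∈ s, F i) (∑ i ∈ s, F' i) := fun k hk => by
  rw [map_sum, map_sum]
  exact Finset.sum_congr rfl fun i hi => h i hi k hk

lemma centered {X X' : Fin N → FormalOp N} (h : ∀ i, EqMod n (X i) (X' i)) (I : List (Fin N)) :
    EqMod n (centered X I) (WeylStar.centered X' I) := by
  induction I with
  | nil => exact refl _ _
  | cons i I ih => exact (ih.mul (h i)).sub ((refl _ _).mul ih)

lemma weyl {X X' : Fin N → FormalOp N} (h : ∀ i, EqMod n (X i) (X' i)) (f : Smooth N) :
    EqMod n (weyl X f) (WeylStar.weyl X' f) := fun k hk => by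
  rw [WeylStar.weyl, WeylStar.weyl, PowerSeries.coeff_mk, PowerSeries.coeff_mk]
  refine Finset.sum_congr rfl fun m _ => congrArg _ (Finset.sum_congr rfl fun I _ => ?_)
  rw [EqMod.centered h _ k hk]

lemma weylSeries {X X' : Fin N → FormalOp N} (h : ∀ i, EqMod n (X i) (X' i)) (φ : FormalFn N) :
    EqMod n (weylSeries X φ) (WeylStar.weylSeries X' φ) := fun k hk => by
  rw [WeylStar.weylSeries, WeylStar.weylSeries, PowerSeries.coeff_mk, PowerSeries.coeff_mk]
  refine Finset.sum_congr rfl fun x hx => ?_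
  rw [HasAntidiagonal.mem_antidiagonal] at hx
  exact EqMod.weyl h _ _ (by omega)

end EqMod

lemma coeff_two_X_mul (Z : FormalOp N) (k : ℕ) :
    PowerSeries.coeff k (2 * PowerSeries.X * Z)
      = if k = 0 then 0 else (2 : ℝ) • PowerSeries.coeff (k - 1) Z := by
  have h : (2 : FormalOp N) * PowerSeries.X * Z = PowerSeries.X * (2 * Z) := by
    rw [two_mul, two_mul, mul_add, add_mul]
  rw [h]
  rcases k with _ | k
  · simp
  · rw [PowerSeries.coeff_succ_X_mul, if_neg (Nat.succ_ne_zero k), two_mul, map_add, two_smul]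
    rfl

/-! ### Properties of Weyl ordering -/

lemma coeff_zero_weyl (X : Fin N → FormalOp N) (f : Smooth N) :
    PowerSeries.coeff 0 (weyl X f) = mulOp f := by
  simp [weyl, centered, D_nil]

lemma adm_weyl {X : Fin N → FormalOp N} (hX : IsDeformed X) (f : Smooth N) : Adm (weyl X f) := by
  intro k
  rw [weyl, PowerSeries.coeff_mk]
  refine Submodule.sum_mem _ fun n _ => Submodule.smul_mem _ _ (Submodule.sum_mem _ fun I _ => ?_)
  exact ordLT_mono (by omega) (mul_mem_ordLT (mulOp_mem_ordLT _) (adm_centered hX _ k))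

lemma adm_weylSeries {X : Fin N → FormalOp N} (hX : IsDeformed X) (φ : FormalFn N) :
    Adm (weylSeries X φ) := by
  intro k
  rw [weylSeries, PowerSeries.coeff_mk]
  refine Submodule.sum_mem _ fun x hx => ?_
  rw [HasAntidiagonal.mem_antidiagonal] at hx
  exact ordLT_mono (by omega) (adm_weyl hX _ x.2)

/-- The operator `f ↦ (W(f) g)_k`. -/
def weylLeft (X : Fin N → FormalOp N) (k : ℕ) (g : Smooth N) : Op N :=
  ∑ n ∈ Finset.range (2 * k + 1), (1 / (n.factorial : ℝ)) • ∑ I : Fin n → Fin N,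
    mulOp (PowerSeries.coeff k (centered X (List.ofFn I)) g) * D (List.ofFn I)

lemma weylLeft_apply (X : Fin N → FormalOp N) (k : ℕ) (f g : Smooth N) :
    weylLeft X k g f = PowerSeries.coeff k (weyl X f) g := by
  simp only [weylLeft, weyl, PowerSeries.coeff_mk, LinearMap.sum_apply, LinearMap.smul_apply,
    Module.End.mul_apply, mulOp_apply, mul_comm]

lemma weylLeft_mem_diffOp (X : Fin N → FormalOp N) (k : ℕ) (g : Smooth N) :
    weylLeft X k g ∈ diffOp N := by
  refine Subalgebra.sum_mem _ fun n _ => Subalgebra.smul_mem _ (Subalgebra.sum_mem _ fun I _ => ?_) _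
  exact mem_diffOp (mul_mem_ordLT (mulOp_mem_ordLT _) (D_mem_ordLT _))

lemma weyl_smul (X : Fin N → FormalOp N) (c : ℝ) (f : Smooth N) :
    weyl X (c • f) = c • weyl X f := by
  ext1 k
  refine LinearMap.ext fun h => ?_
  rw [PowerSeries.coeff_smul, LinearMap.smul_apply, ← weylLeft_apply, ← weylLeft_apply, map_smul]

lemma weyl_neg (X : Fin N → FormalOp N) (f : Smooth N) : weyl X (-f) = -weyl X f := by
  rw [← neg_one_smul ℝ f, weyl_smul, neg_one_smul]

lemma weylSeries_neg (X : Fin N → FormalOp N) (φ : FormalFn N) :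
    weylSeries X (-φ) = -weylSeries X φ := by
  ext1 k
  simp only [weylSeries, map_neg, PowerSeries.coeff_mk, weyl_neg, Finset.sum_neg_distrib]

/-- The operator `c · X` acts on powers of `c · x` as multiplication by `c · x`. -/
lemma coeff_dot_lin_pow {X : Fin N → FormalOp N} (hX : IsDeformed X) (c : Fin N → ℝ) (k n : ℕ) :
    PowerSeries.coeff k (dot c X) (lin c ^ n) = if k = 0 then lin c ^ (n + 1) else 0 := by
  rw [dot, map_sum]
  simp only [PowerSeries.coeff_smul, LinearMap.sum_apply, LinearMap.smul_apply]
  split_ifs with hk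
  · subst hk
    simp only [hX.zero, mulOp_apply, pow_succ', lin, Finset.sum_mul, smul_mul_assoc]
  · exact (by simpa using hX.contract c n k hk)

/-- `W(f) 1 = f`. -/
lemma coeff_weyl_apply_one {X : Fin N → FormalOp N} (hX : IsDeformed X) (f : Smooth N) (k : ℕ) :
    PowerSeries.coeff k (weyl X f) 1 = if k = 0 then f else 0 := by
  have hpow : ∀ (c : Fin N → ℝ) (n k : ℕ), PowerSeries.coeff k (dot c X ^ n) 1
      = if k = 0 then lin c ^ n else 0 := by
    intro c n
    induction n with
    | zero =>
      intro k
      rw [pow_zero, PowerSeries.coeff_one, pow_zero]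
      split_ifs <;> rfl
    | succ n ih =>
      intro k
      rw [pow_succ', PowerSeries.coeff_mul, LinearMap.sum_apply,
        Finset.sum_eq_single_of_mem (k, 0) (by simp)]
      · rw [Module.End.mul_apply, ih, if_pos rfl, coeff_dot_lin_pow hX]
      · intro x hx hne
        rw [HasAntidiagonal.mem_antidiagonal] at hx
        rw [Module.End.mul_apply, ih, if_neg, map_zero]
        rintro h
        exact hne (Prod.ext (by simp at *; omega) h)
  -- both sides are differential operators in `f`, and they agree on powers of linear functions
  have h0 : weylLeft X k 1 - (if k = 0 then 1 else 0) = 0 := by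
    refine eq_zero_of_lin_pow (sub_mem (weylLeft_mem_diffOp X k 1) ?_) fun c n => ?_
    · split_ifs
      · exact one_mem _
      · exact zero_mem _
    · rw [LinearMap.sub_apply, weylLeft_apply, weyl_lin_pow hX, hpow]
      split_ifs <;> simp
  have h1 := LinearMap.congr_fun h0 f
  rw [LinearMap.sub_apply, weylLeft_apply, LinearMap.zero_apply, sub_eq_zero] at h1
  rw [h1]
  split_ifs <;> rfl

lemma coeff_weylSeries_apply_one {X : Fin N → FormalOp N} (hX : IsDeformed X) (φ : FormalFn N)
    (k : ℕ) : PowerSeries.coeff k (weylSeries X φ) 1 = PowerSeries.coeff k φ := by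
  rw [weylSeries, PowerSeries.coeff_mk, LinearMap.sum_apply,
    Finset.sum_eq_single_of_mem (k, 0) (by simp)]
  · rw [coeff_weyl_apply_one hX, if_pos rfl]
  · intro x hx hne
    rw [HasAntidiagonal.mem_antidiagonal] at hx
    rw [coeff_weyl_apply_one hX, if_neg]
    rintro h
    exact hne (Prod.ext (by simp at *; omega) h)

/-! ### The deformed coordinates -/

lemma coeff_xhat_of_lt (ω : Fin N → Fin N → FormalFn N) {n k : ℕ} (h : n < k) (i : Fin N) :
    PowerSeries.coeff k (xhat ω n i) = 0 := by
  induction n with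
  | zero => rw [xhat, PowerSeries.coeff_C, if_neg (by omega)]
  | succ n ih =>
    rw [xhat, map_add, ih (by omega), PowerSeries.coeff_X_pow_mul', if_pos (by omega),
      PowerSeries.coeff_C, if_neg (by omega), zero_add]

lemma eqMod_xhat_succ (ω : Fin N → Fin N → FormalFn N) (n : ℕ) (i : Fin N) :
    EqMod (n + 1) (xhat ω (n + 1) i) (xhat ω n i) := by
  intro k hk
  rw [xhat, map_add, PowerSeries.coeff_X_pow_mul', if_neg (by omega), add_zero]

lemma eqMod_xhat (ω : Fin N → Fin N → FormalFn N) {m n : ℕ} (h : m ≤ n) (i : Fin N) :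
    EqMod (m + 1) (xhat ω n i) (xhat ω m i) := by
  induction n, h using Nat.le_induction with
  | base => exact EqMod.refl _ _
  | succ n h ih => exact ((eqMod_xhat_succ ω n i).mono (by omega)).trans ih

lemma coeff_xhat_self (ω : Fin N → Fin N → FormalFn N) (n : ℕ) (i : Fin N) :
    PowerSeries.coeff (n + 1) (xhat ω (n + 1) i) = ∑ p ∈ Finset.Icc 1 (n + 1), ∑ I : Fin p → Fin N,
      mulOp (gammaOf (defect ω n (xhat ω n)) i (List.ofFn I)) * D (List.ofFn I) := by
  rw [xhat, map_add, coeff_xhat_of_lt ω (Nat.lt_succ_self n), zero_add,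
    PowerSeries.coeff_X_pow_mul', if_pos le_rfl, Nat.sub_self, PowerSeries.coeff_C, if_pos rfl]

lemma defect_skew {ω : Fin N → Fin N → FormalFn N} (hω : ∀ i j, ω i j = -ω j i) (n : ℕ)
    (X : Fin N → FormalOp N) (i j : Fin N) : defect ω n X i j = -defect ω n X j i := by
  rw [defect, defect, hω i j, weylSeries_neg, ← map_neg]
  congr 1
  rw [mul_neg]
  abel

lemma coeff_commutator_mem {Z W : FormalOp N} (hZ : Adm Z) (hW : Adm W) (k : ℕ) :
    PowerSeries.coeff k (Z * W - W * Z) ∈ ordLT N k := by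
  rw [map_sub, PowerSeries.coeff_mul, PowerSeries.coeff_mul,
    ← Finset.Nat.sum_antidiagonal_swap, ← Finset.sum_sub_distrib]
  refine Submodule.sum_mem _ fun x hx => ?_
  rw [HasAntidiagonal.mem_antidiagonal] at hx
  exact ordLT_mono (by omega) (commutator_mem_ordLT (hZ x.2) (hW x.1))

lemma defect_mem {ω : Fin N → Fin N → FormalFn N} {X : Fin N → FormalOp N} (hX : IsDeformed X)
    (n : ℕ) (i j : Fin N) : defect ω n X i j ∈ ordLT N (n + 1) := by
  rw [defect, map_sub]
  refine Submodule.sub_mem _ ?_ (coeff_commutator_mem (hX.adm i) (hX.adm j) _)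
  rw [coeff_two_X_mul, if_neg (Nat.succ_ne_zero n)]
  exact Submodule.smul_mem _ _ (adm_weylSeries hX _ n)

lemma sum_op_lin_pow {y : Fin N → Sym N} (hy : ∑ i, X i * y i = 0) (c : Fin N → ℝ) (n : ℕ) :
    ∑ i, c i • op (y i) (lin c ^ n) = 0 := by
  have h := LinearMap.congr_fun (congrArg op hy) (lin c ^ (n + 1))
  have hp : ∀ i, partialOp i (lin c ^ (n + 1)) = ((n : ℝ) + 1) • c i • lin c ^ n := by
    intro i
    have := D_lin_pow c (n + 1) [i]
    simpa [D, smul_smul] using this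
  simp only [map_sum, op_X_mul, LinearMap.sum_apply, Module.End.mul_apply, hp, map_smul,
    map_zero, LinearMap.zero_apply, ← Finset.smul_sum] at h
  exact (smul_eq_zero_iff_right (by positivity)).mp h

/-- The operators `defect ω n X` are differential operators of order at most `n`, with skew-symmetric
symbols. -/
lemma exists_symbol_defect {ω : Fin N → Fin N → FormalFn N} (hω : ∀ i j, ω i j = -ω j i)
    {X : Fin N → FormalOp N} (hX : IsDeformed X) (n : ℕ) :
    ∃ g : Fin N → Fin N → Sym N, (∀ i j, defect ω n X i j = op (g i j)) ∧
      (∀ i j, g i j = -g j i) ∧ ∀ i j, g i j ∈ degLT N (n + 1) := by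
  choose g hg hg' using fun i j => (Submodule.mem_map.mp (defect_mem (ω := ω) hX n i j))
  refine ⟨g, fun i j => (hg' i j).symm, fun i j => op_injective ?_, hg⟩
  rw [map_neg, hg', hg', defect_skew hω]

/-- The iteration stays within the deformations of the coordinates: each correction `gam g (n + 1)`
has degree at most `n + 1`, no constant term, and satisfies `∑ p_i γ^i = 0`. -/
theorem isDeformed_xhat {ω : Fin N → Fin N → FormalFn N} (hω : ∀ i j, ω i j = -ω j i) (n : ℕ) :
    IsDeformed (xhat ω n) := by
  induction n with
  | zero =>
    refine ⟨fun i => by simp [xhat], fun i => adm_C_mulOp _, fun i k hk => ?_, fun c n k hk => ?_⟩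
    · rw [coeff_xhat_of_lt ω (by omega), LinearMap.zero_apply]
    · simp only [coeff_xhat_of_lt ω (Nat.pos_of_ne_zero hk),
        LinearMap.zero_apply, smul_zero, Finset.sum_const_zero]
  | succ n ih =>
    obtain ⟨g, hg, hskew, hdeg⟩ := exists_symbol_defect hω ih n
    have hc : ∀ i k, PowerSeries.coeff k (xhat ω (n + 1) i)
        = if k = n + 1 then op (gam g (n + 1) i) else PowerSeries.coeff k (xhat ω n i) := by
      intro i k
      split_ifs with hk
      · rw [hk, coeff_xhat_self, sum_gammaOf_D hg]
      · by_cases h : k < n + 1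
        · exact eqMod_xhat_succ ω n i k h
        · rw [coeff_xhat_of_lt ω (by omega), coeff_xhat_of_lt ω (by omega)]
    refine ⟨fun i => ?_, fun i k => ?_, fun i k hk => ?_, fun c m k hk => ?_⟩
    · rw [hc, if_neg (by omega), ih.zero]
    · rw [hc]
      split_ifs with h
      · rw [h]; exact op_mem_ordLT (gam_mem_degLT g (n + 1) i)
      · exact ih.adm i k
    · rw [hc]
      split_ifs with h
      · rw [op_apply_one, constantCoeff_gam]
      · exact ih.one i k hk
    · simp only [hc]
      split_ifs with h
      · exact (by simpa using sum_op_lin_pow (sum_X_mul_gam hskew (n + 1)) c m)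
      · exact ih.contract c m k hk

/-! ### The commutation relation follows from the consistency condition -/

lemma coeff_mul_of_eqMod_zero_right {n : ℕ} {Z : FormalOp N} (hZ : EqMod n Z 0) (W : FormalOp N) :
    PowerSeries.coeff n (W * Z) = PowerSeries.coeff 0 W * PowerSeries.coeff n Z := by
  rw [PowerSeries.coeff_mul, Finset.sum_eq_single_of_mem (0, n) (by simp)]
  intro x hx hne
  rw [HasAntidiagonal.mem_antidiagonal] at hx
  rw [hZ x.2, map_zero, mul_zero]
  by_contra h
  exact hne (Prod.ext (by simp at *; omega) (by simp at *; omega))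

lemma coeff_mul_of_eqMod_zero_left {n : ℕ} {Z : FormalOp N} (hZ : EqMod n Z 0) (W : FormalOp N) :
    PowerSeries.coeff n (Z * W) = PowerSeries.coeff n Z * PowerSeries.coeff 0 W := by
  rw [PowerSeries.coeff_mul, Finset.sum_eq_single_of_mem (n, 0) (by simp)]
  intro x hx hne
  rw [HasAntidiagonal.mem_antidiagonal] at hx
  rw [hZ x.1, map_zero, zero_mul]
  by_contra h
  exact hne (Prod.ext (by simp at *; omega) (by simp at *; omega))

lemma commutationRelation_iff {ω : Fin N → Fin N → FormalFn N} {n : ℕ} :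
    CommutationRelation ω n ↔ ∀ i j, EqMod (n + 1)
      (xhat ω n i * xhat ω n j - xhat ω n j * xhat ω n i)
      (2 * PowerSeries.X * weylSeries (xhat ω n) (ω i j)) :=
  forall_congr' fun _ => forall_congr' fun _ => forall_congr' fun _ =>
    ⟨fun h hk => h (Nat.lt_succ_iff.mp hk), fun h hk => h (Nat.lt_succ_iff.mpr hk)⟩

lemma consistencyCondition_iff {ω : Fin N → Fin N → FormalFn N} {n : ℕ} :
    ConsistencyCondition ω n ↔ ∀ i j k, EqMod (n + 1)
      (coordOmegaComm ω n i j k + coordOmegaComm ω n j k i + coordOmegaComm ω n k i j) 0 := by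
  refine forall_congr' fun _ => forall_congr' fun _ => forall_congr' fun _ =>
    forall_congr' fun _ => ?_
  rw [map_zero]
  exact ⟨fun h hk => h (Nat.lt_succ_iff.mp hk), fun h hk => h (Nat.lt_succ_iff.mpr hk)⟩

lemma eqMod_coordOmegaComm (ω : Fin N → Fin N → FormalFn N) {m n : ℕ} (h : m ≤ n)
    (i j k : Fin N) : EqMod (m + 1) (coordOmegaComm ω n i j k) (coordOmegaComm ω m i j k) :=
  ((eqMod_xhat ω h i).mul (EqMod.weylSeries (eqMod_xhat ω h) _)).sub
    ((EqMod.weylSeries (eqMod_xhat ω h) _).mul (eqMod_xhat ω h i))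

lemma ConsistencyCondition.mono {ω : Fin N → Fin N → FormalFn N} {m n : ℕ}
    (hc : ConsistencyCondition ω n) (h : m ≤ n) : ConsistencyCondition ω m := by
  rw [consistencyCondition_iff] at *
  exact fun i j k => ((((eqMod_coordOmegaComm ω h i j k).add (eqMod_coordOmegaComm ω h j k i)).add
    (eqMod_coordOmegaComm ω h k i j)).symm.trans ((hc i j k).mono (by omega)))

lemma commutationRelation_zero (ω : Fin N → Fin N → FormalFn N) : CommutationRelation ω 0 := by
  intro i j k hk
  obtain rfl : k = 0 := by omega
  rw [coeff_two_X_mul, if_pos rfl]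
  simp only [xhat, ← map_mul, mulOp_comm (coord i), sub_self, map_zero]

/-- One step of the iteration. By the Jacobi identity and the consistency condition, the symbols
`g^{ij}` of the defect are closed, and the correction `gam g` solves
`∂_{p_j} γ^i - ∂_{p_i} γ^j = g^{ij}`, which is the commutation relation in the next order. -/
theorem CommutationRelation.succ {ω : Fin N → Fin N → FormalFn N} (hω : ∀ i j, ω i j = -ω j i)
    {n : ℕ} (hr : CommutationRelation ω n) (hc : ConsistencyCondition ω n) :
    CommutationRelation ω (n + 1) := by
  have hX := isDeformed_xhat hω n
  obtain ⟨g, hg, hskew, hdeg⟩ := exists_symbol_defect hω hX n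
  set X := xhat ω n with hXdef
  let K : Fin N → Fin N → FormalOp N := fun i j =>
    2 * PowerSeries.X * weylSeries X (ω i j) - (X i * X j - X j * X i)
  have hK : ∀ i j, EqMod (n + 1) (K i j) 0 := fun i j k hk => by
    simp only [K, map_sub]
    rw [← commutationRelation_iff.mp hr i j k hk, map_sub, sub_self, map_zero]
  have hKg : ∀ i j, PowerSeries.coeff (n + 1) (K i j) = op (g i j) := hg
  -- the Jacobi identity shows that the symbols of the defect are closed
  have hclosed : ∀ i j k, pderiv i (g j k) + pderiv j (g k i) + pderiv k (g i j) = 0 := by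
    intro i j k
    have hJ : (X i * K j k - K j k * X i) + (X j * K k i - K k i * X j)
        + (X k * K i j - K i j * X k) = 2 * PowerSeries.X *
        (coordOmegaComm ω n i j k + coordOmegaComm ω n j k i + coordOmegaComm ω n k i j) := by
      have hcomm : ∀ i j k, X i * (2 * PowerSeries.X * weylSeries X (ω j k))
          = 2 * PowerSeries.X * (X i * weylSeries X (ω j k)) := fun i j k => by
        rw [two_mul, add_mul, mul_add, ← mul_assoc, (PowerSeries.commute_X (X i)).eq, mul_assoc,
          add_mul]
      simp only [K, coordOmegaComm, mul_sub, sub_mul, hcomm, mul_add]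
      noncomm_ring
    have h1 := congrArg (PowerSeries.coeff (n + 1)) hJ
    have h2 := consistencyCondition_iff.mp hc i j k n (Nat.lt_succ_self n)
    rw [coeff_two_X_mul, if_neg (Nat.succ_ne_zero n), Nat.add_sub_cancel, h2, map_zero,
      smul_zero] at h1
    have hb : ∀ i j k, PowerSeries.coeff (n + 1) (X i * K j k - K j k * X i)
        = -op (pderiv i (g j k)) := by
      intro i j k
      rw [map_sub, coeff_mul_of_eqMod_zero_right (hK j k), coeff_mul_of_eqMod_zero_left (hK j k),
        hX.zero, hKg, op_mul_mulOp_coord, sub_add_cancel_left]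
    rw [map_add, map_add, hb, hb, hb, ← neg_add, ← neg_add, neg_eq_zero, ← map_add, ← map_add] at h1
    exact op_injective (h1.trans (map_zero _).symm)
  rw [commutationRelation_iff]
  intro i j
  have hsucc : ∀ i, EqMod (n + 1) (xhat ω (n + 1) i) (X i) := eqMod_xhat_succ ω n
  have hlow : EqMod (n + 1) (xhat ω (n + 1) i * xhat ω (n + 1) j
      - xhat ω (n + 1) j * xhat ω (n + 1) i) (X i * X j - X j * X i) :=
    ((hsucc i).mul (hsucc j)).sub ((hsucc j).mul (hsucc i))
  have hW := EqMod.weylSeries hsucc (ω i j)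
  intro k hk
  rcases Nat.lt_succ_iff_lt_or_eq.mp hk with hk | rfl
  · rw [hlow k hk, commutationRelation_iff.mp hr i j k hk, coeff_two_X_mul, coeff_two_X_mul,
      hW (k - 1) (by omega)]
  · have hΔ : ∀ i, EqMod (n + 1) (xhat ω (n + 1) i - X i) 0 := fun i k hk => by
      rw [map_sub, hsucc i k hk, sub_self, map_zero]
    have hΔc : ∀ i, PowerSeries.coeff (n + 1) (xhat ω (n + 1) i - X i)
        = op (gam g (n + 1) i) := fun i => by
      rw [map_sub, coeff_xhat_self, sum_gammaOf_D hg, hXdef,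
        coeff_xhat_of_lt ω (Nat.lt_succ_self n), sub_zero]
    have hprod : ∀ i j, PowerSeries.coeff (n + 1) (xhat ω (n + 1) i * xhat ω (n + 1) j)
        = PowerSeries.coeff (n + 1) (X i * X j) + op (gam g (n + 1) i) * mulOp (coord j)
          + mulOp (coord i) * op (gam g (n + 1) j) := by
      intro i j
      have : xhat ω (n + 1) i * xhat ω (n + 1) j = X i * X j + (xhat ω (n + 1) i - X i) * X j
          + xhat ω (n + 1) i * (xhat ω (n + 1) j - X j) := by noncomm_ring
      rw [this, map_add, map_add, coeff_mul_of_eqMod_zero_right (hΔ j),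
        coeff_mul_of_eqMod_zero_left (hΔ i), hΔc, hΔc, hX.zero, hsucc i 0 (Nat.succ_pos n), hX.zero]
    -- in the order `n + 1` the commutator of a correction with `x^j` is a derivative of its symbol
    have hd := hg i j
    rw [defect, map_sub, map_sub, sub_eq_iff_eq_add] at hd
    have hP := pderiv_gam_sub hskew hclosed hdeg i j
    rw [map_sub, hprod, hprod, op_mul_mulOp_coord, op_mul_mulOp_coord]
    rw [coeff_two_X_mul, if_neg (Nat.succ_ne_zero n), Nat.add_sub_cancel] at hd ⊢
    rw [hW n (Nat.lt_succ_self n), hd, ← hP, map_sub]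
    abel

/-! ### The parity of the star product -/

/-- The substitution `α ↦ -α`. -/
def alt : FormalOp N →ₗ[ℝ] FormalOp N where
  toFun Z := PowerSeries.mk fun k => (-1 : ℝ) ^ k • PowerSeries.coeff k Z
  map_add' Z W := by
    ext1 k; simp only [PowerSeries.coeff_mk, map_add, smul_add]
  map_smul' c Z := by
    ext1 k
    simp only [PowerSeries.coeff_mk, PowerSeries.coeff_smul, RingHom.id_apply, smul_comm c]

lemma coeff_alt (k : ℕ) (Z : FormalOp N) :
    PowerSeries.coeff k (alt Z) = (-1 : ℝ) ^ k • PowerSeries.coeff k Z :=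
  PowerSeries.coeff_mk k fun k => (-1 : ℝ) ^ k • PowerSeries.coeff k Z

lemma alt_mul (Z W : FormalOp N) : alt (Z * W) = alt Z * alt W := by
  ext1 k
  rw [coeff_alt, PowerSeries.coeff_mul, PowerSeries.coeff_mul, Finset.smul_sum]
  refine Finset.sum_congr rfl fun x hx => ?_
  rw [HasAntidiagonal.mem_antidiagonal] at hx
  rw [coeff_alt, coeff_alt, smul_mul_assoc, mul_smul_comm, smul_smul, ← pow_add, hx]

lemma alt_C (P : Op N) : alt (PowerSeries.C P) = PowerSeries.C P := by
  ext1 k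
  rw [coeff_alt, PowerSeries.coeff_C]
  split_ifs with h
  · rw [h, pow_zero, one_smul]
  · rw [smul_zero]

lemma alt_alt (Z : FormalOp N) : alt (alt Z) = Z := by
  ext1 k
  rw [coeff_alt, coeff_alt, smul_smul, ← mul_pow]
  simp

/-- The deformed coordinates with the opposite deformation parameter. -/
def altX (X : Fin N → FormalOp N) (i : Fin N) : FormalOp N := alt (X i)

lemma centered_altX (X : Fin N → FormalOp N) (I : List (Fin N)) :
    centered (altX X) I = alt (centered X I) := by
  induction I with
  | nil =>
    have h : (1 : FormalOp N) = PowerSeries.C 1 := (map_one _).symm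
    rw [centered, centered, h, alt_C]
  | cons i I ih => rw [centered, centered, map_sub, alt_mul, alt_mul, alt_C, ih, altX]

lemma weyl_altX (X : Fin N → FormalOp N) (f : Smooth N) : weyl (altX X) f = alt (weyl X f) := by
  ext1 k
  simp only [coeff_alt, weyl, PowerSeries.coeff_mk, centered_altX, mul_smul_comm, Finset.smul_sum,
    smul_comm ((-1 : ℝ) ^ k)]

lemma IsDeformed.altX {X : Fin N → FormalOp N} (hX : IsDeformed X) : IsDeformed (altX X) := by
  refine ⟨fun i => ?_, fun i k => ?_, fun i k hk => ?_, fun c n k hk => ?_⟩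
  · rw [WeylStar.altX, coeff_alt, hX.zero, pow_zero, one_smul]
  · rw [WeylStar.altX, coeff_alt]; exact Submodule.smul_mem _ _ (hX.adm i k)
  · rw [WeylStar.altX, coeff_alt, LinearMap.smul_apply, hX.one i k hk, smul_zero]
  · simp only [WeylStar.altX, coeff_alt, LinearMap.smul_apply]
    rw [Finset.sum_congr rfl fun i _ => smul_comm (c i) _ _, ← Finset.smul_sum,
      hX.contract c n k hk, smul_zero]

lemma EqMod.sub_eq_zero {n : ℕ} {Z W : FormalOp N} (h : EqMod n Z W) : EqMod n (Z - W) 0 :=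
  fun k hk => by rw [map_sub, h k hk, sub_self, map_zero]

lemma EqMod.of_sub_eq_zero {n : ℕ} {Z W : FormalOp N} (h : EqMod n (Z - W) 0) : EqMod n Z W :=
  fun k hk => by
    have := h k hk
    rwa [map_sub, map_zero, _root_.sub_eq_zero] at this

/-- An operator that commutes with the deformed coordinates commutes with all Weyl ordered
operators. -/
lemma EqMod.commute_weyl {X : Fin N → FormalOp N} (hX : IsDeformed X) {n : ℕ} {Z : FormalOp N}
    (hZ : Adm Z) (h : ∀ i, EqMod n (Z * X i) (X i * Z)) (f : Smooth N) :
    EqMod n (Z * WeylStar.weyl X f) (WeylStar.weyl X f * Z) := by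
  have hdot : ∀ c m, EqMod n (Z * dot c X ^ m) (dot c X ^ m * Z) := by
    intro c m
    induction m with
    | zero => rw [pow_zero, mul_one, one_mul]; exact EqMod.refl _ _
    | succ m ih =>
      have h1 : EqMod n (Z * dot c X) (dot c X * Z) := by
        simp only [dot, Finset.mul_sum, Finset.sum_mul, mul_smul_comm, smul_mul_assoc]
        exact EqMod.sum _ fun i _ => (h i).smul _
      have h2 := ih.mul (EqMod.refl n (dot c X))
      have h3 := (EqMod.refl n (dot c X ^ m)).mul h1
      rw [mul_assoc, mul_assoc] at h2
      rw [← mul_assoc] at h3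
      rw [pow_succ]
      exact h2.trans (by rwa [mul_assoc] at h3 ⊢)
  intro k hk
  refine LinearMap.ext fun g => ?_
  -- both sides are differential operators in `f`, so that powers of linear functions suffice
  have h0 : ∑ x ∈ HasAntidiagonal.antidiagonal k, (PowerSeries.coeff x.1 Z * weylLeft X x.2 g)
      - ∑ x ∈ HasAntidiagonal.antidiagonal k, weylLeft X x.1 (PowerSeries.coeff x.2 Z g) = 0 := by
    refine eq_zero_of_lin_pow (sub_mem (Subalgebra.sum_mem _ fun x _ => mul_mem (mem_diffOp (hZ x.1))
      (weylLeft_mem_diffOp _ _ _)) (Subalgebra.sum_mem _ fun x _ => weylLeft_mem_diffOp _ _ _))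
      fun c m => ?_
    have := LinearMap.congr_fun (hdot c m k hk) g
    rw [← weyl_lin_pow hX, PowerSeries.coeff_mul, PowerSeries.coeff_mul] at this
    simp only [LinearMap.sum_apply, Module.End.mul_apply] at this
    simp only [LinearMap.sub_apply, LinearMap.sum_apply, Module.End.mul_apply, weylLeft_apply]
    rw [this, sub_self]
  have h1 := LinearMap.congr_fun h0 f
  simp only [LinearMap.sub_apply, LinearMap.sum_apply, Module.End.mul_apply, weylLeft_apply,
    LinearMap.zero_apply] at h1
  rw [PowerSeries.coeff_mul, PowerSeries.coeff_mul]
  simp only [LinearMap.sum_apply, Module.End.mul_apply]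
  exact _root_.sub_eq_zero.mp h1

lemma weylSeries_eq (X : Fin N → FormalOp N) (φ : FormalFn N) (k : ℕ) :
    PowerSeries.coeff k (weylSeries X φ) = ∑ q ∈ HasAntidiagonal.antidiagonal k,
      PowerSeries.coeff q.2 (weyl X (PowerSeries.coeff q.1 φ)) := PowerSeries.coeff_mk _ _

lemma EqMod.commute_weylSeries {X : Fin N → FormalOp N} (hX : IsDeformed X) {n : ℕ}
    {Z : FormalOp N} (hZ : Adm Z) (h : ∀ i, EqMod n (Z * X i) (X i * Z)) (φ : FormalFn N) :
    EqMod n (Z * WeylStar.weylSeries X φ) (WeylStar.weylSeries X φ * Z) := by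
  have hsum : EqMod n (WeylStar.weylSeries X φ) (∑ m ∈ range n,
      PowerSeries.X ^ m * WeylStar.weyl X (PowerSeries.coeff m φ)) := by
    intro k hk
    rw [weylSeries_eq, map_sum, Finset.Nat.sum_antidiagonal_eq_sum_range_succ
      (fun a b => PowerSeries.coeff b (WeylStar.weyl X (PowerSeries.coeff a φ)))]
    simp only [PowerSeries.coeff_X_pow_mul']
    rw [← Finset.sum_subset (Finset.range_mono (show k + 1 ≤ n by omega)) fun m _ hm => if_neg (by
      simpa using hm)]
    exact Finset.sum_congr rfl fun m hm => by
      rw [if_pos (by simpa [Nat.lt_succ_iff] using hm)]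
  refine (((EqMod.refl n Z).mul hsum).trans ?_).trans (hsum.symm.mul (EqMod.refl n Z))
  rw [Finset.mul_sum, Finset.sum_mul]
  refine EqMod.sum _ fun m _ => ?_
  have h1 := (EqMod.refl n (PowerSeries.X ^ m)).mul
    (EqMod.commute_weyl hX hZ h (PowerSeries.coeff m φ))
  rw [← mul_assoc, ← (PowerSeries.commute_X_pow Z m).eq, mul_assoc] at h1
  rwa [mul_assoc]

/-- If the tensors `ζ` of symbols satisfy `∂_{p_k} ζ^{ij} = ∂_{p_i} ζ^{kj}`, are symmetric or
skew-symmetric, have no constant terms, and `∑ p_i p_j ζ^{ij} = 0`, then they vanish. -/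
lemma eq_zero_of_pderiv_symm {ζ : Fin N → Fin N → Sym N} {ε : ℝ} (hε : ε = 1 ∨ ε = -1)
    (h1 : ∀ i j k, pderiv k (ζ i j) = pderiv i (ζ k j)) (h2 : ∀ i j, ζ j i = ε • ζ i j)
    (h3 : ∑ j, ∑ i, X j * (X i * ζ i j) = 0) (h4 : ∀ i j, constantCoeff (ζ i j) = 0)
    (i j : Fin N) : ζ i j = 0 := by
  obtain ⟨n, hn⟩ := exists_mem_degLT (ζ i j)
  rw [← sum_homogeneousComponent_of_mem_degLT hn]
  refine Finset.sum_eq_zero fun d _ => ?_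
  rcases d with _ | d
  · rw [homogeneousComponent_zero, ← constantCoeff_eq, h4, map_zero]
  -- Euler's identity, applied to `ψ^j = ∑ p_i ζ^{ij}` and to `ζ^{ij}`, in a fixed degree
  let η : Fin N → Fin N → Sym N := fun i j => homogeneousComponent (d + 1) (ζ i j)
  let ψ : Fin N → Sym N := fun j => ∑ i, X i * η i j
  have hη : ∀ i j k, pderiv k (η i j) = pderiv i (η k j) := fun i j k => by
    simp only [η, pderiv_homogeneousComponent, h1 i j k]
  have hsymm : ∀ i j, η j i = ε • η i j := fun i j => by
    simp only [η, h2 i j]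
    rw [← smul_one_smul (Smooth N) ε (ζ i j), map_smul, smul_one_smul]
  have hψ : ∀ i j, pderiv i (ψ j) = ((d : ℝ) + 2) • η i j := by
    intro i j
    have he := (homogeneousComponent_isHomogeneous (d + 1) (ζ i j)).sum_X_mul_pderiv
    change ∑ k, X k * pderiv k (η i j) = (d + 1) • η i j at he
    simp only [ψ, map_sum, pderiv_X_mul, Finset.sum_add_distrib, Finset.sum_ite_eq,
      Finset.mem_univ, if_true]
    rw [Finset.sum_congr rfl fun k _ => by rw [← hη i j k], he, ← Nat.cast_smul_eq_nsmul ℝ,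
      smul_add_one_smul (M := Sym N)]
    push_cast
    congr 1
    ring
  have h30 : ∑ j, X j * ψ j = 0 := by
    have := congrArg (homogeneousComponent (d + 1 + 2)) h3
    simp only [map_sum, homogeneousComponent_X_mul, map_zero, ← Finset.mul_sum] at this
    exact this
  have hψ0 : ∀ j, ψ j = 0 := by
    intro j
    have h5 := congrArg (pderiv j) h30
    simp only [map_sum, pderiv_X_mul, Finset.sum_add_distrib, Finset.sum_ite_eq,
      Finset.mem_univ, if_true, hψ, map_zero] at h5
    rw [Finset.sum_congr rfl fun i _ => by
      rw [hsymm i j, smul_smul, mul_smul_comm], ← Finset.smul_sum] at h5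
    change (((d : ℝ) + 2) * ε) • ψ j + ψ j = 0 at h5
    rw [smul_add_one_smul (M := Sym N)] at h5
    -- the factor `(d + 2) ε + 1` is `d + 3` or `-(d + 1)`
    refine (smul_eq_zero_iff_right ?_).mp h5
    rcases hε with rfl | rfl
    · positivity
    · have : (0 : ℝ) ≤ d := Nat.cast_nonneg d
      intro h
      linarith
  have h6 := hψ i j
  rw [hψ0, map_zero] at h6
  exact (smul_eq_zero_iff_right (by positivity)).mp h6.symm


/-- The relation `∑ p_i p_j ζ^{ij} = 0`, tested on powers of linear functions. -/
lemma sum_mul_eq_zero_of_lin_pow {ζ : Fin N → Fin N → Sym N}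
    (h : ∀ (c : Fin N → ℝ) (n : ℕ), ∑ j, ∑ i, c j • c i • op (ζ i j) (lin c ^ n) = 0) :
    ∑ j, ∑ i, X j * (X i * ζ i j) = 0 := by
  refine eq_zero_of_op_lin_pow fun c n => ?_
  simp only [map_sum, op_X_mul, LinearMap.sum_apply, Module.End.mul_apply]
  have hd : ∀ i j, partialOp i (partialOp j (lin c ^ n))
      = (n.descFactorial 2 : ℝ) • c j • c i • lin c ^ (n - 2) := by
    intro i j
    have := D_lin_pow c n [i, j]
    rw [D_cons, D_cons, D_nil, mul_one] at this
    rw [← Module.End.mul_apply, this]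
    simp [smul_smul, mul_comm]
  have h' := h c (n - 2)
  simp only [← Finset.smul_sum] at h'
  simp only [hd, map_smul, ← Finset.smul_sum, h', smul_zero]

/-- The parity theorem: the operators `X^i` commute with the operators `X^j` of the opposite
deformation parameter. Let `ζ` be the symbols of the lowest order of these commutators. By the
Jacobi identity and the commutation relation they satisfy `∂_{p_k} ζ^{ij} = ∂_{p_i} ζ^{kj}`, and symmetric
ordering gives `∑ p_i p_j ζ^{ij} = 0`, so that they vanish. -/
theorem eqMod_commute_altX {X : Fin N → FormalOp N} (hX : IsDeformed X)
    {φ : Fin N → Fin N → FormalFn N}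
    (heven : ∀ i j k, Odd k → PowerSeries.coeff k (φ i j) = 0) {n : ℕ}
    (hr : ∀ i j, EqMod n (X i * X j - X j * X i) (2 * PowerSeries.X * weylSeries X (φ i j)))
    (i j : Fin N) : EqMod n (altX X j * X i) (X i * altX X j) := by
  have hX' := hX.altX
  suffices h : ∀ m ≤ n, ∀ i j, EqMod m (X i * altX X j - altX X j * X i) 0 from
    (h n le_rfl i j).of_sub_eq_zero.symm
  intro m
  induction m with
  | zero => exact fun _ i j k hk => absurd hk (Nat.not_lt_zero k)
  | succ m ih =>
    intro hm
    replace ih := ih (by omega)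
    suffices h : ∀ i j, PowerSeries.coeff m (X i * altX X j - altX X j * X i) = 0 by
      intro i j k hk
      rcases Nat.lt_succ_iff_lt_or_eq.mp hk with hk | rfl
      · exact ih i j k hk
      · rw [h, map_zero]
    have hadm : ∀ i j, Adm (X i * altX X j - altX X j * X i) := fun i j =>
      ((hX.adm i).mul (hX'.adm j)).sub ((hX'.adm j).mul (hX.adm i))
    choose ζ _ hζ using fun i j => Submodule.mem_map.mp (hadm i j m)
    have hζ0 : ∀ i j, ζ i j = 0 := by
      refine eq_zero_of_pderiv_symm (ε := -(-1) ^ m) ?_ ?_ ?_ ?_ ?_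
      · rcases neg_one_pow_eq_or ℝ m with h | h <;> simp [h]
      · -- the Jacobi identity for `X^k`, `X^i` and `X^j` with the opposite parameter
        intro i j k
        have hJ : (X k * (X i * altX X j - altX X j * X i) - (X i * altX X j - altX X j * X i) * X k)
            - (X i * (X k * altX X j - altX X j * X k) - (X k * altX X j - altX X j * X k) * X i)
            = (X k * X i - X i * X k) * altX X j - altX X j * (X k * X i - X i * X k) := by
          noncomm_ring
        have h1 := congrArg (PowerSeries.coeff m) hJ
        have hz : PowerSeries.coeff m ((X k * X i - X i * X k) * altX X j
            - altX X j * (X k * X i - X i * X k)) = 0 := by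
          have h2 := ((hr k i).mul (EqMod.refl n (altX X j))).sub
            ((EqMod.refl n (altX X j)).mul (hr k i)) m (by omega)
          have h3 : 2 * PowerSeries.X * weylSeries X (φ k i) * altX X j
              - altX X j * (2 * PowerSeries.X * weylSeries X (φ k i)) = 2 * PowerSeries.X *
              (weylSeries X (φ k i) * altX X j - altX X j * weylSeries X (φ k i)) := by
            have hc : altX X j * (2 * PowerSeries.X * weylSeries X (φ k i))
                = 2 * PowerSeries.X * (altX X j * weylSeries X (φ k i)) := by
              rw [two_mul, add_mul, mul_add, ← mul_assoc, (PowerSeries.commute_X (altX X j)).eq,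
                mul_assoc, add_mul]
            rw [hc, mul_sub, mul_assoc]
          rw [h2, h3, coeff_two_X_mul]
          split_ifs with h0
          · rfl
          · have h4 := (EqMod.commute_weylSeries hX (hX'.adm j)
              (fun i => (ih i j).of_sub_eq_zero.symm) (φ k i)).symm.sub_eq_zero (m - 1) (by omega)
            rw [h4, map_zero, smul_zero]
        have hb : ∀ i k, PowerSeries.coeff m (X k * (X i * altX X j - altX X j * X i)
            - (X i * altX X j - altX X j * X i) * X k) = -op (pderiv k (ζ i j)) := by
          intro i k
          rw [map_sub, coeff_mul_of_eqMod_zero_right (ih i j), coeff_mul_of_eqMod_zero_left (ih i j),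
            hX.zero, ← hζ, op_mul_mulOp_coord, sub_add_cancel_left]
        rw [hz, map_sub, hb, hb, sub_neg_eq_add, neg_add_eq_sub, sub_eq_zero] at h1
        exact (op_injective h1).symm
      · -- `α ↦ -α` exchanges the two families of operators
        intro i j
        refine op_injective ?_
        have h1 : X j * altX X i - altX X i * X j
            = -alt (X i * altX X j - altX X j * X i) := by
          rw [map_sub, alt_mul, alt_mul, altX, altX, alt_alt]
          abel
        rw [map_smul, hζ, hζ, h1, map_neg, coeff_alt, neg_smul]
      · -- `c · X` acts on powers of `c · x` as multiplication by `c · x`, for both parameters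
        refine sum_mul_eq_zero_of_lin_pow fun c r => ?_
        have h1 : ∀ c r, PowerSeries.coeff m (dot c X * dot c (altX X)
            - dot c (altX X) * dot c X) (lin c ^ r) = 0 := by
          have h2 : ∀ {X Y : Fin N → FormalOp N} (_ : IsDeformed X) (_ : IsDeformed Y)
              (c : Fin N → ℝ) (r : ℕ), PowerSeries.coeff m (dot c X * dot c Y) (lin c ^ r)
              = if m = 0 then lin c ^ (r + 2) else 0 := by
            intro X Y hX hY c r
            rw [PowerSeries.coeff_mul, LinearMap.sum_apply,
              Finset.sum_eq_single_of_mem (m, 0) (by simp)]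
            · rw [Module.End.mul_apply, coeff_dot_lin_pow hY, if_pos rfl, coeff_dot_lin_pow hX]
            · intro x hx hne
              rw [HasAntidiagonal.mem_antidiagonal] at hx
              rw [Module.End.mul_apply, coeff_dot_lin_pow hY, if_neg, map_zero]
              rintro h
              exact hne (Prod.ext (by simp at *; omega) h)
          intro c r
          rw [map_sub, LinearMap.sub_apply, h2 hX hX', h2 hX' hX, sub_self]
        rw [← h1 c r]
        have h3 : dot c X * dot c (altX X) - dot c (altX X) * dot c X
            = ∑ j, ∑ i, c j • c i • (X i * altX X j - altX X j * X i) := by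
          simp only [smul_sub, Finset.sum_sub_distrib]
          congr 1
          · rw [dot, dot, Finset.sum_mul_sum, Finset.sum_comm]
            refine Finset.sum_congr rfl fun j _ => Finset.sum_congr rfl fun i _ => ?_
            rw [smul_mul_smul_comm, smul_smul, mul_comm (c i)]
          · rw [dot, dot, Finset.sum_mul_sum]
            refine Finset.sum_congr rfl fun j _ => Finset.sum_congr rfl fun i _ => ?_
            rw [smul_mul_smul_comm, smul_smul]
        rw [h3]
        simp only [map_sum, PowerSeries.coeff_smul, LinearMap.sum_apply, LinearMap.smul_apply, hζ]
      · -- the function parts of the commutators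
        intro i j
        rw [← op_apply_one, hζ]
        have h1 : ∀ {X Y : Fin N → FormalOp N} (_ : IsDeformed X) (_ : IsDeformed Y)
            (i j : Fin N), PowerSeries.coeff m (X i * Y j) 1
            = PowerSeries.coeff m (X i) (coord j) := by
          intro X Y hX hY i j
          rw [PowerSeries.coeff_mul, LinearMap.sum_apply,
              Finset.sum_eq_single_of_mem (m, 0) (by simp)]
          · rw [Module.End.mul_apply, hY.zero, mulOp_apply, mul_one]
          · intro x hx hne
            rw [HasAntidiagonal.mem_antidiagonal] at hx
            rw [Module.End.mul_apply, hY.one, map_zero]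
            rintro h
            exact hne (Prod.ext (by simp at *; omega) h)
        rw [map_sub, LinearMap.sub_apply, h1 hX hX', h1 hX' hX, altX, coeff_alt,
          LinearMap.smul_apply]
        rcases Nat.even_or_odd m with he | ho
        · -- even orders: the function part of the commutator is odd in the parameter
          rw [he.neg_one_pow, one_smul, ← h1 hX hX i j, ← h1 hX hX j i, ← LinearMap.sub_apply,
            ← map_sub, hr i j m (by omega), coeff_two_X_mul]
          split_ifs with h0
          · rfl
          · rw [LinearMap.smul_apply, coeff_weylSeries_apply_one hX, heven, smul_zero]
            exact Nat.Even.sub_odd (by omega) he odd_one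
        · -- odd orders: symmetrisation of `∑ p_i Y^i(p) = 0`
          rw [ho.neg_one_pow, neg_one_smul, sub_neg_eq_add]
          have h0 : m ≠ 0 := by rintro rfl; simp at ho
          have hq : ∀ c : Fin N → ℝ, ∑ i, ∑ j, (c i * c j) •
              PowerSeries.coeff m (X i) (coord j) = 0 := by
            intro c
            have := hX.contract c 1 m h0
            simpa only [pow_one, lin, map_sum, map_smul, Finset.smul_sum, smul_smul] using this
          have hs : ∀ (i j : Fin N) (a b : ℝ), ∑ k, ∑ l,
              ((Pi.single i a + Pi.single j b : Fin N → ℝ) k * (Pi.single i a + Pi.single j b : Fin N → ℝ) l) •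
              PowerSeries.coeff m (X k) (coord l)
              = (a * a) • PowerSeries.coeff m (X i) (coord i)
              + (b * b) • PowerSeries.coeff m (X j) (coord j)
              + (a * b) • (PowerSeries.coeff m (X i) (coord j) + PowerSeries.coeff m (X j) (coord i)) := by
            intro i j a b
            simp only [Pi.add_apply, add_mul, mul_add, add_smul, Finset.sum_add_distrib,
              Pi.single_apply, ite_mul, mul_ite, zero_mul, mul_zero, ite_smul, zero_smul,
              Finset.sum_ite_eq', Finset.mem_univ, if_true, smul_add, mul_comm b a]
            abel
          have h11 := hq (Pi.single i 1 + Pi.single j 1)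
          have h10 := hq (Pi.single i 1 + Pi.single j 0)
          have h01 := hq (Pi.single i 0 + Pi.single j 1)
          rw [hs] at h11 h10 h01
          simp only [mul_one, mul_zero, one_smul, zero_smul, add_zero, zero_add] at h11 h10 h01
          rwa [h10, h01, zero_add, zero_add] at h11
    intro i j
    rw [← hζ, hζ0, map_zero]

/-- Weyl ordered operators commute with the Weyl ordered operators of the opposite parameter. -/
lemma eqMod_commute_weyl_altX {X : Fin N → FormalOp N} (hX : IsDeformed X) {n : ℕ}
    (h : ∀ i j, EqMod n (altX X j * X i) (X i * altX X j)) (f g : Smooth N) :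
    EqMod n (weyl X f * weyl (altX X) g) (weyl (altX X) g * weyl X f) :=
  EqMod.commute_weyl hX.altX (adm_weyl hX f)
    (fun j => (EqMod.commute_weyl hX (hX.altX.adm j) (fun i => h i j) f).symm) g

/-- `f ⋆ g` turns into `g ⋆ f` under `α ↦ -α`. -/
theorem coeff_weyl_apply_comm {X : Fin N → FormalOp N} (hX : IsDeformed X) {n : ℕ}
    (h : ∀ i j, EqMod n (altX X j * X i) (X i * altX X j)) {k : ℕ} (hk : k < n)
    (f g : Smooth N) :
    PowerSeries.coeff k (weyl X f) g = (-1 : ℝ) ^ k • PowerSeries.coeff k (weyl X g) f := by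
  have hone : ∀ {X : Fin N → FormalOp N} (_ : IsDeformed X) (Z : FormalOp N) (g : Smooth N),
      PowerSeries.coeff k (Z * weyl X g) 1 = PowerSeries.coeff k Z g := by
    intro X hX Z g
    rw [PowerSeries.coeff_mul, LinearMap.sum_apply, Finset.sum_eq_single_of_mem (k, 0) (by simp)]
    · rw [Module.End.mul_apply, coeff_weyl_apply_one hX, if_pos rfl]
    · intro x hx hne
      rw [HasAntidiagonal.mem_antidiagonal] at hx
      rw [Module.End.mul_apply, coeff_weyl_apply_one hX, if_neg, map_zero]
      rintro h
      exact hne (Prod.ext (by simp at *; omega) h)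
  have := LinearMap.congr_fun (eqMod_commute_weyl_altX hX h f g k hk) 1
  rwa [hone hX.altX, hone hX, weyl_altX, coeff_alt, LinearMap.smul_apply] at this

/-- A formal operator that annihilates `1` and commutes with deformed coordinates vanishes. -/
lemma eqMod_zero_of_commute {X : Fin N → FormalOp N} (hX : IsDeformed X) {n : ℕ}
    {A : FormalOp N} (hA : Adm A) (h : ∀ i, EqMod n (A * X i) (X i * A))
    (h1 : ∀ k < n, PowerSeries.coeff k A 1 = 0) : EqMod n A 0 := by
  suffices hm : ∀ m ≤ n, EqMod m A 0 from hm n le_rfl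
  intro m
  induction m with
  | zero => exact fun _ k hk => absurd hk (Nat.not_lt_zero k)
  | succ m ih =>
    intro hm k hk
    rcases Nat.lt_succ_iff_lt_or_eq.mp hk with hk | rfl
    · exact ih (by omega) k hk
    · rw [map_zero]
      refine eq_zero_of_commute_coord (mem_diffOp (hA k)) (fun i => ?_) (h1 k (by omega))
      rw [← hX.zero i, ← coeff_mul_of_eqMod_zero_left (ih (by omega)),
        ← coeff_mul_of_eqMod_zero_right (ih (by omega)), h i k (by omega)]

/-! ### Consistency conditions -/

lemma lin_single (i : Fin N) : lin (Pi.single i 1) = coord i := by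
  simp [lin, Pi.single_apply]

lemma weyl_coord {X : Fin N → FormalOp N} (hX : IsDeformed X) (i : Fin N) :
    weyl X (coord i) = X i := by
  have := weyl_lin_pow hX (Pi.single i 1) 1
  rw [pow_one, pow_one, lin_single] at this
  rw [this]
  simp [dot, Pi.single_apply]

/-- The commutators `[x^i, φ]` of the star product are odd in the formal parameter. -/
lemma coeff_commutator_weylSeries_apply_one {X : Fin N → FormalOp N} (hX : IsDeformed X) {n : ℕ}
    (h : ∀ i j, EqMod n (altX X j * X i) (X i * altX X j)) {φ : FormalFn N}
    (heven : ∀ k, Odd k → PowerSeries.coeff k φ = 0) (i : Fin N) {m : ℕ} (hm : m < n) :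
    PowerSeries.coeff m (X i * weylSeries X φ - weylSeries X φ * X i) 1
      = (1 - (-1 : ℝ) ^ m) • ∑ q ∈ HasAntidiagonal.antidiagonal m,
        PowerSeries.coeff q.2 (X i) (PowerSeries.coeff q.1 φ) := by
  have h1 : PowerSeries.coeff m (X i * weylSeries X φ) 1 = ∑ q ∈ HasAntidiagonal.antidiagonal m,
      PowerSeries.coeff q.2 (X i) (PowerSeries.coeff q.1 φ) := by
    rw [PowerSeries.coeff_mul, LinearMap.sum_apply, ← Finset.Nat.sum_antidiagonal_swap]
    refine Finset.sum_congr rfl fun q _ => ?_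
    rw [Module.End.mul_apply, coeff_weylSeries_apply_one hX]
    rfl
  have h2 : PowerSeries.coeff m (weylSeries X φ * X i) 1
      = (-1 : ℝ) ^ m • ∑ q ∈ HasAntidiagonal.antidiagonal m,
        PowerSeries.coeff q.2 (X i) (PowerSeries.coeff q.1 φ) := by
    rw [PowerSeries.coeff_mul, LinearMap.sum_apply, Finset.sum_eq_single_of_mem (m, 0) (by simp)]
    · rw [Module.End.mul_apply, hX.zero, mulOp_apply, mul_one, weylSeries_eq, LinearMap.sum_apply,
        Finset.smul_sum]
      refine Finset.sum_congr rfl fun q hq => ?_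
      rw [HasAntidiagonal.mem_antidiagonal] at hq
      rw [coeff_weyl_apply_comm hX h (by omega), weyl_coord hX]
      rcases Nat.even_or_odd q.1 with he | ho
      · rw [← hq, pow_add, he.neg_one_pow, one_mul]
      · rw [heven _ ho, map_zero, smul_zero, smul_zero]
    · intro x hx hne
      rw [HasAntidiagonal.mem_antidiagonal] at hx
      rw [Module.End.mul_apply, hX.one, map_zero]
      rintro h
      exact hne (Prod.ext (by simp at *; omega) h)
  rw [map_sub, LinearMap.sub_apply, h1, h2, sub_smul, one_smul]

lemma adm_coordOmegaComm {ω : Fin N → Fin N → FormalFn N} (hω : ∀ i j, ω i j = -ω j i) (n : ℕ)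
    (i j k : Fin N) : Adm (coordOmegaComm ω n i j k) :=
  have hX := isDeformed_xhat hω n
  ((hX.adm i).mul (adm_weylSeries hX _)).sub ((adm_weylSeries hX _).mul (hX.adm i))

lemma CommutationRelation.commute_altX {ω : Fin N → Fin N → FormalFn N}
    (hω : ∀ i j, ω i j = -ω j i) (heven : ∀ i j k, Odd k → PowerSeries.coeff k (ω i j) = 0)
    {n : ℕ} (hr : CommutationRelation ω n) (i j : Fin N) :
    EqMod (n + 1) (altX (xhat ω n) j * xhat ω n i) (xhat ω n i * altX (xhat ω n) j) :=
  eqMod_commute_altX (isDeformed_xhat hω n) heven (commutationRelation_iff.mp hr) i j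

/-- If the commutation relation holds in the order `α^n`, then only the function parts of odd order
have to be checked in the consistency condition: the cyclic sum of commutators commutes with the
coordinates of the opposite parameter, so it vanishes as soon as it annihilates `1`, and its function
parts of even order are zero by the parity of the star product. -/
theorem CommutationRelation.consistencyCondition {ω : Fin N → Fin N → FormalFn N}
    (hω : ∀ i j, ω i j = -ω j i) (heven : ∀ i j k, Odd k → PowerSeries.coeff k (ω i j) = 0)
    {n : ℕ} (hr : CommutationRelation ω n)
    (hodd : ∀ m ≤ n, Odd m → ∀ i j k, PowerSeries.coeff m
      (coordOmegaComm ω n i j k + coordOmegaComm ω n j k i + coordOmegaComm ω n k i j) 1 = 0) :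
    ConsistencyCondition ω n := by
  rw [consistencyCondition_iff]
  intro i j k
  have hX := isDeformed_xhat hω n
  have hc := hr.commute_altX hω heven
  refine eqMod_zero_of_commute hX.altX (((adm_coordOmegaComm hω n i j k).add
    (adm_coordOmegaComm hω n j k i)).add (adm_coordOmegaComm hω n k i j)) (fun l => ?_)
    fun m hm => ?_
  · have hw : ∀ a b, EqMod (n + 1) (weylSeries (xhat ω n) (ω a b) * altX (xhat ω n) l)
        (altX (xhat ω n) l * weylSeries (xhat ω n) (ω a b)) := fun a b =>
      (EqMod.commute_weylSeries hX (hX.altX.adm l) (fun i => hc i l) (ω a b)).symm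
    have hp : ∀ i a b, EqMod (n + 1) (coordOmegaComm ω n i a b * altX (xhat ω n) l)
        (altX (xhat ω n) l * coordOmegaComm ω n i a b) := by
      have hmul : ∀ {Z W A : FormalOp N}, EqMod (n + 1) (Z * A) (A * Z) →
          EqMod (n + 1) (W * A) (A * W) → EqMod (n + 1) (Z * W * A) (A * (Z * W)) := by
        intro Z W A h1 h2
        have h3 := (EqMod.refl (n + 1) Z).mul h2
        have h4 := h1.mul (EqMod.refl (n + 1) W)
        rw [← mul_assoc] at h3
        rw [mul_assoc Z, mul_assoc A] at h4
        exact h3.trans h4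
      intro i a b
      rw [coordOmegaComm, sub_mul, mul_sub]
      exact (hmul (hc i l).symm (hw a b)).sub (hmul (hw a b) (hc i l).symm)
    rw [add_mul, add_mul, mul_add, mul_add]
    exact ((hp i j k).add (hp j k i)).add (hp k i j)
  · rcases Nat.even_or_odd m with he | ho
    · have h1 : ∀ i j k, PowerSeries.coeff m (coordOmegaComm ω n i j k) 1 = 0 := fun i j k => by
        rw [coordOmegaComm, coeff_commutator_weylSeries_apply_one hX hc (heven j k) i hm,
          he.neg_one_pow, sub_self, zero_smul]
      rw [map_add, map_add, LinearMap.add_apply, LinearMap.add_apply, h1, h1, h1, add_zero,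
        add_zero]
    · exact hodd m (by omega) ho i j k

lemma coeff_correctedOmega (ω₀ ω₂ : Fin N → Fin N → Smooth N) (i j : Fin N) (k : ℕ) :
    PowerSeries.coeff k (correctedOmega ω₀ ω₂ i j)
      = if k = 0 then ω₀ i j else if k = 2 then ω₂ i j else 0 := by
  rw [correctedOmega, map_add, PowerSeries.coeff_C, PowerSeries.coeff_X_pow_mul',
    PowerSeries.coeff_C]
  rcases k with _ | _ | _ | k <;> simp

lemma correctedOmega_even (ω₀ ω₂ : Fin N → Fin N → Smooth N) (i j : Fin N) (k : ℕ) (hk : Odd k) :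
    PowerSeries.coeff k (correctedOmega ω₀ ω₂ i j) = 0 := by
  rw [coeff_correctedOmega, if_neg, if_neg]
  · rintro rfl; exact absurd hk (by decide)
  · rintro rfl; exact absurd hk (by decide)

lemma correctedOmega_skew {ω₀ ω₂ : Fin N → Fin N → Smooth N} (h₀ : ∀ i j, ω₀ i j = -ω₀ j i)
    (h₂ : ∀ i j, ω₂ i j = -ω₂ j i) (i j : Fin N) :
    correctedOmega ω₀ ω₂ i j = -correctedOmega ω₀ ω₂ j i := by
  ext1 k
  rw [map_neg, coeff_correctedOmega, coeff_correctedOmega, h₀ i j, h₂ i j]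
  split_ifs <;> simp

/-- The consistency condition in the order `n` implies all commutation relations up to the order
`n + 1`. -/
lemma ConsistencyCondition.commutationRelation {ω : Fin N → Fin N → FormalFn N}
    (hω : ∀ i j, ω i j = -ω j i) {n : ℕ} (hc : ConsistencyCondition ω n) :
    ∀ m ≤ n + 1, CommutationRelation ω m := by
  intro m
  induction m with
  | zero => exact fun _ => commutationRelation_zero ω
  | succ m ih => exact fun hm => (ih (by omega)).succ hω (hc.mono (by omega))

/-- In even orders the consistency condition holds automatically. -/
lemma ConsistencyCondition.succ_of_even {ω : Fin N → Fin N → FormalFn N}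
    (hω : ∀ i j, ω i j = -ω j i) (heven : ∀ i j k, Odd k → PowerSeries.coeff k (ω i j) = 0)
    {n : ℕ} (hn : Even (n + 1)) (hc : ConsistencyCondition ω n) :
    ConsistencyCondition ω (n + 1) := by
  refine (hc.commutationRelation hω (n + 1) le_rfl).consistencyCondition hω heven
    fun m hm ho i j k => ?_
  have hmn : m < n + 1 := by
    rcases hm.lt_or_eq with h | rfl
    · exact h
    · exact absurd hn (Nat.not_even_iff_odd.mpr ho)
  have h1 := fun a b c => eqMod_coordOmegaComm ω (Nat.le_succ n) a b c m hmn
  have h2 := consistencyCondition_iff.mp hc i j k m hmn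
  rw [map_add, map_add] at h2 ⊢
  rw [h1, h1, h1, h2, map_zero, LinearMap.zero_apply]

/-! ### Symbols of the deformed coordinates and of their symmetrised products -/

/-- The composition of symbols. -/
def hash (q r : Sym N) : Sym N := ∑ k ∈ range (q.totalDegree + 1), bid k q r

lemma op_hash (q r : Sym N) : op (hash q r) = op q * op r := by
  refine (op_mul_op (fun m hm => coeff_eq_zero_of_totalDegree_lt ?_) r).symm
  rw [← Finsupp.degree_apply]; omega

lemma hash_eq {K : ℕ} {q : Sym N} (hq : q ∈ degLT N K) (r : Sym N) :
    hash q r = ∑ k ∈ range K, bid k q r :=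
  op_injective (by rw [op_hash, op_mul_op hq])

lemma hash_one (r : Sym N) : hash 1 r = r := op_injective (by rw [op_hash, op_one, one_mul])

lemma hash_zero_left (r : Sym N) : hash 0 r = 0 := op_injective (by rw [op_hash, map_zero, zero_mul])

lemma hash_zero_right (r : Sym N) : hash r 0 = 0 := op_injective (by rw [op_hash, map_zero, mul_zero])

lemma hash_add_left (p q r : Sym N) : hash (p + q) r = hash p r + hash q r :=
  op_injective (by simp only [op_hash, map_add, add_mul])

lemma hash_add_right (p q r : Sym N) : hash p (q + r) = hash p q + hash p r :=
  op_injective (by simp only [op_hash, map_add, mul_add])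

lemma hash_mem_degLT {a b : ℕ} {q r : Sym N} (hq : q ∈ degLT N (a + 1)) (hr : r ∈ degLT N (b + 1)) :
    hash q r ∈ degLT N (a + b + 1) := by
  rw [hash_eq hq]
  exact Submodule.sum_mem _ fun k _ => degLT_mono (by omega) (bid_mem_degLT k hq hr)

/-- The full symbol of a differential operator. -/
def symb (P : Op N) : Sym N := Function.invFun op P

lemma symb_op (q : Sym N) : symb (op q) = q := Function.leftInverse_invFun op_injective q

lemma op_symb {n : ℕ} {P : Op N} (hP : P ∈ ordLT N n) : op (symb P) = P := by
  obtain ⟨q, _, rfl⟩ := hP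
  rw [symb_op]

lemma symb_mem_degLT {n : ℕ} {P : Op N} (hP : P ∈ ordLT N n) : symb P ∈ degLT N n := by
  obtain ⟨q, hq, rfl⟩ := hP
  rwa [symb_op]

/-- The symbol of the `α^k`-coefficient of `X i - x^i`. -/
def ys (X : Fin N → FormalOp N) (k : ℕ) (i : Fin N) : Sym N :=
  if k = 0 then 0 else symb (PowerSeries.coeff k (X i))

section ys

variable {X : Fin N → FormalOp N}

lemma ys_zero (i : Fin N) : ys X 0 i = 0 := if_pos rfl

lemma op_ys (hX : IsDeformed X) {k : ℕ} (hk : k ≠ 0) (i : Fin N) :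
    op (ys X k i) = PowerSeries.coeff k (X i) := by
  rw [ys, if_neg hk, op_symb (hX.adm i k)]

lemma ys_mem_degLT (hX : IsDeformed X) (k : ℕ) (i : Fin N) : ys X k i ∈ degLT N (k + 1) := by
  rw [ys]
  split_ifs
  · exact zero_mem _
  · exact symb_mem_degLT (hX.adm i k)

lemma constantCoeff_ys (hX : IsDeformed X) (k : ℕ) (i : Fin N) : constantCoeff (ys X k i) = 0 := by
  rcases eq_or_ne k 0 with rfl | hk
  · rw [ys_zero, map_zero]
  · rw [← op_apply_one, op_ys hX hk, hX.one i k hk]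

lemma sum_X_mul_ys (hX : IsDeformed X) (k : ℕ) : ∑ i, MvPolynomial.X i * ys X k i = 0 := by
  rcases eq_or_ne k 0 with rfl | hk
  · simp [ys_zero]
  refine eq_zero_of_op_lin_pow fun c n => ?_
  have hd : ∀ i, partialOp i (lin c ^ n) = (n : ℝ) • c i • lin c ^ (n - 1) := fun i => by
    have := D_lin_pow c n [i]
    simpa [D, smul_smul] using this
  simp only [map_sum, op_X_mul, LinearMap.sum_apply, Module.End.mul_apply, hd, map_smul,
    op_ys hX hk, ← Finset.smul_sum, hX.contract c _ k hk, smul_zero]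

/-- The symbol of `c · (X - x)` in the order `α^k`. -/
def qs (X : Fin N → FormalOp N) (c : Fin N → ℝ) (k : ℕ) : Sym N := ∑ i, c i • ys X k i

lemma op_qs (hX : IsDeformed X) (c : Fin N → ℝ) {k : ℕ} (hk : k ≠ 0) :
    op (qs X c k) = PowerSeries.coeff k (dot c X) := by
  simp only [qs, dot, map_sum, map_smul, PowerSeries.coeff_smul, op_ys hX hk]

lemma qs_mem_degLT (hX : IsDeformed X) (c : Fin N → ℝ) (k : ℕ) : qs X c k ∈ degLT N (k + 1) :=
  Submodule.sum_mem _ fun i _ => Submodule.smul_mem _ _ (ys_mem_degLT hX k i)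

/-- The symbols of the contracted centered products `cen X c m`. -/
def cs (X : Fin N → FormalOp N) (c : Fin N → ℝ) : ℕ → ℕ → Sym N
  | 0, k => if k = 0 then 1 else 0
  | m + 1, k => ∑ a ∈ range k, hash (cs X c m a) (qs X c (k - a)) + dirD c (cs X c m k)

lemma cs_mem_degLT (hX : IsDeformed X) (c : Fin N → ℝ) (m k : ℕ) :
    cs X c m k ∈ degLT N (k + 1) := by
  induction m generalizing k with
  | zero =>
    rw [cs]
    split_ifs
    · rw [← C_1]; exact degLT_mono (by omega) (C_mem_degLT 1)
    · exact zero_mem _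
  | succ m ih =>
    rw [cs]
    refine Submodule.add_mem _ (Submodule.sum_mem _ fun a ha => ?_)
      (degLT_mono (by omega) (dirD_mem_degLT (ih k) c))
    rw [Finset.mem_range] at ha
    exact degLT_mono (by omega) (hash_mem_degLT (ih a) (qs_mem_degLT hX c (k - a)))

lemma op_cs (hX : IsDeformed X) (c : Fin N → ℝ) (m k : ℕ) :
    op (cs X c m k) = PowerSeries.coeff k (cen X c m) := by
  induction m generalizing k with
  | zero =>
    rw [cs, cen_zero, PowerSeries.coeff_one]
    split_ifs
    · exact op_one
    · exact map_zero op
  | succ m ih =>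
    have h0 : PowerSeries.coeff 0 (dot c X) = mulOp (lin c) := by
      simp only [dot, map_sum, PowerSeries.coeff_smul, hX.zero, lin, mulOp_sum, mulOp_smul]
    rw [cs, cen_succ, map_sub, PowerSeries.coeff_mul, PowerSeries.coeff_C_mul,
      Finset.Nat.sum_antidiagonal_eq_sum_range_succ
      (fun a b => PowerSeries.coeff a (cen X c m) * PowerSeries.coeff b (dot c X)),
      Finset.sum_range_succ, Nat.sub_self, h0, ← ih, op_mul_mulOp_lin, map_add, map_sum]
    rw [add_sub_assoc, add_sub_cancel_left]
    congr 1
    refine Finset.sum_congr rfl fun a ha => ?_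
    rw [Finset.mem_range] at ha
    rw [op_hash, ih, op_qs hX c (by omega)]

lemma cs_one (c : Fin N → ℝ) {k : ℕ} (hk : k ≠ 0) : cs X c 1 k = qs X c k := by
  have h : dirD c (cs X c 0 k) = 0 := by
    rw [cs, if_neg hk, dirD_zero]
  rw [cs, h, add_zero, Finset.sum_eq_single_of_mem 0 (by simpa using Nat.pos_of_ne_zero hk)]
  · rw [cs, if_pos rfl, hash_one, Nat.sub_zero]
  · intro a _ ha
    rw [cs, if_neg ha, hash_zero_left]

lemma cs_succ_zero (c : Fin N → ℝ) (m : ℕ) : cs X c (m + 1) 0 = 0 := by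
  induction m with
  | zero => rw [cs, cs, if_pos rfl, ← C_1, dirD_C, Finset.sum_range_zero, add_zero]
  | succ m ih => rw [cs, ih, Finset.sum_range_zero, dirD_zero, add_zero]

end ys

lemma D_expo (c : Fin N → ℝ) (I : List (Fin N)) : D I (expo c) = (I.map c).prod • expo c := by
  induction I with
  | nil => simp [D_nil]
  | cons i I ih =>
    rw [D_cons, Module.End.mul_apply, ih, map_smul, partialOp_expo, smul_smul, List.map_cons,
      List.prod_cons, mul_comm]

/-- The contributions of `m`-fold products to Weyl ordering vanish if the contracted centered
products vanish. -/
lemma sum_D_centered_eq_zero {X : Fin N → FormalOp N} {m k : ℕ}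
    (h : ∀ c, PowerSeries.coeff k (cen X c m) = 0) (f : Smooth N) :
    ∑ I : Fin m → Fin N, mulOp (D (List.ofFn I) f) * PowerSeries.coeff k (centered X (List.ofFn I))
      = 0 := by
  refine LinearMap.ext fun g => ?_
  have h0 : ∑ I : Fin m → Fin N, mulOp (PowerSeries.coeff k (centered X (List.ofFn I)) g)
      * D (List.ofFn I) = 0 := by
    refine eq_zero_of_expo (Subalgebra.sum_mem _ fun I _ => mem_diffOp
      (mul_mem_ordLT (mulOp_mem_ordLT _) (D_mem_ordLT _))) fun c => ?_
    have := LinearMap.congr_fun (h c) g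
    simp only [cen, map_sum, PowerSeries.coeff_smul, LinearMap.sum_apply, LinearMap.smul_apply,
      LinearMap.zero_apply] at this
    simp only [LinearMap.sum_apply, Module.End.mul_apply, D_expo, List.map_ofFn, List.prod_ofFn,
      mulOp_apply, mul_smul_comm, Function.comp_apply]
    simp only [← smul_mul_assoc, ← Finset.sum_mul, this, zero_mul]
  have := LinearMap.congr_fun h0 f
  simpa only [LinearMap.sum_apply, Module.End.mul_apply, mulOp_apply, LinearMap.zero_apply,
    mul_comm] using this

/-! ### Weyl ordering in low orders -/

section LowOrder

variable {X : Fin N → FormalOp N}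

lemma dirD_sum {ι : Type*} (c : Fin N → ℝ) (s : Finset ι) (q : ι → Sym N) :
    dirD c (∑ i ∈ s, q i) = ∑ i ∈ s, dirD c (q i) :=
  map_sum (AddMonoidHom.mk' (dirD c) (dirD_add c)) q s

lemma dirD_mul (c : Fin N → ℝ) (p q : Sym N) : dirD c (p * q) = p * dirD c q + q * dirD c p := by
  simp only [dirD, Derivation.leibniz, smul_eq_mul, smul_add, Finset.sum_add_distrib,
    Finset.mul_sum, mul_smul_comm]

lemma dirD_cpd (c : Fin N → ℝ) (l : Fin N) (q : Sym N) : dirD c (cpd l q) = cpd l (dirD c q) := by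
  simp only [dirD, map_sum, map_smul, cpd_pderiv]

lemma pderiv_comm (i j : Fin N) (q : Sym N) : pderiv i (pderiv j q) = pderiv j (pderiv i q) := by
  ext1 m
  simp only [coeff_pderiv, Finsupp.add_apply, Finsupp.single_apply, add_right_comm]
  by_cases h : i = j
  · subst h; rfl
  · simp only [if_neg h, if_neg (Ne.symm h), add_zero]; ring

lemma dirD_pderiv (c : Fin N → ℝ) (l : Fin N) (q : Sym N) :
    dirD c (pderiv l q) = pderiv l (dirD c q) := by
  simp only [dirD, map_sum, Derivation.map_smul_of_tower, pderiv_comm l]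

lemma dirD_bid (c : Fin N → ℝ) (k : ℕ) (p q : Sym N) :
    dirD c (bid k p q) = bid k (dirD c p) q + bid k p (dirD c q) := by
  induction k generalizing p q with
  | zero => rw [bid_zero, bid_zero, bid_zero, dirD_mul, mul_comm q, add_comm]
  | succ k ih =>
    simp only [bid_succ, dirD_smul, dirD_sum, ih, dirD_pderiv, dirD_cpd, Finset.sum_add_distrib,
      smul_add]

lemma dirD_hash (c : Fin N → ℝ) (p q : Sym N) :
    dirD c (hash p q) = hash (dirD c p) q + hash p (dirD c q) := by
  obtain ⟨K, hK⟩ := exists_mem_degLT p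
  rw [hash_eq hK, hash_eq hK, hash_eq (degLT_mono (Nat.sub_le K 1) (dirD_mem_degLT hK c)), dirD_sum]
  simp only [dirD_bid, Finset.sum_add_distrib]

/-- Since `∑ p_i Y^i(p) = 0`, the top order part of `c · Y` vanishes at `c`. -/
lemma dirD_iterate_qs (hX : IsDeformed X) (c : Fin N → ℝ) (k : ℕ) :
    (dirD c)^[k] (qs X c k) = 0 := by
  have h : ∀ s : Finset (Fin N), (dirD c)^[k + 1] (∑ i ∈ s, MvPolynomial.X i * ys X k i)
      = ((k : ℝ) + 1) • (dirD c)^[k] (∑ i ∈ s, c i • ys X k i) := by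
    intro s
    induction s using Finset.cons_induction with
    | empty =>
      rw [Finset.sum_empty, Finset.sum_empty, dirD_iterate_eq_zero (zero_mem _),
        dirD_iterate_eq_zero (zero_mem _), smul_zero]
    | cons i s hi ih =>
      rw [Finset.sum_cons, Finset.sum_cons, dirD_iterate_add, dirD_iterate_add, ih,
        dirD_iterate_X_mul, dirD_iterate_eq_zero (ys_mem_degLT hX k i), mul_zero, zero_add,
        dirD_iterate_smul, smul_add]
  have h1 := h univ
  rw [sum_X_mul_ys hX, dirD_iterate_eq_zero (zero_mem _)] at h1
  exact (smul_eq_zero_iff_right (by positivity)).mp h1.symm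

lemma dirD_qs_one (hX : IsDeformed X) (c : Fin N → ℝ) : dirD c (qs X c 1) = 0 :=
  dirD_iterate_qs hX c 1

lemma dirD_dirD_qs_two (hX : IsDeformed X) (c : Fin N → ℝ) : dirD c (dirD c (qs X c 2)) = 0 :=
  dirD_iterate_qs hX c 2

lemma cs_succ (c : Fin N → ℝ) (m k : ℕ) : cs X c (m + 1) k
    = ∑ a ∈ range k, hash (cs X c m a) (qs X c (k - a)) + dirD c (cs X c m k) := rfl

lemma cs_two_one (hX : IsDeformed X) (c : Fin N → ℝ) : cs X c 2 1 = 0 := by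
  rw [cs_succ, cs_one c one_ne_zero, dirD_qs_one hX, Finset.sum_range_one, cs_succ_zero,
    hash_zero_left, add_zero]

lemma cs_two_two (c : Fin N → ℝ) :
    cs X c 2 2 = hash (qs X c 1) (qs X c 1) + dirD c (qs X c 2) := by
  rw [cs_succ, cs_one c two_ne_zero, Finset.sum_range_succ, Finset.sum_range_one, cs_succ_zero,
    hash_zero_left, zero_add, cs_one c one_ne_zero]

lemma cs_two_three (c : Fin N → ℝ) : cs X c 2 3 = hash (qs X c 1) (qs X c 2)
    + hash (qs X c 2) (qs X c 1) + dirD c (qs X c 3) := by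
  rw [cs_succ, cs_one c three_ne_zero, Finset.sum_range_succ, Finset.sum_range_succ,
    Finset.sum_range_one, cs_succ_zero, hash_zero_left, zero_add, cs_one c one_ne_zero,
    cs_one c two_ne_zero]

lemma cs_two_four (c : Fin N → ℝ) : cs X c 2 4 = hash (qs X c 1) (qs X c 3)
    + hash (qs X c 2) (qs X c 2) + hash (qs X c 3) (qs X c 1) + dirD c (qs X c 4) := by
  rw [cs_succ, cs_one c four_ne_zero, Finset.sum_range_succ, Finset.sum_range_succ,
    Finset.sum_range_succ, Finset.sum_range_one, cs_succ_zero, hash_zero_left, zero_add,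
    cs_one c one_ne_zero, cs_one c two_ne_zero, cs_one c three_ne_zero]

lemma dirD_cs_two_two (hX : IsDeformed X) (c : Fin N → ℝ) : dirD c (cs X c 2 2) = 0 := by
  rw [cs_two_two, dirD_add, dirD_hash, dirD_qs_one hX, dirD_dirD_qs_two hX, hash_zero_left,
    hash_zero_right, add_zero, add_zero]

lemma cs_three_one (hX : IsDeformed X) (c : Fin N → ℝ) : cs X c 3 1 = 0 := by
  rw [cs_succ, cs_two_one hX, dirD_zero, Finset.sum_range_one, cs_succ_zero,
    hash_zero_left, add_zero]

lemma cs_three_two (hX : IsDeformed X) (c : Fin N → ℝ) : cs X c 3 2 = 0 := by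
  rw [cs_succ, dirD_cs_two_two hX, Finset.sum_range_succ, Finset.sum_range_one, cs_succ_zero,
    hash_zero_left, cs_two_one hX, hash_zero_left, add_zero, add_zero]

lemma cs_three_three (hX : IsDeformed X) (c : Fin N → ℝ) :
    cs X c 3 3 = hash (cs X c 2 2) (qs X c 1) + dirD c (cs X c 2 3) := by
  rw [cs_succ, Finset.sum_range_succ, Finset.sum_range_succ, Finset.sum_range_one, cs_succ_zero,
    hash_zero_left, cs_two_one hX, hash_zero_left, add_zero, zero_add]

lemma cs_three_four (hX : IsDeformed X) (c : Fin N → ℝ) :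
    cs X c 3 4 = hash (cs X c 2 2) (qs X c 2) + hash (cs X c 2 3) (qs X c 1)
      + dirD c (cs X c 2 4) := by
  rw [cs_succ, Finset.sum_range_succ, Finset.sum_range_succ, Finset.sum_range_succ,
    Finset.sum_range_one, cs_succ_zero, hash_zero_left, cs_two_one hX, hash_zero_left, add_zero,
    zero_add]

lemma cs_four_two (hX : IsDeformed X) (c : Fin N → ℝ) : cs X c 4 2 = 0 := by
  rw [cs_succ, cs_three_two hX, dirD_zero, Finset.sum_range_succ, Finset.sum_range_one,
    cs_succ_zero, hash_zero_left, cs_three_one hX, hash_zero_left, add_zero, add_zero]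

lemma cs_four_four (hX : IsDeformed X) (c : Fin N → ℝ) :
    cs X c 4 4 = hash (cs X c 3 3) (qs X c 1) + dirD c (cs X c 3 4) := by
  rw [cs_succ, Finset.sum_range_succ, Finset.sum_range_succ, Finset.sum_range_succ,
    Finset.sum_range_one, cs_succ_zero, hash_zero_left, cs_three_one hX, cs_three_two hX,
    hash_zero_left, hash_zero_left, add_zero, zero_add, zero_add]

lemma coeff_centered_singleton (hX : IsDeformed X) {k : ℕ} (hk : k ≠ 0) (i : Fin N) :
    PowerSeries.coeff k (centered X [i]) = op (ys X k i) := by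
  rw [centered, centered, one_mul, mul_one, map_sub, PowerSeries.coeff_C, if_neg hk, sub_zero,
    op_ys hX hk]

lemma coeff_zero_centered_singleton (hX : IsDeformed X) (i : Fin N) :
    PowerSeries.coeff 0 (centered X [i]) = 0 := by
  rw [centered, centered, one_mul, mul_one, map_sub, PowerSeries.coeff_C, if_pos rfl, hX.zero,
    sub_self]

lemma coeff_two_centered_pair (hX : IsDeformed X) (i j : Fin N) :
    PowerSeries.coeff 2 (centered X [i, j])
      = op (hash (ys X 1 j) (ys X 1 i) + pderiv i (ys X 2 j)) := by
  rw [centered, map_sub, PowerSeries.coeff_mul, PowerSeries.coeff_C_mul,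
    coeff_centered_singleton hX two_ne_zero,
    Finset.Nat.sum_antidiagonal_eq_sum_range_succ
      (fun a b => PowerSeries.coeff a (centered X [j]) * PowerSeries.coeff b (X i)),
    Finset.sum_range_succ, Finset.sum_range_succ, Finset.sum_range_one,
    coeff_zero_centered_singleton hX, zero_mul, zero_add, coeff_centered_singleton hX one_ne_zero,
    coeff_centered_singleton hX two_ne_zero, Nat.sub_self, hX.zero, op_mul_mulOp_coord,
    map_add, op_hash, op_ys hX one_ne_zero i]
  exact (add_sub_assoc _ _ _).trans (congrArg _ (add_sub_cancel_left _ _))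

lemma coeff_weyl_eq_zero_of_cs (hX : IsDeformed X) {k m : ℕ} (h : ∀ c, cs X c m k = 0)
    (f : Smooth N) : (1 / (m.factorial : ℝ)) • ∑ I : Fin m → Fin N,
      mulOp (D (List.ofFn I) f) * PowerSeries.coeff k (centered X (List.ofFn I)) = 0 := by
  rw [sum_D_centered_eq_zero (fun c => by rw [← op_cs hX, h, map_zero]), smul_zero]

lemma sum_fin_one {M : Type*} [AddCommMonoid M] (F : (Fin 1 → Fin N) → M) :
    ∑ I, F I = ∑ i, F ![i] := by
  rw [sum_cons]
  refine Finset.sum_congr rfl fun i _ => (Fintype.sum_unique _).trans ?_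
  exact congrArg (fun J : Fin 0 → Fin N => F (Fin.cons i J)) (Subsingleton.elim _ _)

lemma sum_fin_two {M : Type*} [AddCommMonoid M] (F : (Fin 2 → Fin N) → M) :
    ∑ I, F I = ∑ i, ∑ j, F ![i, j] := by
  rw [sum_cons]; exact Finset.sum_congr rfl fun i _ => sum_fin_one _

lemma ofFn_one (i : Fin N) : List.ofFn ![i] = [i] := by simp
lemma ofFn_two (i j : Fin N) : List.ofFn ![i, j] = [i, j] := by simp [List.ofFn_succ]

lemma D_one (i : Fin N) (f : Smooth N) : D [i] f = pd i f := by
  rw [D_cons, D_nil, mul_one, pd_apply]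

lemma D_two (i j : Fin N) (f : Smooth N) : D [i, j] f = pd i (pd j f) := by
  rw [D_cons, Module.End.mul_apply, D_one, pd_apply i]

lemma coeff_one_weyl (hX : IsDeformed X) (f : Smooth N) :
    PowerSeries.coeff 1 (weyl X f) = op (∑ l, C (pd l f) * ys X 1 l) := by
  rw [weyl, PowerSeries.coeff_mk, show 2 * 1 + 1 = 3 from rfl, Finset.sum_range_succ,
    coeff_weyl_eq_zero_of_cs hX (cs_two_one hX), add_zero, Finset.sum_range_succ,
    Finset.sum_range_one,
    coeff_weyl_eq_zero_of_cs hX (fun c => by rw [cs, if_neg one_ne_zero]), zero_add, sum_fin_one]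
  simp only [ofFn_one, D_one, coeff_centered_singleton hX one_ne_zero, map_sum, op_C_mul]
  simp

lemma coeff_two_weyl (hX : IsDeformed X) (f : Smooth N) :
    PowerSeries.coeff 2 (weyl X f) = op (∑ l, C (pd l f) * ys X 2 l + (1 / 2 : ℝ) •
      ∑ i, ∑ j, C (pd i (pd j f)) * (hash (ys X 1 j) (ys X 1 i) + pderiv i (ys X 2 j))) := by
  rw [weyl, PowerSeries.coeff_mk, show 2 * 2 + 1 = 5 from rfl, Finset.sum_range_succ,
    coeff_weyl_eq_zero_of_cs hX (cs_four_two hX), add_zero, Finset.sum_range_succ,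
    coeff_weyl_eq_zero_of_cs hX (cs_three_two hX), add_zero, Finset.sum_range_succ,
    Finset.sum_range_succ, Finset.sum_range_one,
    coeff_weyl_eq_zero_of_cs hX (fun c => by rw [cs, if_neg two_ne_zero]), zero_add, sum_fin_one,
    sum_fin_two]
  simp only [ofFn_one, ofFn_two, D_one, D_two, coeff_centered_singleton hX two_ne_zero,
    coeff_two_centered_pair hX, map_sum, op_C_mul, map_add, map_smul]
  simp

end LowOrder

/-! ### The deformed coordinates in low orders -/

/-- The components of `∑ p_j g^{ij}` determine `gam g n i`. -/
lemma gam_eq {g : Fin N → Fin N → Sym N} {n : ℕ} {i : Fin N} {r : ℕ → Sym N}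
    (hr : ∀ m < n, (r m).IsHomogeneous (m + 1))
    (h : ∑ j, X j * g i j = ∑ m ∈ range n, r m) :
    gam g n i = ∑ m ∈ range n, (1 / ((m : ℝ) + 2)) • r m := by
  refine Finset.sum_congr rfl fun m hm => ?_
  rw [Finset.mem_range] at hm
  congr 1
  simp only [← homogeneousComponent_X_mul]
  rw [← map_sum, h, map_sum, Finset.sum_eq_single_of_mem m (by simpa using hm)]
  · rw [homogeneousComponent_of_mem (hr m hm), if_pos rfl]
  · intro k hk hkm
    rw [homogeneousComponent_of_mem (hr k (by simpa using hk)), if_neg (by omega)]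

lemma ys_xhat_eq_gam {ω : Fin N → Fin N → FormalFn N} {n m : ℕ} (hm : n + 1 ≤ m)
    {g : Fin N → Fin N → Sym N} (hg : ∀ i j, defect ω n (xhat ω n) i j = op (g i j)) (i : Fin N) :
    ys (xhat ω m) (n + 1) i = gam g (n + 1) i := by
  rw [ys, if_neg (Nat.succ_ne_zero n), eqMod_xhat ω hm i (n + 1) (by omega), coeff_xhat_self,
    sum_gammaOf_D hg, symb_op]

/-- The symbol `∑ ω^{ij} p_j`. -/
def hamSym (ω₀ : Fin N → Fin N → Smooth N) (i : Fin N) : Sym N := ∑ j, C (ω₀ i j) * X j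

section ham

variable {ω₀ : Fin N → Fin N → Smooth N}

lemma hamSym_isHomogeneous (i : Fin N) : (hamSym ω₀ i).IsHomogeneous 1 :=
  IsHomogeneous.sum _ _ _ fun _ _ => by
    simpa only [zero_add] using (isHomogeneous_C (Fin N) (ω₀ i _)).mul (isHomogeneous_X _ _)

lemma hamSym_mem_degLT (i : Fin N) : hamSym ω₀ i ∈ degLT N 2 :=
  isHomogeneous_mem_degLT (hamSym_isHomogeneous i)

lemma pderiv_hamSym (l i : Fin N) : pderiv l (hamSym ω₀ i) = C (ω₀ i l) := by
  simp [hamSym, pderiv_X, Pi.single_apply]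

lemma cpd_C_mul (l : Fin N) (a : Smooth N) (q : Sym N) :
    cpd l (C a * q) = C a * cpd l q + C (pd l a) * q := by
  rw [cpd_mul, cpd_C, mul_comm q]

lemma cpd_hamSym (l i : Fin N) :
    cpd l (hamSym ω₀ i) = hamSym (fun a b => pd l (ω₀ a b)) i := by
  simp only [hamSym, map_sum, cpd_C_mul, cpd_X, mul_zero, zero_add]

lemma sum_X_mul_C (i : Fin N) : ∑ j, X j * C (ω₀ i j) = hamSym ω₀ i :=
  Finset.sum_congr rfl fun j _ => mul_comm _ _

lemma sum_X_mul_C_left (h₀ : ∀ i j, ω₀ i j = -ω₀ j i) (l : Fin N) :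
    ∑ j, X j * C (ω₀ j l) = -hamSym ω₀ l := by
  rw [hamSym, ← Finset.sum_neg_distrib]
  refine Finset.sum_congr rfl fun j _ => ?_
  rw [h₀ j l, map_neg, mul_neg, mul_comm]

lemma cpd_isHomogeneous {q : Sym N} {d : ℕ} (hq : q.IsHomogeneous d) (l : Fin N) :
    (cpd l q).IsHomogeneous d := by
  intro m hm
  refine hq fun h0 => hm ?_
  rw [coeff_cpd, h0, map_zero]

lemma smul_isHomogeneous {q : Sym N} {d : ℕ} (hq : q.IsHomogeneous d) (t : ℝ) :
    (t • q).IsHomogeneous d := by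
  intro m hm
  refine hq fun h0 => hm ?_
  rw [coeff_smul, h0, smul_zero]

end ham

section correction

variable {ω₀ ω₂ : Fin N → Fin N → Smooth N} (h₀ : ∀ i j, ω₀ i j = -ω₀ j i)
  (h₂ : ∀ i j, ω₂ i j = -ω₂ j i)

lemma coeff_weylSeries_zero (X : Fin N → FormalOp N) (i j : Fin N) :
    PowerSeries.coeff 0 (weylSeries X (correctedOmega ω₀ ω₂ i j)) = mulOp (ω₀ i j) := by
  rw [weylSeries, PowerSeries.coeff_mk]
  simp [coeff_zero_weyl, coeff_correctedOmega]

lemma coeff_weylSeries_one (X : Fin N → FormalOp N) (i j : Fin N) :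
    PowerSeries.coeff 1 (weylSeries X (correctedOmega ω₀ ω₂ i j))
      = PowerSeries.coeff 1 (weyl X (ω₀ i j)) := by
  rw [weylSeries, PowerSeries.coeff_mk]
  simp [Finset.Nat.antidiagonal_succ, coeff_correctedOmega, coeff_zero_weyl, mulOp_zero]

lemma coeff_weylSeries_two (X : Fin N → FormalOp N) (i j : Fin N) :
    PowerSeries.coeff 2 (weylSeries X (correctedOmega ω₀ ω₂ i j))
      = PowerSeries.coeff 2 (weyl X (ω₀ i j)) + mulOp (ω₂ i j) := by
  have h : weyl X 0 = 0 := by simpa using weyl_smul X 0 0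
  rw [weylSeries, PowerSeries.coeff_mk]
  simp [Finset.Nat.antidiagonal_succ, coeff_correctedOmega, coeff_zero_weyl, h]

lemma defect_zero (i j : Fin N) : defect (correctedOmega ω₀ ω₂) 0 (xhat (correctedOmega ω₀ ω₂) 0) i j
    = op ((2 : ℝ) • C (ω₀ i j)) := by
  rw [defect, map_sub, coeff_two_X_mul, if_neg (by omega), Nat.add_sub_cancel,
    coeff_weylSeries_zero, map_smul, op_C]
  simp [xhat, ← map_mul, mulOp_comm (coord i)]

lemma coeff_succ_mul_xhat {ω : Fin N → Fin N → FormalFn N} (hω : ∀ i j, ω i j = -ω j i) (n : ℕ)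
    (i j : Fin N) : PowerSeries.coeff (n + 1) (xhat ω n i * xhat ω n j)
      = op (∑ a ∈ range n, hash (ys (xhat ω n) (a + 1) i) (ys (xhat ω n) (n - a) j)) := by
  have hX := isDeformed_xhat hω n
  rw [PowerSeries.coeff_mul, Finset.Nat.sum_antidiagonal_eq_sum_range_succ
      (fun a b => PowerSeries.coeff a (xhat ω n i) * PowerSeries.coeff b (xhat ω n j)),
    Finset.sum_range_succ, Finset.sum_range_succ', Nat.sub_zero,
    coeff_xhat_of_lt ω (Nat.lt_succ_self n), coeff_xhat_of_lt ω (Nat.lt_succ_self n), mul_zero,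
    zero_mul, add_zero, add_zero, map_sum]
  refine Finset.sum_congr rfl fun a ha => ?_
  rw [Finset.mem_range] at ha
  rw [op_hash, op_ys hX (by omega), op_ys hX (by omega), Nat.add_sub_add_right]

lemma hash_hamSym_left (i : Fin N) (q : Sym N) :
    hash (hamSym ω₀ i) q = hamSym ω₀ i * q + ∑ l, C (ω₀ i l) * cpd l q := by
  rw [hash_eq (hamSym_mem_degLT i), Finset.sum_range_succ, Finset.sum_range_one, bid_zero, bid_succ]
  simp only [pderiv_hamSym, bid_zero]
  simp

include h₀ h₂

/-- The symbol of first order is `∑ ω₀^{ij} p_j`. -/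
lemma ys_one {n : ℕ} (hn : 1 ≤ n) (i : Fin N) :
    ys (xhat (correctedOmega ω₀ ω₂) n) 1 i = hamSym ω₀ i := by
  rw [ys_xhat_eq_gam hn defect_zero, gam_eq (r := fun _ => (2 : ℝ) • hamSym ω₀ i)]
  · simp
  · intro m hm
    obtain rfl : m = 0 := by omega
    exact smul_isHomogeneous (hamSym_isHomogeneous i) _
  · simp only [mul_smul_comm, ← Finset.smul_sum, sum_X_mul_C, zero_add, Finset.sum_range_one]

lemma defect_one (i j : Fin N) : defect (correctedOmega ω₀ ω₂) 1 (xhat (correctedOmega ω₀ ω₂) 1) i j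
    = op ((2 : ℝ) • ∑ l, C (pd l (ω₀ i j)) * hamSym ω₀ l
      - (hash (hamSym ω₀ i) (hamSym ω₀ j) - hash (hamSym ω₀ j) (hamSym ω₀ i))) := by
  have hω := correctedOmega_skew h₀ h₂
  rw [defect, map_sub, coeff_two_X_mul, if_neg (by omega), Nat.add_sub_cancel,
    coeff_weylSeries_one, coeff_one_weyl (isDeformed_xhat hω 1), map_sub, coeff_succ_mul_xhat hω,
    coeff_succ_mul_xhat hω, map_sub, map_sub, map_smul]
  simp only [Finset.sum_range_one, zero_add, Nat.sub_zero, ys_one h₀ h₂ le_rfl]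

/-- The symbol of second order is `1/3 ∑ v^l ∂_l v^i`, with the symbols `v` of first order. -/
lemma ys_two {n : ℕ} (hn : 2 ≤ n) (i : Fin N) :
    ys (xhat (correctedOmega ω₀ ω₂) n) 2 i
      = (1 / 3 : ℝ) • ∑ l, hamSym ω₀ l * cpd l (hamSym ω₀ i) := by
  have hX := isDeformed_xhat (correctedOmega_skew h₀ h₂) 1
  have hz : ∑ j, X j * hamSym ω₀ j = 0 := by
    simpa only [ys_one h₀ h₂ le_rfl] using sum_X_mul_ys hX 1
  rw [ys_xhat_eq_gam hn (defect_one h₀ h₂), gam_eq (r := fun m => if m = 1 then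
    ∑ l, hamSym ω₀ l * cpd l (hamSym ω₀ i) else 0)]
  · rw [Finset.sum_range_succ, Finset.sum_range_one, if_neg zero_ne_one, if_pos rfl, smul_zero,
      zero_add]
    norm_num
  · intro m hm
    split_ifs with h
    · subst h
      exact IsHomogeneous.sum _ _ _ fun l _ =>
        (hamSym_isHomogeneous l).mul (cpd_isHomogeneous (hamSym_isHomogeneous i) l)
    · exact isHomogeneous_zero _ _ _
  · -- of the contraction of the defect with `p_j`, the derivative of `ω₀` along `v` and one of the two
    -- terms of the commutator contribute
    simp only [hash_hamSym_left]
    have h1 : ∑ j, X j * ((2 : ℝ) • ∑ l, C (pd l (ω₀ i j)) * hamSym ω₀ l)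
        = (2 : ℝ) • ∑ l, hamSym ω₀ l * cpd l (hamSym ω₀ i) := by
      simp only [mul_smul_comm, ← Finset.smul_sum, Finset.mul_sum]
      rw [Finset.sum_comm]
      congr 1
      refine Finset.sum_congr rfl fun l _ => ?_
      rw [cpd_hamSym, ← sum_X_mul_C (ω₀ := fun a b => pd l (ω₀ a b)), Finset.mul_sum]
      exact Finset.sum_congr rfl fun j _ => by
        rw [mul_comm (hamSym ω₀ l), mul_assoc]
    have h2 : ∑ j, X j * ∑ l, C (ω₀ i l) * cpd l (hamSym ω₀ j) = 0 := by
      simp only [Finset.mul_sum]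
      rw [Finset.sum_comm]
      refine Finset.sum_eq_zero fun l _ => ?_
      have := congrArg (cpd l) hz
      simp only [map_sum, cpd_X_mul, map_zero] at this
      simp only [mul_left_comm (X _) (C (ω₀ i l)), ← Finset.mul_sum, this, mul_zero]
    have h3 : ∑ j, X j * ∑ l, C (ω₀ j l) * cpd l (hamSym ω₀ i)
        = -∑ l, hamSym ω₀ l * cpd l (hamSym ω₀ i) := by
      simp only [Finset.mul_sum]
      rw [Finset.sum_comm, ← Finset.sum_neg_distrib]
      refine Finset.sum_congr rfl fun l _ => ?_
      simp only [← mul_assoc, ← Finset.sum_mul, sum_X_mul_C_left h₀, neg_mul]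
    have h4 : ∀ a b c d e : Sym N, a * (b - ((c + d) - (c + e))) = a * b - (a * d - a * e) :=
      fun a b c d e => by rw [add_sub_add_left_eq_sub, mul_sub, mul_sub]
    simp only [mul_comm (hamSym ω₀ _) (hamSym ω₀ i), h4, Finset.sum_sub_distrib, h1, h2, h3]
    rw [Finset.sum_range_succ, Finset.sum_range_one, if_neg zero_ne_one, if_pos rfl, two_smul]
    abel

end correction

section correction

variable {ω₀ ω₂ : Fin N → Fin N → Smooth N} (h₀ : ∀ i j, ω₀ i j = -ω₀ j i)
  (h₂ : ∀ i j, ω₂ i j = -ω₂ j i)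

lemma sum_X_mul_sum_C_mul {ι : Type*} [Fintype ι] (A : ι → Fin N → Smooth N) (q : ι → Sym N) :
    ∑ b, X b * ∑ l, C (A l b) * q l = ∑ l, (∑ b, C (A l b) * X b) * q l := by
  simp only [Finset.mul_sum, Finset.sum_mul]
  rw [Finset.sum_comm]
  refine Finset.sum_congr rfl fun l _ => Finset.sum_congr rfl fun b _ => ?_
  rw [← mul_assoc, mul_comm (X b)]

lemma hash_hamSym_right {q : Sym N} (hq : q ∈ degLT N 3) (i : Fin N) :
    hash q (hamSym ω₀ i) = q * hamSym ω₀ i + ∑ l, pderiv l q * cpd l (hamSym ω₀ i)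
      + (1 / 2 : ℝ) • ∑ l, ∑ m, pderiv m (pderiv l q) * cpd m (cpd l (hamSym ω₀ i)) := by
  rw [hash_eq hq, Finset.sum_range_succ, Finset.sum_range_succ, Finset.sum_range_one, bid_zero,
    bid_succ, bid_succ]
  simp only [bid_succ, bid_zero]
  norm_num

/-- Derivatives of the relation `∑ p_b s^b = 0`. -/
lemma sum_X_mul_pderiv {s : Fin N → Sym N} (hs : ∑ b, X b * s b = 0) (l : Fin N) :
    ∑ b, X b * pderiv l (s b) = -s l := by
  have := congrArg (pderiv l) hs
  simp only [map_sum, pderiv_X_mul, Finset.sum_add_distrib, Finset.sum_ite_eq, Finset.mem_univ,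
    if_true, map_zero] at this
  exact eq_neg_of_add_eq_zero_left this

lemma sum_X_mul_pderiv_pderiv {s : Fin N → Sym N} (hs : ∑ b, X b * s b = 0) (l m : Fin N) :
    ∑ b, X b * pderiv m (pderiv l (s b)) = -(pderiv m (s l) + pderiv l (s m)) := by
  have := congrArg (pderiv m) (sum_X_mul_pderiv hs l)
  simp only [map_sum, pderiv_X_mul, Finset.sum_add_distrib, Finset.sum_ite_eq, Finset.mem_univ,
    if_true, map_neg] at this
  rw [eq_sub_of_add_eq this, neg_add, sub_eq_add_neg]

lemma sum_X_mul_cpd {s : Fin N → Sym N} (hs : ∑ b, X b * s b = 0) (l : Fin N) :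
    ∑ b, X b * cpd l (s b) = 0 := by
  have := congrArg (cpd l) hs
  simpa only [map_sum, cpd_X_mul, map_zero] using this

lemma sum_X_mul_hamSym (h₀ : ∀ i j, ω₀ i j = -ω₀ j i) : ∑ j, X j * hamSym ω₀ j = 0 := by
  simpa only [ys_one h₀ h₀ le_rfl] using
    sum_X_mul_ys (isDeformed_xhat (correctedOmega_skew h₀ h₀) 1) 1

lemma hash_hamSym_hamSym (i j : Fin N) : hash (hamSym ω₀ i) (hamSym ω₀ j)
    = hamSym ω₀ i * hamSym ω₀ j + ∑ l, C (ω₀ i l) * cpd l (hamSym ω₀ j) :=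
  hash_hamSym_left i _

/-- The contraction of the commutators `[Y_1^a, Y_2^b] + [Y_2^a, Y_1^b]` with `p_b`. -/
lemma sum_X_mul_commutator {s : Fin N → Sym N} (h₀ : ∀ i j, ω₀ i j = -ω₀ j i)
    (hs3 : ∀ b, s b ∈ degLT N 3) (hs : ∑ b, X b * s b = 0) (a : Fin N) :
    ∑ b, X b * ((hash (hamSym ω₀ a) (s b) + hash (s a) (hamSym ω₀ b))
      - (hash (hamSym ω₀ b) (s a) + hash (s b) (hamSym ω₀ a)))
    = ∑ l, s l * cpd l (hamSym ω₀ a)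
      + ∑ l, ∑ m, pderiv l (s m) * cpd m (cpd l (hamSym ω₀ a))
      + ∑ l, hamSym ω₀ l * cpd l (s a) := by
  have hz := sum_X_mul_hamSym h₀
  have h1 : ∑ b, X b * ∑ l, C (ω₀ a l) * cpd l (s b) = 0 := by
    simp only [Finset.mul_sum, mul_left_comm (X _) (C _)]
    rw [Finset.sum_comm]
    simp only [← Finset.mul_sum, sum_X_mul_cpd hs, mul_zero, Finset.sum_const_zero]
  have h2 : ∑ b, X b * ∑ l, C (ω₀ b l) * cpd l (s a) = -∑ l, hamSym ω₀ l * cpd l (s a) := by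
    simp only [Finset.mul_sum]
    rw [Finset.sum_comm, ← Finset.sum_neg_distrib]
    refine Finset.sum_congr rfl fun l _ => ?_
    simp only [← mul_assoc, ← Finset.sum_mul, sum_X_mul_C_left h₀, neg_mul]
  have h3 : ∑ b, X b * ∑ l, pderiv l (s a) * cpd l (hamSym ω₀ b) = 0 := by
    simp only [Finset.mul_sum, mul_left_comm (X _) (pderiv _ _)]
    rw [Finset.sum_comm]
    simp only [← Finset.mul_sum, sum_X_mul_cpd hz, mul_zero, Finset.sum_const_zero]
  have h4 : ∑ b, X b * ∑ l, ∑ m, pderiv m (pderiv l (s a)) * cpd m (cpd l (hamSym ω₀ b)) = 0 := by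
    simp only [Finset.mul_sum, mul_left_comm (X _) (pderiv _ _)]
    rw [Finset.sum_comm]
    refine Finset.sum_eq_zero fun l _ => ?_
    rw [Finset.sum_comm]
    simp only [← Finset.mul_sum, sum_X_mul_cpd (sum_X_mul_cpd hz l), mul_zero,
      Finset.sum_const_zero]
  have h5 : ∑ b, X b * ∑ l, pderiv l (s b) * cpd l (hamSym ω₀ a)
      = -∑ l, s l * cpd l (hamSym ω₀ a) := by
    simp only [Finset.mul_sum, ← mul_assoc]
    rw [Finset.sum_comm]
    simp only [← Finset.sum_mul, sum_X_mul_pderiv hs, neg_mul, Finset.sum_neg_distrib]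
  have h6 : ∑ b, X b * ∑ l, ∑ m, pderiv m (pderiv l (s b)) * cpd m (cpd l (hamSym ω₀ a))
      = -((2 : ℝ) • ∑ l, ∑ m, pderiv l (s m) * cpd m (cpd l (hamSym ω₀ a))) := by
    simp only [Finset.mul_sum, ← mul_assoc]
    rw [Finset.sum_comm, two_smul]
    nth_rewrite 2 [Finset.sum_comm]
    rw [← Finset.sum_add_distrib, ← Finset.sum_neg_distrib]
    refine Finset.sum_congr rfl fun l _ => ?_
    rw [Finset.sum_comm, ← Finset.sum_add_distrib, ← Finset.sum_neg_distrib]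
    refine Finset.sum_congr rfl fun m _ => ?_
    rw [← Finset.sum_mul, sum_X_mul_pderiv_pderiv hs, cpd_comm l m, ← add_mul, neg_mul, add_comm]
  have h7 : ∀ b, (hash (hamSym ω₀ a) (s b) + hash (s a) (hamSym ω₀ b))
      - (hash (hamSym ω₀ b) (s a) + hash (s b) (hamSym ω₀ a))
      = (∑ l, C (ω₀ a l) * cpd l (s b) + ∑ l, pderiv l (s a) * cpd l (hamSym ω₀ b)
      + (1 / 2 : ℝ) • ∑ l, ∑ m, pderiv m (pderiv l (s a)) * cpd m (cpd l (hamSym ω₀ b)))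
      - (∑ l, C (ω₀ b l) * cpd l (s a) + ∑ l, pderiv l (s b) * cpd l (hamSym ω₀ a)
      + (1 / 2 : ℝ) • ∑ l, ∑ m, pderiv m (pderiv l (s b)) * cpd m (cpd l (hamSym ω₀ a))) := by
    intro b
    rw [hash_hamSym_left, hash_hamSym_left, hash_hamSym_right (hs3 a), hash_hamSym_right (hs3 b),
      mul_comm (s b), mul_comm (s a)]
    abel
  simp only [h7, mul_sub, mul_add, mul_smul_comm, Finset.sum_sub_distrib, Finset.sum_add_distrib,
    ← Finset.smul_sum, h1, h2, h3, h4, h5, h6]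
  rw [smul_neg, smul_smul, one_div_mul_cancel two_ne_zero, one_smul, smul_zero]
  abel

/-- The term `∑ v^l ∂_l s^a` with `s^a = 1/3 ∑ v^m ∂_m v^a`, in which the second derivatives of `v` are
separated. -/
lemma sum_mul_cpd_sum (v : Fin N → Sym N) {s : Fin N → Sym N}
    (hs : ∀ l, s l = (1 / 3 : ℝ) • ∑ m, v m * cpd m (v l)) (a : Fin N) :
    ∑ l, v l * cpd l (s a) = ∑ l, s l * cpd l (v a)
      + (1 / 3 : ℝ) • ∑ l, ∑ m, v m * v l * cpd l (cpd m (v a)) := by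
  have h2 : ∀ l m, v l * cpd l (v m * cpd m (v a))
      = v l * cpd l (v m) * cpd m (v a) + v m * v l * cpd l (cpd m (v a)) := by
    intro l m
    rw [cpd_mul, mul_add, add_comm, mul_comm (v m) (v l), mul_assoc, mul_assoc]
    rw [mul_comm (cpd m (v a))]
  have h1 : ∀ l, v l * cpd l (s a) = (1 / 3 : ℝ) • ∑ m, (v l * cpd l (v m) * cpd m (v a)
        + v m * v l * cpd l (cpd m (v a))) := by
    intro l
    rw [hs, map_smul, map_sum, mul_smul_comm, Finset.mul_sum]
    simp only [h2]
  simp only [h1]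
  simp only [hs, Finset.sum_add_distrib, smul_add, ← Finset.smul_sum, smul_mul_assoc,
    Finset.sum_mul]
  rw [Finset.sum_comm]

include h₀ h₂

lemma defect_two (i j : Fin N) : defect (correctedOmega ω₀ ω₂) 2 (xhat (correctedOmega ω₀ ω₂) 2) i j
    = op ((2 : ℝ) • (∑ l, C (pd l (ω₀ i j)) * ys (xhat (correctedOmega ω₀ ω₂) 2) 2 l
      + (1 / 2 : ℝ) • ∑ l, ∑ m, C (pd l (pd m (ω₀ i j))) * (hash (hamSym ω₀ m) (hamSym ω₀ l)
        + pderiv l (ys (xhat (correctedOmega ω₀ ω₂) 2) 2 m)) + C (ω₂ i j))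
      - ((hash (hamSym ω₀ i) (ys (xhat (correctedOmega ω₀ ω₂) 2) 2 j)
          + hash (ys (xhat (correctedOmega ω₀ ω₂) 2) 2 i) (hamSym ω₀ j))
        - (hash (hamSym ω₀ j) (ys (xhat (correctedOmega ω₀ ω₂) 2) 2 i)
          + hash (ys (xhat (correctedOmega ω₀ ω₂) 2) 2 j) (hamSym ω₀ i)))) := by
  have hω := correctedOmega_skew h₀ h₂
  rw [defect, map_sub, coeff_two_X_mul, if_neg (by omega), Nat.add_sub_cancel,
    coeff_weylSeries_two, coeff_two_weyl (isDeformed_xhat hω 2), map_sub, coeff_succ_mul_xhat hω,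
    coeff_succ_mul_xhat hω, map_sub, map_sub, map_smul, map_add, ← op_C (ω₂ i j), map_add op _ (C _)]
  simp only [Finset.sum_range_succ, Finset.sum_range_zero, zero_add, Nat.sub_zero,
    ys_one h₀ h₂ one_le_two, Nat.reduceAdd, Nat.reduceSub]
  rw [map_add op (∑ l, _)]

/-- The symbol of third order. In the contraction of the defect with `p_b` the terms that contain the
symbols of second order drop out, except for second derivatives of the symbols `v` of first order. -/
lemma ys_three {n : ℕ} (hn : 3 ≤ n) (a : Fin N) :
    ys (xhat (correctedOmega ω₀ ω₂) n) 3 a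
      = (1 / 6 : ℝ) • (∑ l, ∑ m, hamSym ω₀ m * hamSym ω₀ l * cpd l (cpd m (hamSym ω₀ a)))
        + (1 / 3 : ℝ) • (∑ l, ∑ m, cpd l (cpd m (hamSym ω₀ a)) *
          ∑ r, C (ω₀ m r) * cpd r (hamSym ω₀ l)) + hamSym ω₂ a := by
  have hX := isDeformed_xhat (correctedOmega_skew h₀ h₂) 2
  set s := ys (xhat (correctedOmega ω₀ ω₂) 2) 2 with hs_def
  have hs : ∀ l, s l = (1 / 3 : ℝ) • ∑ m, hamSym ω₀ m * cpd m (hamSym ω₀ l) := ys_two h₀ h₂ le_rfl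
  set W := hamSym ω₂ a with hW
  set R := ∑ l, ∑ m, hamSym ω₀ m * hamSym ω₀ l * cpd l (cpd m (hamSym ω₀ a)) with hR
  set T := ∑ l, ∑ m, cpd l (cpd m (hamSym ω₀ a)) * ∑ r, C (ω₀ m r) * cpd r (hamSym ω₀ l) with hT
  -- the contractions with `p_b` of the Weyl ordered first and second derivatives of `ω₀`, and of `ω₂`
  have hA : ∑ b, X b * ∑ l, C (pd l (ω₀ a b)) * s l = ∑ l, s l * cpd l (hamSym ω₀ a) := by
    rw [sum_X_mul_sum_C_mul fun l b => pd l (ω₀ a b)]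
    refine Finset.sum_congr rfl fun l _ => ?_
    rw [mul_comm, cpd_hamSym, hamSym]
  have hB : ∑ b, X b * ∑ l, ∑ m, C (pd l (pd m (ω₀ a b))) * (hash (hamSym ω₀ m) (hamSym ω₀ l)
        + pderiv l (s m))
      = R + T + ∑ l, ∑ m, pderiv l (s m) * cpd m (cpd l (hamSym ω₀ a)) := by
    have h := sum_X_mul_sum_C_mul (ι := Fin N × Fin N) (fun l b => pd l.1 (pd l.2 (ω₀ a b)))
      fun l => hash (hamSym ω₀ l.2) (hamSym ω₀ l.1) + pderiv l.1 (s l.2)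
    simp only [Fintype.sum_prod_type] at h
    rw [h, hR, hT, ← Finset.sum_add_distrib, ← Finset.sum_add_distrib]
    refine Finset.sum_congr rfl fun l _ => ?_
    rw [← Finset.sum_add_distrib, ← Finset.sum_add_distrib]
    refine Finset.sum_congr rfl fun m _ => ?_
    have h1 : ∑ b, C (pd l (pd m (ω₀ a b))) * X b = cpd l (cpd m (hamSym ω₀ a)) := by
      rw [cpd_hamSym, cpd_hamSym, hamSym]
    rw [h1, hash_hamSym_hamSym, mul_add, mul_add, cpd_comm m l,
      mul_comm _ (hamSym ω₀ m * hamSym ω₀ l), mul_comm _ (pderiv l (s m))]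
  have hC : ∑ b, X b * C (ω₂ a b) = W := sum_X_mul_C a
  have hK := sum_X_mul_commutator h₀ (fun b => ys_mem_degLT hX 2 b) (sum_X_mul_ys hX 2) a
  have hU := sum_mul_cpd_sum (hamSym ω₀) hs a
  -- the weights `1 / (m + 2)` of the homotopy turn `2`, `1` and `2 / 3` into `1`, `1 / 3` and `1 / 6`
  rw [ys_xhat_eq_gam hn (defect_two h₀ h₂), gam_eq (r := fun m => if m = 0 then (2 : ℝ) • W
    else if m = 1 then T else (2 / 3 : ℝ) • R)]
  · rw [Finset.sum_range_succ, Finset.sum_range_succ, Finset.sum_range_one]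
    norm_num [smul_smul]
    abel
  · intro m hm
    have hv := fun i => hamSym_isHomogeneous (ω₀ := ω₀) i
    split_ifs with h h'
    · subst h
      exact smul_isHomogeneous (hamSym_isHomogeneous a) _
    · subst h'
      refine IsHomogeneous.sum _ _ _ fun l _ => IsHomogeneous.sum _ _ _ fun m _ =>
        (cpd_isHomogeneous (cpd_isHomogeneous (hv a) m) l).mul (IsHomogeneous.sum _ _ _ fun r _ => ?_)
      have := (isHomogeneous_C (Fin N) (ω₀ m r)).mul (cpd_isHomogeneous (hv l) r)
      rwa [zero_add] at this
    · obtain rfl : m = 2 := by omega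
      exact smul_isHomogeneous (IsHomogeneous.sum _ _ _ fun l _ => IsHomogeneous.sum _ _ _
        fun m _ => ((hv m).mul (hv l)).mul (cpd_isHomogeneous (cpd_isHomogeneous (hv a) m) l)) _
  · simp only [mul_sub _ ((2 : ℝ) • _), Finset.sum_sub_distrib]
    rw [hK, hU]
    simp only [mul_smul_comm, mul_add _ _ (C _), mul_add _ _ ((1 / 2 : ℝ) • _),
      Finset.sum_add_distrib, ← Finset.smul_sum]
    rw [hA, hB, hC, Finset.sum_range_succ, Finset.sum_range_succ, Finset.sum_range_one]
    norm_num
    module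

end correction

/-! ### A graphical identity for Poisson structures -/

/-- The sum over five indices. -/
def sum5 {R : Type*} [AddCommMonoid R] (F : Fin N → Fin N → Fin N → Fin N → Fin N → R) : R :=
  ∑ p, ∑ q, ∑ r, ∑ s, ∑ t, F p q r s t

section sum5

variable {R : Type*} [AddCommGroup R] (F G : Fin N → Fin N → Fin N → Fin N → Fin N → R)

lemma sum5_add : sum5 (fun p q r s t => F p q r s t + G p q r s t) = sum5 F + sum5 G := by
  simp only [sum5, Finset.sum_add_distrib]

lemma sum5_neg : sum5 (fun p q r s t => -F p q r s t) = -sum5 F := by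
  simp only [sum5, Finset.sum_neg_distrib]

lemma sum5_sub : sum5 (fun p q r s t => F p q r s t - G p q r s t) = sum5 F - sum5 G := by
  simp only [sum5, Finset.sum_sub_distrib]

lemma sum5_eq_sum : sum5 F = ∑ I : Fin 5 → Fin N, F (I 0) (I 1) (I 2) (I 3) (I 4) := by
  rw [sum_cons, sum5]
  refine Finset.sum_congr rfl fun p _ => ?_
  rw [sum_cons]
  refine Finset.sum_congr rfl fun q _ => ?_
  rw [sum_cons]
  refine Finset.sum_congr rfl fun r _ => ?_
  rw [sum_cons]
  refine Finset.sum_congr rfl fun s _ => ?_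
  rw [sum_fin_one]
  rfl

lemma sum5_reindex (f : Fin 5 → Fin 5) (hf : f.Injective) :
    sum5 (fun p q r s t => F (![p, q, r, s, t] (f 0)) (![p, q, r, s, t] (f 1))
      (![p, q, r, s, t] (f 2)) (![p, q, r, s, t] (f 3)) (![p, q, r, s, t] (f 4))) = sum5 F := by
  have h : ∀ I : Fin 5 → Fin N, ![I 0, I 1, I 2, I 3, I 4] = I := fun I => by
    funext i; fin_cases i <;> rfl
  rw [sum5_eq_sum, sum5_eq_sum]
  simp only [h]
  exact (Equiv.arrowCongr (Equiv.ofBijective f (Finite.injective_iff_bijective.mp hf)).symm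
    (Equiv.refl (Fin N))).sum_comp fun I => F (I 0) (I 1) (I 2) (I 3) (I 4)

end sum5

/-- The third jet at a point of a Poisson structure `w`, with values in a commutative ring: the
derivatives `∂_l w^{ab}`, `∂_l ∂_m w^{ab}` and `∂_l ∂_m ∂_n w^{ab}` are `w1 l a b`, `w2 l m a b` and
`w3 l m n a b`, and `J`, `J1`, `J2` are the Jacobi identity and its derivatives. -/
structure PoissonJet (N : ℕ) (R : Type*) [CommRing R] where
  w : Fin N → Fin N → R
  w1 : Fin N → Fin N → Fin N → R
  w2 : Fin N → Fin N → Fin N → Fin N → R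
  w3 : Fin N → Fin N → Fin N → Fin N → Fin N → R
  hw : ∀ a b, w a b = -w b a
  hw1 : ∀ l a b, w1 l a b = -w1 l b a
  hw2 : ∀ l m a b, w2 l m a b = -w2 l m b a
  hw3 : ∀ l m n a b, w3 l m n a b = -w3 l m n b a
  hs2 : ∀ l m a b, w2 l m a b = w2 m l a b
  hs3 : ∀ l m n a b, w3 l m n a b = w3 l n m a b
  J : ∀ x y z, ∑ l, (w x l * w1 l y z + w y l * w1 l z x + w z l * w1 l x y) = 0
  J1 : ∀ p x y z, ∑ l, (w1 p x l * w1 l y z + w x l * w2 p l y z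
    + w1 p y l * w1 l z x + w y l * w2 p l z x + w1 p z l * w1 l x y + w z l * w2 p l x y) = 0
  J2 : ∀ p q x y z, ∑ l, (w2 p q x l * w1 l y z + w1 p x l * w2 q l y z
    + w1 q x l * w2 p l y z + w x l * w3 p q l y z
    + w2 p q y l * w1 l z x + w1 p y l * w2 q l z x
    + w1 q y l * w2 p l z x + w y l * w3 p q l z x
    + w2 p q z l * w1 l x y + w1 p z l * w2 q l x y
    + w1 q z l * w2 p l x y + w z l * w3 p q l x y) = 0

namespace PoissonJet

variable {R : Type*} [CommRing R]

/-- The summands of the graphs with the legs `a`, `b`, `c` that occur in the consistency condition of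
third order for the universal correction (the graphs `0` to `7`) and in the derivatives of the Jacobi
identity that are used to prove it (the graphs `8` to `12` occur only there). Each factor is a vertex of
the graph, each internal index `p`, …, `t` an edge. -/
def graphTerm (P : PoissonJet N R) : Fin 13 → Fin N → Fin N → Fin N → Fin N → Fin N → Fin N →
    Fin N → Fin N → R
  | 0, a, b, c, p, q, r, s, t => P.w2 q s a p * P.w q r * P.w s t * P.w3 p r t b c
  | 1, a, b, c, p, q, r, s, t => P.w2 q s a p * P.w q r * P.w1 r s t * P.w2 p t b c
  | 2, a, b, c, p, q, r, s, t => P.w1 r p q * P.w1 p r s * P.w2 q s a t * P.w1 t b c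
  | 3, a, b, c, p, q, r, s, t => P.w2 r s a p * P.w2 p t q r * P.w s t * P.w1 q b c
  | 4, a, b, c, p, q, r, s, t => P.w2 r t p q * P.w1 p r s * P.w2 q s b c * P.w a t
  | 5, a, b, c, p, q, r, s, t => P.w3 q r t b p * P.w2 p s c q * P.w r s * P.w a t
  | 6, a, b, c, p, q, r, s, t => P.w1 r p q * P.w1 p r s * P.w3 q s t b c * P.w a t
  | 7, a, b, c, p, q, r, s, t => P.w2 q r b p * P.w2 p s c q * P.w1 t r s * P.w a t
  | 8, a, b, c, p, q, r, s, t => P.w1 q a p * P.w2 p s b c * P.w1 t q r * P.w1 r s t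
  | 9, a, b, c, p, q, r, s, t => P.w2 r s a p * P.w1 p b q * P.w2 q t c r * P.w s t
  | 10, a, b, c, p, q, r, s, t => P.w1 s a p * P.w2 p r b q * P.w2 q t c r * P.w s t
  | 11, a, b, c, p, q, r, s, t => P.w1 r p q * P.w2 q s a b * P.w2 p t c r * P.w s t
  | 12, a, b, c, p, q, r, s, t => P.w1 s a p * P.w1 p q r * P.w2 q t b c * P.w1 r s t

/-- The sum over the internal indices of a graph. -/
def graph (P : PoissonJet N R) (k : Fin 13) (a b c : Fin N) : R :=
  sum5 (P.graphTerm k a b c)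

variable (P : PoissonJet N R) (a b c : Fin N)

/-- Renaming the internal indices of a graph. -/
lemma sum5_graphTerm (k : Fin 13) (f : Fin 5 → Fin 5) (hf : f.Injective) :
    sum5 (fun p q r s t => P.graphTerm k a b c (![p, q, r, s, t] (f 0)) (![p, q, r, s, t] (f 1))
      (![p, q, r, s, t] (f 2)) (![p, q, r, s, t] (f 3)) (![p, q, r, s, t] (f 4)))
    = P.graph k a b c :=
  sum5_reindex (P.graphTerm k a b c) f hf

/-! Antisymmetry of graphs in the legs `b` and `c`. -/

lemma graph_0_swap : P.graph 0 a c b = -P.graph 0 a b c := by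
  have h : ∀ p q r s t, P.graphTerm 0 a c b p q r s t = -P.graphTerm 0 a b c p q r s t := by
    intro p q r s t
    simp only [graphTerm,
      P.hw3 p r t c b]
    ring
  rw [← P.sum5_graphTerm a b c 0 ![0, 1, 2, 3, 4] (by decide), ← sum5_neg]
  exact congrArg sum5 (by funext p q r s t; exact h p q r s t)

lemma graph_1_swap : P.graph 1 a c b = -P.graph 1 a b c := by
  have h : ∀ p q r s t, P.graphTerm 1 a c b p q r s t = -P.graphTerm 1 a b c p q r s t := by
    intro p q r s t
    simp only [graphTerm,
      P.hw2 p t c b]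
    ring
  rw [← P.sum5_graphTerm a b c 1 ![0, 1, 2, 3, 4] (by decide), ← sum5_neg]
  exact congrArg sum5 (by funext p q r s t; exact h p q r s t)

lemma graph_2_swap : P.graph 2 a c b = -P.graph 2 a b c := by
  have h : ∀ p q r s t, P.graphTerm 2 a c b p q r s t = -P.graphTerm 2 a b c p q r s t := by
    intro p q r s t
    simp only [graphTerm,
      P.hw1 t c b]
    ring
  rw [← P.sum5_graphTerm a b c 2 ![0, 1, 2, 3, 4] (by decide), ← sum5_neg]
  exact congrArg sum5 (by funext p q r s t; exact h p q r s t)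

lemma graph_3_swap : P.graph 3 a c b = -P.graph 3 a b c := by
  have h : ∀ p q r s t, P.graphTerm 3 a c b p q r s t = -P.graphTerm 3 a b c p q r s t := by
    intro p q r s t
    simp only [graphTerm,
      P.hw1 q c b]
    ring
  rw [← P.sum5_graphTerm a b c 3 ![0, 1, 2, 3, 4] (by decide), ← sum5_neg]
  exact congrArg sum5 (by funext p q r s t; exact h p q r s t)

lemma graph_4_swap : P.graph 4 a c b = -P.graph 4 a b c := by
  have h : ∀ p q r s t, P.graphTerm 4 a c b p q r s t = -P.graphTerm 4 a b c p q r s t := by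
    intro p q r s t
    simp only [graphTerm,
      P.hw2 q s c b]
    ring
  rw [← P.sum5_graphTerm a b c 4 ![0, 1, 2, 3, 4] (by decide), ← sum5_neg]
  exact congrArg sum5 (by funext p q r s t; exact h p q r s t)

lemma graph_6_swap : P.graph 6 a c b = -P.graph 6 a b c := by
  have h : ∀ p q r s t, P.graphTerm 6 a c b p q r s t = -P.graphTerm 6 a b c p q r s t := by
    intro p q r s t
    simp only [graphTerm,
      P.hw3 q s t c b]
    ring
  rw [← P.sum5_graphTerm a b c 6 ![0, 1, 2, 3, 4] (by decide), ← sum5_neg]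
  exact congrArg sum5 (by funext p q r s t; exact h p q r s t)

lemma graph_7_swap : P.graph 7 a c b = -P.graph 7 a b c := by
  have h : ∀ p q r s t, P.graphTerm 7 a c b p q r s t = -P.graphTerm 7 a b c q p s r t := by
    intro p q r s t
    simp only [graphTerm,
      P.hw1 t s r]
    ring
  rw [← P.sum5_graphTerm a b c 7 ![1, 0, 3, 2, 4] (by decide), ← sum5_neg]
  exact congrArg sum5 (by funext p q r s t; exact h p q r s t)

lemma graph_8_swap : P.graph 8 a c b = -P.graph 8 a b c := by
  have h : ∀ p q r s t, P.graphTerm 8 a c b p q r s t = -P.graphTerm 8 a b c p q r s t := by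
    intro p q r s t
    simp only [graphTerm,
      P.hw2 p s c b]
    ring
  rw [← P.sum5_graphTerm a b c 8 ![0, 1, 2, 3, 4] (by decide), ← sum5_neg]
  exact congrArg sum5 (by funext p q r s t; exact h p q r s t)

/-- The second derivative of the Jacobi identity for `a`, `b`, `c`, contracted with two first
derivatives of `w`. -/
lemma J2_contract_w1_w1 :
    P.graph 2 a b c + P.graph 8 a b c + P.graph 8 a b c + P.graph 6 a b c - P.graph 2 b a c
    - P.graph 8 b a c - P.graph 8 b a c - P.graph 6 b a c + P.graph 2 c a b + P.graph 8 c a b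
    + P.graph 8 c a b + P.graph 6 c a b = 0 := by
  have h : ∀ p q r s t, (P.w2 p r a t * P.w1 t b c + P.w1 p a t * P.w2 r t b c + P.w1 r a t * P.w2 p t b c +
      P.w a t * P.w3 p r t b c + P.w2 p r b t * P.w1 t c a + P.w1 p b t * P.w2 r t c a +
      P.w1 r b t * P.w2 p t c a + P.w b t * P.w3 p r t c a + P.w2 p r c t * P.w1 t a b +
      P.w1 p c t * P.w2 r t a b + P.w1 r c t * P.w2 p t a b + P.w c t * P.w3 p r t a b)
        * P.w1 s p q * P.w1 q r s
      = P.graphTerm 2 a b c q p s r t + P.graphTerm 8 a b c t p q r s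
        + P.graphTerm 8 a b c t r s p q + P.graphTerm 6 a b c q p s r t
        - P.graphTerm 2 b a c q p s r t - P.graphTerm 8 b a c t p q r s
        - P.graphTerm 8 b a c t r s p q - P.graphTerm 6 b a c q p s r t
        + P.graphTerm 2 c a b q p s r t + P.graphTerm 8 c a b t p q r s
        + P.graphTerm 8 c a b t r s p q + P.graphTerm 6 c a b q p s r t := by
    intro p q r s t
    simp only [graphTerm,
      P.hs2 t p a b, P.hs2 t p a c, P.hs2 t p b c, P.hs2 t r a b, P.hs2 t r a c, P.hs2 t r b c,
      P.hw1 q s r, P.hw1 s q p, P.hw1 t c a, P.hw2 p t c a, P.hw2 r t c a, P.hw3 p r t c a]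
    ring
  have h0 : sum5 (fun p q r s t => P.graphTerm 2 a b c q p s r t + P.graphTerm 8 a b c t p q r s
        + P.graphTerm 8 a b c t r s p q + P.graphTerm 6 a b c q p s r t
        - P.graphTerm 2 b a c q p s r t - P.graphTerm 8 b a c t p q r s
        - P.graphTerm 8 b a c t r s p q - P.graphTerm 6 b a c q p s r t
        + P.graphTerm 2 c a b q p s r t + P.graphTerm 8 c a b t p q r s
        + P.graphTerm 8 c a b t r s p q + P.graphTerm 6 c a b q p s r t) = 0 := by
    simp only [← h, sum5, ← Finset.sum_mul, P.J2, zero_mul, Finset.sum_const_zero]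
  simp only [sum5_add, sum5_sub] at h0
  have h1 : sum5 (fun p q r s t => P.graphTerm 2 a b c q p s r t) = P.graph 2 a b c :=
    P.sum5_graphTerm a b c 2 ![1, 0, 3, 2, 4] (by decide)
  have h2 : sum5 (fun p q r s t => P.graphTerm 8 a b c t p q r s) = P.graph 8 a b c :=
    P.sum5_graphTerm a b c 8 ![4, 0, 1, 2, 3] (by decide)
  have h3 : sum5 (fun p q r s t => P.graphTerm 8 a b c t r s p q) = P.graph 8 a b c :=
    P.sum5_graphTerm a b c 8 ![4, 2, 3, 0, 1] (by decide)
  have h4 : sum5 (fun p q r s t => P.graphTerm 6 a b c q p s r t) = P.graph 6 a b c :=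
    P.sum5_graphTerm a b c 6 ![1, 0, 3, 2, 4] (by decide)
  have h5 : sum5 (fun p q r s t => P.graphTerm 2 b a c q p s r t) = P.graph 2 b a c :=
    P.sum5_graphTerm b a c 2 ![1, 0, 3, 2, 4] (by decide)
  have h6 : sum5 (fun p q r s t => P.graphTerm 8 b a c t p q r s) = P.graph 8 b a c :=
    P.sum5_graphTerm b a c 8 ![4, 0, 1, 2, 3] (by decide)
  have h7 : sum5 (fun p q r s t => P.graphTerm 8 b a c t r s p q) = P.graph 8 b a c :=
    P.sum5_graphTerm b a c 8 ![4, 2, 3, 0, 1] (by decide)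
  have h8 : sum5 (fun p q r s t => P.graphTerm 6 b a c q p s r t) = P.graph 6 b a c :=
    P.sum5_graphTerm b a c 6 ![1, 0, 3, 2, 4] (by decide)
  have h9 : sum5 (fun p q r s t => P.graphTerm 2 c a b q p s r t) = P.graph 2 c a b :=
    P.sum5_graphTerm c a b 2 ![1, 0, 3, 2, 4] (by decide)
  have h10 : sum5 (fun p q r s t => P.graphTerm 8 c a b t p q r s) = P.graph 8 c a b :=
    P.sum5_graphTerm c a b 8 ![4, 0, 1, 2, 3] (by decide)
  have h11 : sum5 (fun p q r s t => P.graphTerm 8 c a b t r s p q) = P.graph 8 c a b :=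
    P.sum5_graphTerm c a b 8 ![4, 2, 3, 0, 1] (by decide)
  have h12 : sum5 (fun p q r s t => P.graphTerm 6 c a b q p s r t) = P.graph 6 c a b :=
    P.sum5_graphTerm c a b 6 ![1, 0, 3, 2, 4] (by decide)
  linear_combination h0 - (h1 + h2 + h3 + h4 + -h5 + -h6 + -h7 + -h8 + h9 + h10 + h11 + h12)

/-- The second derivative of the Jacobi identity for `a`, `b` and an internal index, contracted with
`∂ ∂ w^{c ·}` and `w`. -/
lemma J2_contract_w2_w :
    P.graph 9 a b c - P.graph 9 c a b + P.graph 10 a b c + P.graph 5 a b c - P.graph 9 b a c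
    + P.graph 9 c b a - P.graph 10 b a c - P.graph 5 b a c + P.graph 3 c a b + P.graph 11 a b c
    - P.graph 1 c a b - P.graph 0 c a b = 0 := by
  have h : ∀ p q r s t, (P.w2 q r a t * P.w1 t b p + P.w1 q a t * P.w2 r t b p + P.w1 r a t * P.w2 q t b p +
      P.w a t * P.w3 q r t b p + P.w2 q r b t * P.w1 t p a + P.w1 q b t * P.w2 r t p a +
      P.w1 r b t * P.w2 q t p a + P.w b t * P.w3 q r t p a + P.w2 q r p t * P.w1 t a b +
      P.w1 q p t * P.w2 r t a b + P.w1 r p t * P.w2 q t a b + P.w p t * P.w3 q r t a b)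
        * P.w2 p s c q * P.w r s
      = P.graphTerm 9 a b c t p q r s - P.graphTerm 9 c a b q t p s r
        + P.graphTerm 10 a b c t p q r s + P.graphTerm 5 a b c p q r s t
        - P.graphTerm 9 b a c t p q r s + P.graphTerm 9 c b a q t p s r
        - P.graphTerm 10 b a c t p q r s - P.graphTerm 5 b a c p q r s t
        + P.graphTerm 3 c a b q t p s r + P.graphTerm 11 a b c p t q r s
        - P.graphTerm 1 c a b q s r p t - P.graphTerm 0 c a b q p t s r := by
    intro p q r s t
    simp only [graphTerm,
      P.hs2 s p c q, P.hs2 t q a p, P.hs2 t q b p, P.hs2 t r a b, P.hs2 t r a p, P.hs2 t r b p,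
      P.hs3 q t r a b, P.hw s r, P.hw1 t p a, P.hw2 q r t p, P.hw2 q t p a, P.hw2 r t p a,
      P.hw3 q r t p a]
    ring
  have h0 : sum5 (fun p q r s t => P.graphTerm 9 a b c t p q r s - P.graphTerm 9 c a b q t p s r
        + P.graphTerm 10 a b c t p q r s + P.graphTerm 5 a b c p q r s t
        - P.graphTerm 9 b a c t p q r s + P.graphTerm 9 c b a q t p s r
        - P.graphTerm 10 b a c t p q r s - P.graphTerm 5 b a c p q r s t
        + P.graphTerm 3 c a b q t p s r + P.graphTerm 11 a b c p t q r s
        - P.graphTerm 1 c a b q s r p t - P.graphTerm 0 c a b q p t s r) = 0 := by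
    simp only [← h, sum5, ← Finset.sum_mul, P.J2, zero_mul, Finset.sum_const_zero]
  simp only [sum5_add, sum5_sub] at h0
  have h1 : sum5 (fun p q r s t => P.graphTerm 9 a b c t p q r s) = P.graph 9 a b c :=
    P.sum5_graphTerm a b c 9 ![4, 0, 1, 2, 3] (by decide)
  have h2 : sum5 (fun p q r s t => P.graphTerm 9 c a b q t p s r) = P.graph 9 c a b :=
    P.sum5_graphTerm c a b 9 ![1, 4, 0, 3, 2] (by decide)
  have h3 : sum5 (fun p q r s t => P.graphTerm 10 a b c t p q r s) = P.graph 10 a b c :=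
    P.sum5_graphTerm a b c 10 ![4, 0, 1, 2, 3] (by decide)
  have h4 : sum5 (fun p q r s t => P.graphTerm 5 a b c p q r s t) = P.graph 5 a b c :=
    P.sum5_graphTerm a b c 5 ![0, 1, 2, 3, 4] (by decide)
  have h5 : sum5 (fun p q r s t => P.graphTerm 9 b a c t p q r s) = P.graph 9 b a c :=
    P.sum5_graphTerm b a c 9 ![4, 0, 1, 2, 3] (by decide)
  have h6 : sum5 (fun p q r s t => P.graphTerm 9 c b a q t p s r) = P.graph 9 c b a :=
    P.sum5_graphTerm c b a 9 ![1, 4, 0, 3, 2] (by decide)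
  have h7 : sum5 (fun p q r s t => P.graphTerm 10 b a c t p q r s) = P.graph 10 b a c :=
    P.sum5_graphTerm b a c 10 ![4, 0, 1, 2, 3] (by decide)
  have h8 : sum5 (fun p q r s t => P.graphTerm 5 b a c p q r s t) = P.graph 5 b a c :=
    P.sum5_graphTerm b a c 5 ![0, 1, 2, 3, 4] (by decide)
  have h9 : sum5 (fun p q r s t => P.graphTerm 3 c a b q t p s r) = P.graph 3 c a b :=
    P.sum5_graphTerm c a b 3 ![1, 4, 0, 3, 2] (by decide)
  have h10 : sum5 (fun p q r s t => P.graphTerm 11 a b c p t q r s) = P.graph 11 a b c :=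
    P.sum5_graphTerm a b c 11 ![0, 4, 1, 2, 3] (by decide)
  have h11 : sum5 (fun p q r s t => P.graphTerm 1 c a b q s r p t) = P.graph 1 c a b :=
    P.sum5_graphTerm c a b 1 ![1, 3, 2, 0, 4] (by decide)
  have h12 : sum5 (fun p q r s t => P.graphTerm 0 c a b q p t s r) = P.graph 0 c a b :=
    P.sum5_graphTerm c a b 0 ![1, 0, 4, 3, 2] (by decide)
  linear_combination h0 - (h1 + -h2 + h3 + h4 + -h5 + h6 + -h7 + -h8 + h9 + h10 + -h11 + -h12)

/-- The first derivative of the Jacobi identity for `a` and two internal indices, contracted with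
`∂ ∂ w^{bc}` and `∂ w`. -/
lemma J1_contract_w2_w1 :
    P.graph 12 a b c - P.graph 4 a b c - P.graph 12 a b c - P.graph 11 b c a + P.graph 8 a b c
    - P.graph 1 a b c = 0 := by
  have h : ∀ p q r s t, (P.w1 r a t * P.w1 t p q + P.w a t * P.w2 r t p q + P.w1 r p t * P.w1 t q a +
      P.w p t * P.w2 r t q a + P.w1 r q t * P.w1 t a p + P.w q t * P.w2 r t a p)
        * P.w2 p s b c * P.w1 q r s
      = P.graphTerm 12 a b c t p q r s - P.graphTerm 4 a b c q p r s t
        - P.graphTerm 12 a b c q s r t p - P.graphTerm 11 b c a r s q p t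
        + P.graphTerm 8 a b c p t q s r - P.graphTerm 1 a b c p t q r s := by
    intro p q r s t
    simp only [graphTerm,
      P.hs2 s p b c, P.hs2 t r a p, P.hw t q, P.hw1 q s r, P.hw1 r t p, P.hw1 r t q, P.hw1 t q a,
      P.hw2 r t q a, P.hw2 r t q p]
    ring
  have h0 : sum5 (fun p q r s t => P.graphTerm 12 a b c t p q r s - P.graphTerm 4 a b c q p r s t
        - P.graphTerm 12 a b c q s r t p - P.graphTerm 11 b c a r s q p t
        + P.graphTerm 8 a b c p t q s r - P.graphTerm 1 a b c p t q r s) = 0 := by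
    simp only [← h, sum5, ← Finset.sum_mul, P.J1, zero_mul, Finset.sum_const_zero]
  simp only [sum5_add, sum5_sub] at h0
  have h1 : sum5 (fun p q r s t => P.graphTerm 12 a b c t p q r s) = P.graph 12 a b c :=
    P.sum5_graphTerm a b c 12 ![4, 0, 1, 2, 3] (by decide)
  have h2 : sum5 (fun p q r s t => P.graphTerm 4 a b c q p r s t) = P.graph 4 a b c :=
    P.sum5_graphTerm a b c 4 ![1, 0, 2, 3, 4] (by decide)
  have h3 : sum5 (fun p q r s t => P.graphTerm 12 a b c q s r t p) = P.graph 12 a b c :=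
    P.sum5_graphTerm a b c 12 ![1, 3, 2, 4, 0] (by decide)
  have h4 : sum5 (fun p q r s t => P.graphTerm 11 b c a r s q p t) = P.graph 11 b c a :=
    P.sum5_graphTerm b c a 11 ![2, 3, 1, 0, 4] (by decide)
  have h5 : sum5 (fun p q r s t => P.graphTerm 8 a b c p t q s r) = P.graph 8 a b c :=
    P.sum5_graphTerm a b c 8 ![0, 4, 1, 3, 2] (by decide)
  have h6 : sum5 (fun p q r s t => P.graphTerm 1 a b c p t q r s) = P.graph 1 a b c :=
    P.sum5_graphTerm a b c 1 ![0, 4, 1, 2, 3] (by decide)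
  linear_combination h0 - (h1 + -h2 + -h3 + -h4 + h5 + -h6)

/-- The Jacobi identity for `a` and two internal indices, contracted with `∂ ∂ w^{b ·}` and
`∂ ∂ w^{c ·}`. -/
lemma J_contract_w2_w2 :
    P.graph 7 a b c + P.graph 10 a c b - P.graph 10 a b c = 0 := by
  have h : ∀ p q r s t, (P.w a t * P.w1 t p q + P.w p t * P.w1 t q a + P.w q t * P.w1 t a p)
        * P.w2 p s b r * P.w2 q r c s
      = P.graphTerm 7 a b c r s p q t + P.graphTerm 10 a c b q s r t p
        - P.graphTerm 10 a b c p r s t q := by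
    intro p q r s t
    simp only [graphTerm,
      P.hs2 r q c s, P.hs2 s p b r, P.hw t p, P.hw t q, P.hw1 t q a]
    ring
  have h0 : sum5 (fun p q r s t => P.graphTerm 7 a b c r s p q t + P.graphTerm 10 a c b q s r t p
        - P.graphTerm 10 a b c p r s t q) = 0 := by
    simp only [← h, sum5, ← Finset.sum_mul, P.J, zero_mul, Finset.sum_const_zero]
  simp only [sum5_add, sum5_sub] at h0
  have h1 : sum5 (fun p q r s t => P.graphTerm 7 a b c r s p q t) = P.graph 7 a b c :=
    P.sum5_graphTerm a b c 7 ![2, 3, 0, 1, 4] (by decide)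
  have h2 : sum5 (fun p q r s t => P.graphTerm 10 a c b q s r t p) = P.graph 10 a c b :=
    P.sum5_graphTerm a c b 10 ![1, 3, 2, 4, 0] (by decide)
  have h3 : sum5 (fun p q r s t => P.graphTerm 10 a b c p r s t q) = P.graph 10 a b c :=
    P.sum5_graphTerm a b c 10 ![0, 2, 3, 4, 1] (by decide)
  linear_combination h0 - (h1 + h2 + -h3)

/-- The consistency condition of third order for the universal correction. It is a combination of
contracted derivatives of the Jacobi identity, antisymmetrised in the legs. -/
lemma sum_graph_eq_zero :
    2 * P.graph 0 a b c + 4 * P.graph 1 a b c + P.graph 2 a b c - 2 * P.graph 3 a b c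
    + 2 * P.graph 4 a b c - 2 * P.graph 5 a b c + 2 * P.graph 5 a c b + P.graph 6 a b c
    - 2 * P.graph 7 a b c + 2 * P.graph 0 b c a + 4 * P.graph 1 b c a + P.graph 2 b c a
    - 2 * P.graph 3 b c a + 2 * P.graph 4 b c a - 2 * P.graph 5 b c a + 2 * P.graph 5 b a c
    + P.graph 6 b c a - 2 * P.graph 7 b c a + 2 * P.graph 0 c a b + 4 * P.graph 1 c a b
    + P.graph 2 c a b - 2 * P.graph 3 c a b + 2 * P.graph 4 c a b - 2 * P.graph 5 c a b
    + 2 * P.graph 5 c b a + P.graph 6 c a b - 2 * P.graph 7 c a b = 0 := by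
  linear_combination
    P.J2_contract_w1_w1 a b c
    - P.J2_contract_w2_w a b c + P.J2_contract_w2_w a c b + P.J2_contract_w2_w b a c
    - P.J2_contract_w2_w b c a - P.J2_contract_w2_w c a b + P.J2_contract_w2_w c b a - P.J1_contract_w2_w1 a b c
    + P.J1_contract_w2_w1 a c b + P.J1_contract_w2_w1 b a c - P.J1_contract_w2_w1 b c a - P.J1_contract_w2_w1 c a b
    + P.J1_contract_w2_w1 c b a - P.J_contract_w2_w2 a b c + P.J_contract_w2_w2 a c b + P.J_contract_w2_w2 b a c
    - P.J_contract_w2_w2 b c a - P.J_contract_w2_w2 c a b + P.J_contract_w2_w2 c b a + P.graph_0_swap a b c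
    + P.graph_0_swap b a c + P.graph_0_swap c a b + 2 * P.graph_1_swap a b c
    + 2 * P.graph_1_swap b a c + 2 * P.graph_1_swap c a b + P.graph_2_swap b a c
    - P.graph_3_swap a b c - P.graph_3_swap b a c - P.graph_3_swap c a b + P.graph_4_swap a b c
    + P.graph_4_swap b a c + P.graph_4_swap c a b + P.graph_6_swap b a c - P.graph_7_swap a b c
    - P.graph_7_swap b a c - P.graph_7_swap c a b - P.graph_8_swap a b c + P.graph_8_swap b a c
    - P.graph_8_swap c a b

end PoissonJet

/-! ### The universal correction -/

lemma sum5_congr {R : Type*} [AddCommGroup R] {F G : Fin N → Fin N → Fin N → Fin N → Fin N → R}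
    (h : ∀ p q r s t, F p q r s t = G p q r s t) : sum5 F = sum5 G :=
  congrArg sum5 (by funext p q r s t; exact h p q r s t)

lemma sum5_smul {R : Type*} [AddCommGroup R] [Module ℝ R] (x : ℝ)
    (F : Fin N → Fin N → Fin N → Fin N → Fin N → R) :
    sum5 (fun p q r s t => x • F p q r s t) = x • sum5 F := by
  simp only [sum5, Finset.smul_sum]

lemma pd_mul (l : Fin N) (f g : Smooth N) : pd l (f * g) = f * pd l g + g * pd l f := by
  rw [Derivation.leibniz, smul_eq_mul, smul_eq_mul]

lemma pd_sum {ι : Type*} (l : Fin N) (s : Finset ι) (f : ι → Smooth N) :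
    pd l (∑ i ∈ s, f i) = ∑ i ∈ s, pd l (f i) := map_sum _ _ _

/-- The third jets of a Poisson structure. -/
def IsPoisson.jet {ω₀ : Fin N → Fin N → Smooth N} (h : IsPoisson ω₀) : PoissonJet N (Smooth N) where
  w := ω₀
  w1 l a b := pd l (ω₀ a b)
  w2 l m a b := pd l (pd m (ω₀ a b))
  w3 l m n a b := pd l (pd m (pd n (ω₀ a b)))
  hw := h.skew
  hw1 l a b := by rw [h.skew a b, map_neg]
  hw2 l m a b := by rw [h.skew a b, map_neg, map_neg]
  hw3 l m n a b := by rw [h.skew a b, map_neg, map_neg, map_neg]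
  hs2 l m a b := pd_comm l m _
  hs3 l m n a b := by rw [pd_comm m n]
  J x y z := by
    rw [← h.jacobi y z x]
    refine Finset.sum_congr rfl fun l _ => ?_
    rw [D_one, D_one, D_one]
    ring
  J1 p x y z := by
    have := congrArg (pd p) (h.jacobi y z x)
    rw [map_zero] at this
    rw [← this, map_sum]
    refine Finset.sum_congr rfl fun l _ => ?_
    simp only [D_one, map_add, pd_mul]
    ring
  J2 p q x y z := by
    have := congrArg (fun f => pd p (pd q f)) (h.jacobi y z x)
    simp only [map_zero] at this
    rw [← this, map_sum, map_sum]
    refine Finset.sum_congr rfl fun l _ => ?_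
    simp only [D_one, map_add, pd_mul]
    ring

lemma omegaTwo_eq (ω₀ : Fin N → Fin N → Smooth N) (b c : Fin N) : omegaTwo ω₀ b c
    = ∑ k, ∑ l, ∑ m, ∑ n, ((1 / 12 : ℝ) • (pd m (ω₀ n l) * pd n (ω₀ m k) * pd l (pd k (ω₀ b c)))
      - (1 / 6 : ℝ) • (pd n (pd k (ω₀ b m)) * pd m (pd l (ω₀ c n)) * ω₀ k l)) := by
  simp only [omegaTwo, D_one, D_two]

lemma omegaTwo_skew {ω₀ : Fin N → Fin N → Smooth N} (h : ∀ i j, ω₀ i j = -ω₀ j i) (b c : Fin N) :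
    omegaTwo ω₀ b c = -omegaTwo ω₀ c b := by
  rw [omegaTwo_eq, omegaTwo_eq]
  simp only [Finset.sum_sub_distrib, neg_sub]
  have h1 : ∀ k l m n, (1 / 12 : ℝ) • (pd m (ω₀ n l) * pd n (ω₀ m k) * pd l (pd k (ω₀ b c)))
      = -((1 / 12 : ℝ) • (pd m (ω₀ n l) * pd n (ω₀ m k) * pd l (pd k (ω₀ c b)))) := by
    intro k l m n
    rw [h b c, map_neg, map_neg]
    simp only [Algebra.smul_def]
    ring
  have h2 : ∑ k, ∑ l, ∑ m, ∑ n, (1 / 6 : ℝ) • (pd n (pd k (ω₀ b m)) * pd m (pd l (ω₀ c n)) * ω₀ k l)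
      = -∑ k, ∑ l, ∑ m, ∑ n,
        (1 / 6 : ℝ) • (pd n (pd k (ω₀ c m)) * pd m (pd l (ω₀ b n)) * ω₀ k l) := by
    rw [Finset.sum_comm]
    simp only [← Finset.sum_neg_distrib]
    refine Finset.sum_congr rfl fun l _ => Finset.sum_congr rfl fun k _ => ?_
    rw [Finset.sum_comm]
    refine Finset.sum_congr rfl fun n _ => Finset.sum_congr rfl fun m _ => ?_
    rw [h k l]
    simp only [Algebra.smul_def]
    ring
  simp only [h1, h2, Finset.sum_neg_distrib]
  abel

section

variable {ω₀ : Fin N → Fin N → Smooth N}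

lemma op_hamSym_mul_apply (i : Fin N) (q : Sym N) (f : Smooth N) :
    op (hamSym ω₀ i * q) f = ∑ j, ω₀ i j * op q (pd j f) := by
  rw [hamSym, Finset.sum_mul, map_sum, LinearMap.sum_apply]
  refine Finset.sum_congr rfl fun j _ => ?_
  rw [mul_assoc, op_C_mul, op_X_mul]
  rfl

lemma op_hamSym_apply (i : Fin N) (f : Smooth N) :
    op (hamSym ω₀ i) f = ∑ j, ω₀ i j * pd j f := by
  have := op_hamSym_mul_apply (ω₀ := ω₀) i 1 f
  simpa only [mul_one, op_one, Module.End.one_apply] using this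

lemma op_C_mul_apply (a : Smooth N) (q : Sym N) (f : Smooth N) : op (C a * q) f = a * op q f := by
  rw [op_C_mul]; rfl

/-- The operator of third order in the deformed coordinate `x^a`, applied to `ω₀^{bc}`, as a
combination of graphs. -/
lemma op_ys_three_apply (h : IsPoisson ω₀) (a b c : Fin N) :
    op (ys (xhat (correctedOmega ω₀ (omegaTwo ω₀)) 3) 3 a) (ω₀ b c)
      = (1 / 6 : ℝ) • h.jet.graph 0 a b c + (1 / 3 : ℝ) • h.jet.graph 1 a b c
        + ((1 / 12 : ℝ) • h.jet.graph 2 a b c - (1 / 6 : ℝ) • h.jet.graph 3 a b c) := by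
  have h0 : op (∑ l, ∑ m, hamSym ω₀ m * hamSym ω₀ l * cpd l (cpd m (hamSym ω₀ a))) (ω₀ b c)
      = h.jet.graph 0 a b c := by
    simp only [map_sum, LinearMap.sum_apply, cpd_hamSym, mul_assoc, op_hamSym_mul_apply,
      op_hamSym_apply, Finset.mul_sum]
    rw [← h.jet.sum5_graphTerm a b c 0 ![4, 1, 2, 0, 3] (by decide)]
    refine sum5_congr fun l m i j k => ?_
    simp only [PoissonJet.graphTerm, IsPoisson.jet]
    change _ = pd m (pd l (ω₀ a k)) * ω₀ m i * ω₀ l j * pd k (pd i (pd j (ω₀ b c)))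
    rw [pd_comm l m, pd_comm j i]
    ring
  have h1 : op (∑ l, ∑ m, cpd l (cpd m (hamSym ω₀ a)) * ∑ r, C (ω₀ m r) * cpd r (hamSym ω₀ l))
      (ω₀ b c) = h.jet.graph 1 a b c := by
    simp only [map_sum, LinearMap.sum_apply, cpd_hamSym, op_C_mul_apply, op_hamSym_mul_apply,
      op_hamSym_apply, Finset.mul_sum]
    rw [← h.jet.sum5_graphTerm a b c 1 ![3, 1, 2, 0, 4] (by decide)]
    refine sum5_congr fun l m r k j => ?_
    change _ = pd m (pd l (ω₀ a k)) * ω₀ m r * pd r (ω₀ l j) * pd k (pd j (ω₀ b c))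
    rw [pd_comm l m, pd_comm j k]
    ring
  have h2 : op (hamSym (omegaTwo ω₀) a) (ω₀ b c)
      = (1 / 12 : ℝ) • h.jet.graph 2 a b c - (1 / 6 : ℝ) • h.jet.graph 3 a b c := by
    simp only [op_hamSym_apply, omegaTwo_eq, Finset.sum_mul, sub_mul, Finset.sum_sub_distrib,
      smul_mul_assoc, ← Finset.smul_sum]
    rw [← h.jet.sum5_graphTerm a b c 2 ![4, 2, 3, 1, 0] (by decide),
      ← h.jet.sum5_graphTerm a b c 3 ![3, 0, 4, 1, 2] (by decide)]
    rfl
  rw [ys_three h.skew (omegaTwo_skew h.skew) le_rfl, map_add, map_add, map_smul, map_smul,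
    LinearMap.add_apply, LinearMap.add_apply, LinearMap.smul_apply, LinearMap.smul_apply, h0, h1, h2]

/-- The operator of first order in the deformed coordinate `x^a`, applied to the universal correction,
as a combination of graphs. -/
lemma op_hamSym_omegaTwo (h : IsPoisson ω₀) (a b c : Fin N) :
    op (hamSym ω₀ a) (omegaTwo ω₀ b c) = (1 / 12 : ℝ) • (2 * h.jet.graph 4 a b c +
      h.jet.graph 6 a b c) - (1 / 6 : ℝ) • (h.jet.graph 5 a b c - h.jet.graph 5 a c b
        + h.jet.graph 7 a b c) := by
  simp only [op_hamSym_apply, omegaTwo_eq, pd_sum, Finset.mul_sum]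
  rw [two_mul]
  nth_rewrite 1 [← h.jet.sum5_graphTerm a b c 4 ![4, 2, 3, 1, 0] (by decide)]
  rw [← h.jet.sum5_graphTerm a b c 4 ![3, 1, 4, 2, 0] (by decide),
    ← h.jet.sum5_graphTerm a b c 6 ![4, 2, 3, 1, 0] (by decide),
    ← h.jet.sum5_graphTerm a b c 5 ![3, 4, 1, 2, 0] (by decide),
    ← h.jet.sum5_graphTerm a c b 5 ![4, 3, 2, 1, 0] (by decide),
    ← h.jet.sum5_graphTerm a b c 7 ![3, 4, 1, 2, 0] (by decide)]
  rw [← sum5_add, ← sum5_add, ← sum5_sub, ← sum5_add, ← sum5_smul, ← sum5_smul, ← sum5_sub]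
  refine sum5_congr fun j k l m n => ?_
  rw [map_sub, Derivation.map_smul, Derivation.map_smul]
  change ω₀ a j * ((1 / 12 : ℝ) • pd j (pd m (ω₀ n l) * pd n (ω₀ m k) * pd l (pd k (ω₀ b c)))
      - (1 / 6 : ℝ) • pd j (pd n (pd k (ω₀ b m)) * pd m (pd l (ω₀ c n)) * ω₀ k l))
    = (1 / 12 : ℝ) • (pd m (pd j (ω₀ n l)) * pd n (ω₀ m k) * pd l (pd k (ω₀ b c)) * ω₀ a j
        + pd n (pd j (ω₀ m k)) * pd m (ω₀ n l) * pd k (pd l (ω₀ b c)) * ω₀ a j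
        + pd m (ω₀ n l) * pd n (ω₀ m k) * pd l (pd k (pd j (ω₀ b c))) * ω₀ a j)
      - (1 / 6 : ℝ) • (pd n (pd k (pd j (ω₀ b m))) * pd m (pd l (ω₀ c n)) * ω₀ k l * ω₀ a j
        - pd m (pd l (pd j (ω₀ c n))) * pd n (pd k (ω₀ b m)) * ω₀ l k * ω₀ a j
        + pd n (pd k (ω₀ b m)) * pd m (pd l (ω₀ c n)) * pd j (ω₀ k l) * ω₀ a j)
  have h3 : ∀ (x y : Fin N) (f : Smooth N), pd x (pd y (pd j f)) = pd j (pd x (pd y f)) := by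
    intro x y f
    rw [pd_comm y j, pd_comm x j]
  simp only [pd_mul, h3, pd_comm m j, pd_comm n j, pd_comm k l, h.skew l k, Algebra.smul_def]
  ring

end

/-- The function part of first order of the commutator of `x^i` with `ω^{jk}`. -/
lemma coeff_one_coordOmegaComm {ω₀ ω₂ : Fin N → Fin N → Smooth N} (h₀ : ∀ i j, ω₀ i j = -ω₀ j i)
    (h₂ : ∀ i j, ω₂ i j = -ω₂ j i) {n : ℕ} (hn : 1 ≤ n)
    (hr : CommutationRelation (correctedOmega ω₀ ω₂) n) (i j k : Fin N) :
    PowerSeries.coeff 1 (coordOmegaComm (correctedOmega ω₀ ω₂) n i j k) 1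
      = (2 : ℝ) • op (hamSym ω₀ i) (ω₀ j k) := by
  have hω := correctedOmega_skew h₀ h₂
  have hX := isDeformed_xhat hω n
  rw [coordOmegaComm, coeff_commutator_weylSeries_apply_one hX
    (hr.commute_altX hω (correctedOmega_even ω₀ ω₂)) (correctedOmega_even ω₀ ω₂ j k) i
    (show 1 < n + 1 by omega), ← ys_one h₀ h₂ hn, op_ys hX one_ne_zero]
  congr 1
  · norm_num
  · simp [Finset.Nat.antidiagonal_succ, coeff_correctedOmega]

/-- The function part of third order of the commutator of `x^i` with `ω^{jk}`. -/
lemma coeff_three_coordOmegaComm {ω₀ ω₂ : Fin N → Fin N → Smooth N} (h₀ : ∀ i j, ω₀ i j = -ω₀ j i)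
    (h₂ : ∀ i j, ω₂ i j = -ω₂ j i) {n : ℕ} (hn : 3 ≤ n)
    (hr : CommutationRelation (correctedOmega ω₀ ω₂) n) (i j k : Fin N) :
    PowerSeries.coeff 3 (coordOmegaComm (correctedOmega ω₀ ω₂) n i j k) 1
      = (2 : ℝ) • (op (ys (xhat (correctedOmega ω₀ ω₂) n) 3 i) (ω₀ j k)
        + op (hamSym ω₀ i) (ω₂ j k)) := by
  have hω := correctedOmega_skew h₀ h₂
  have hX := isDeformed_xhat hω n
  rw [coordOmegaComm, coeff_commutator_weylSeries_apply_one hX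
    (hr.commute_altX hω (correctedOmega_even ω₀ ω₂)) (correctedOmega_even ω₀ ω₂ j k) i
    (show 3 < n + 1 by omega), ← ys_one h₀ h₂ (by omega : 1 ≤ n), op_ys hX one_ne_zero,
    op_ys hX three_ne_zero]
  congr 1
  · norm_num
  · simp [Finset.Nat.antidiagonal_succ, coeff_correctedOmega]

lemma IsPoisson.sum_op_hamSym {ω₀ : Fin N → Fin N → Smooth N} (h : IsPoisson ω₀) (i j k : Fin N) :
    op (hamSym ω₀ i) (ω₀ j k) + op (hamSym ω₀ j) (ω₀ k i) + op (hamSym ω₀ k) (ω₀ i j) = 0 := by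
  rw [← h.jet.J i j k, op_hamSym_apply, op_hamSym_apply, op_hamSym_apply,
    ← Finset.sum_add_distrib, ← Finset.sum_add_distrib]
  rfl

/-- The universal correction is admissible. Only the function parts of the orders `1` and `3` have to be
checked: the former is the Jacobi identity of `ω₀`, the latter the graph identity. -/
theorem isCorrection_omegaTwo {ω₀ : Fin N → Fin N → Smooth N} (h : IsPoisson ω₀) :
    IsCorrection ω₀ (omegaTwo ω₀) := by
  have h₂ := omegaTwo_skew h.skew
  have hω := correctedOmega_skew h.skew h₂
  have heven := correctedOmega_even ω₀ (omegaTwo ω₀)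
  refine ⟨h₂, ?_⟩
  have c0 : ConsistencyCondition (correctedOmega ω₀ (omegaTwo ω₀)) 0 :=
    (commutationRelation_zero _).consistencyCondition hω heven fun m hm ho => by
      obtain rfl : m = 0 := by omega
      exact absurd ho (by decide)
  have r1 := c0.commutationRelation hω 1 le_rfl
  have hodd1 : ∀ {n : ℕ}, 1 ≤ n → CommutationRelation (correctedOmega ω₀ (omegaTwo ω₀)) n →
      ∀ i j k, PowerSeries.coeff 1 (coordOmegaComm (correctedOmega ω₀ (omegaTwo ω₀)) n i j k
        + coordOmegaComm (correctedOmega ω₀ (omegaTwo ω₀)) n j k i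
        + coordOmegaComm (correctedOmega ω₀ (omegaTwo ω₀)) n k i j) 1 = 0 := by
    intro n hn hr i j k
    rw [map_add, map_add, LinearMap.add_apply, LinearMap.add_apply,
      coeff_one_coordOmegaComm h.skew h₂ hn hr, coeff_one_coordOmegaComm h.skew h₂ hn hr,
      coeff_one_coordOmegaComm h.skew h₂ hn hr, ← smul_add, ← smul_add, h.sum_op_hamSym, smul_zero]
  have c1 : ConsistencyCondition (correctedOmega ω₀ (omegaTwo ω₀)) 1 :=
    r1.consistencyCondition hω heven fun m hm ho i j k => by
      obtain rfl : m = 1 := by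
        obtain ⟨r, rfl⟩ := ho
        omega
      exact hodd1 le_rfl r1 i j k
  have c2 := c1.succ_of_even hω heven (by decide)
  have r3 := c2.commutationRelation hω 3 le_rfl
  refine r3.consistencyCondition hω heven fun m hm ho i j k => ?_
  obtain rfl | rfl : m = 1 ∨ m = 3 := by
    obtain ⟨r, rfl⟩ := ho
    omega
  · exact hodd1 (by omega) r3 i j k
  · rw [map_add, map_add, LinearMap.add_apply, LinearMap.add_apply,
      coeff_three_coordOmegaComm h.skew h₂ le_rfl r3,
      coeff_three_coordOmegaComm h.skew h₂ le_rfl r3,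
      coeff_three_coordOmegaComm h.skew h₂ le_rfl r3, ← smul_add, ← smul_add]
    refine smul_eq_zero_of_right _ ?_
    simp only [op_ys_three_apply h, op_hamSym_omegaTwo h]
    have := congrArg (fun f => (1 / 12 : ℝ) • f) (h.jet.sum_graph_eq_zero i j k)
    simp only [smul_zero] at this
    rw [← this]
    simp only [two_mul, (by norm_num : (4 : Smooth N) = 2 + 2), add_mul]
    module

end

/-! ### Homogeneous components of the symbols of order four -/

lemma bid_isHomogeneous {p q : Sym N} {d e : ℕ} (hp : p.IsHomogeneous d) (hq : q.IsHomogeneous e)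
    (k : ℕ) : (bid k p q).IsHomogeneous (d - k + e) := by
  induction k generalizing d p q with
  | zero => exact hp.mul hq
  | succ k ih =>
    rw [bid_succ, ← Nat.sub_sub, Nat.sub_right_comm]
    exact smul_isHomogeneous (IsHomogeneous.sum _ _ _ fun l _ =>
      ih hp.pderiv (cpd_isHomogeneous hq l)) _

lemma homogeneousComponent_of_degLT {q : Sym N} {n m : ℕ} (hq : q ∈ degLT N n) (h : n ≤ m) :
    homogeneousComponent m q = 0 := by
  ext1 s
  rw [coeff_homogeneousComponent, coeff_zero]
  split_ifs with hs
  · exact hq s (by omega)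
  · rfl

/-- The homogeneous components of the composition of homogeneous symbols. -/
lemma homogeneousComponent_hash {p q : Sym N} {d e n k : ℕ} (hp : p.IsHomogeneous d)
    (hq : q.IsHomogeneous e) (h : n + k = d + e) :
    homogeneousComponent n (hash p q) = bid k p q := by
  have hd := isHomogeneous_mem_degLT hp
  rw [hash_eq hd, map_sum]
  have hj : ∀ j, homogeneousComponent n (bid j p q) = if n = d - j + e then bid j p q else 0 :=
    fun j => homogeneousComponent_of_mem (bid_isHomogeneous hp hq j) 
  simp only [hj]
  rcases le_or_gt k d with hk | hk
  · rw [Finset.sum_eq_single_of_mem k (by simp; omega) fun j hj hjk => if_neg (by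
      rw [Finset.mem_range] at hj; omega), if_pos (by omega)]
  · rw [bid_eq_zero (degLT_mono hk hd), Finset.sum_eq_zero]
    intro j hj
    rw [Finset.mem_range] at hj
    exact if_neg (by omega)

lemma homogeneousComponent_smul_real (n : ℕ) (t : ℝ) (q : Sym N) :
    homogeneousComponent n (t • q) = t • homogeneousComponent n q := by
  ext1 s
  simp only [coeff_homogeneousComponent, coeff_smul, smul_ite, smul_zero]

lemma dirD_homogeneousComponent (c : Fin N → ℝ) (n : ℕ) (q : Sym N) :
    homogeneousComponent n (dirD c q) = dirD c (homogeneousComponent (n + 1) q) := by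
  simp only [dirD, map_sum, pderiv_homogeneousComponent, homogeneousComponent_smul_real]

lemma hash_sum_left {ι : Type*} (s : Finset ι) (p : ι → Sym N) (q : Sym N) :
    hash (∑ i ∈ s, p i) q = ∑ i ∈ s, hash (p i) q :=
  map_sum (AddMonoidHom.mk' (fun p => hash p q) fun a b => hash_add_left a b q) p s

lemma hash_sum_right {ι : Type*} (s : Finset ι) (p : Sym N) (q : ι → Sym N) :
    hash p (∑ i ∈ s, q i) = ∑ i ∈ s, hash p (q i) :=
  map_sum (AddMonoidHom.mk' (fun q => hash p q) fun a b => hash_add_right p a b) q s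

lemma homogeneousComponent_hash_eq_zero {p q : Sym N} {d e n : ℕ} (hp : p.IsHomogeneous d)
    (hq : q.IsHomogeneous e) (h : d + e < n) : homogeneousComponent n (hash p q) = 0 :=
  homogeneousComponent_of_degLT
    (hash_mem_degLT (isHomogeneous_mem_degLT hp) (isHomogeneous_mem_degLT hq)) h

/-- The top component of a composition. -/
lemma homogeneousComponent_hash_top {p q : Sym N} {a b : ℕ} (hp : p ∈ degLT N (a + 1))
    (hq : q ∈ degLT N (b + 1)) :
    homogeneousComponent (a + b) (hash p q)
      = homogeneousComponent a p * homogeneousComponent b q := by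
  conv_lhs => rw [← sum_homogeneousComponent_of_mem_degLT hp,
    ← sum_homogeneousComponent_of_mem_degLT hq]
  simp only [hash_sum_left, hash_sum_right, map_sum]
  rw [Finset.sum_comm, Finset.sum_eq_single_of_mem a (by simp),
    Finset.sum_eq_single_of_mem b (by simp),
    homogeneousComponent_hash (k := 0) (homogeneousComponent_isHomogeneous a p)
      (homogeneousComponent_isHomogeneous b q) (show a + b + 0 = a + b from rfl), bid_zero]
  · intro e he hne
    rw [Finset.mem_range] at he
    exact homogeneousComponent_hash_eq_zero (homogeneousComponent_isHomogeneous _ _)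
      (homogeneousComponent_isHomogeneous _ _) (by omega)
  · intro d hd hne
    refine Finset.sum_eq_zero fun e he => ?_
    rw [Finset.mem_range] at he hd
    exact homogeneousComponent_hash_eq_zero (homogeneousComponent_isHomogeneous _ _)
      (homogeneousComponent_isHomogeneous _ _) (by omega)

/-- The first subleading component of the composition with a homogeneous symbol. -/
lemma homogeneousComponent_hash_sub {p q : Sym N} {a b : ℕ} (hp : p ∈ degLT N (a + 2))
    (hq : q.IsHomogeneous b) :
    homogeneousComponent (a + b) (hash p q)
      = bid 1 (homogeneousComponent (a + 1) p) q + homogeneousComponent a p * q := by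
  conv_lhs => rw [← sum_homogeneousComponent_of_mem_degLT hp]
  rw [hash_sum_left, map_sum, Finset.sum_range_succ, Finset.sum_range_succ,
    Finset.sum_eq_zero, zero_add,
    homogeneousComponent_hash (k := 0) (homogeneousComponent_isHomogeneous a p) hq
      (show a + b + 0 = a + b from rfl),
    homogeneousComponent_hash (k := 1) (homogeneousComponent_isHomogeneous (a + 1) p) hq (by omega),
    bid_zero, add_comm]
  intro d hd
  rw [Finset.mem_range] at hd
  exact homogeneousComponent_hash_eq_zero (homogeneousComponent_isHomogeneous _ _) hq (by omega)

lemma bid_one (p q : Sym N) : bid 1 p q = ∑ l, pderiv l p * cpd l q := by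
  rw [bid_succ]; norm_num [bid_zero]

lemma bid_one_mul_left (p q r : Sym N) : bid 1 (p * q) r = p * bid 1 q r + q * bid 1 p r := by
  simp only [bid_one, Finset.mul_sum, ← Finset.sum_add_distrib, pderiv_mul]
  exact Finset.sum_congr rfl fun l _ => by ring

lemma isHomogeneous_dirD {q : Sym N} {d : ℕ} (hq : q.IsHomogeneous d) (c : Fin N → ℝ) :
    (dirD c q).IsHomogeneous (d - 1) :=
  IsHomogeneous.sum _ _ _ fun _ _ => smul_isHomogeneous hq.pderiv _

section components

variable {X : Fin N → FormalOp N}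

/-- The symbols of the deformed coordinates are homogeneous of top degree in the orders one and two,
and in the order four there is no vector field. For the deformed coordinates of an `ω` that is even in
the formal parameter, `isParityGraded_xhat_four` proves it. -/
structure IsParityGraded (X : Fin N → FormalOp N) : Prop where
  one : ∀ i, (ys X 1 i).IsHomogeneous 1
  two : ∀ i, (ys X 2 i).IsHomogeneous 2
  four : ∀ i, homogeneousComponent 1 (ys X 4 i) = 0

variable (hX : IsDeformed X) (hg : IsParityGraded X) (c : Fin N → ℝ)

/-- The homogeneous component of degree `d` of the contracted symbol of order `k`. -/
def qh (X : Fin N → FormalOp N) (c : Fin N → ℝ) (k d : ℕ) : Sym N :=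
  homogeneousComponent d (qs X c k)

include hg in
lemma qs_one_isHomogeneous : (qs X c 1).IsHomogeneous 1 :=
  IsHomogeneous.sum _ _ _ fun i _ => smul_isHomogeneous (hg.one i) _

include hg in
lemma qs_two_isHomogeneous : (qs X c 2).IsHomogeneous 2 :=
  IsHomogeneous.sum _ _ _ fun i _ => smul_isHomogeneous (hg.two i) _

lemma qh_isHomogeneous (k d : ℕ) : (qh X c k d).IsHomogeneous d :=
  homogeneousComponent_isHomogeneous _ _

include hX in
lemma qh_zero (k : ℕ) : qh X c k 0 = 0 := by
  rw [qh, qs, map_sum]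
  refine Finset.sum_eq_zero fun i _ => ?_
  rw [homogeneousComponent_smul_real, homogeneousComponent_zero, ← constantCoeff_eq,
    constantCoeff_ys hX, C_0, smul_zero]

include hX in
lemma qs_three_eq : qs X c 3 = qh X c 3 1 + qh X c 3 2 + qh X c 3 3 := by
  have h := sum_homogeneousComponent_of_mem_degLT (qs_mem_degLT hX c 3)
  rw [Finset.sum_range_succ, Finset.sum_range_succ, Finset.sum_range_succ, Finset.sum_range_one,
    ← qh, qh_zero hX, zero_add] at h
  exact h.symm

include hg in
lemma qh_four_one : qh X c 4 1 = 0 := by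
  rw [qh, qs, map_sum]
  exact Finset.sum_eq_zero fun i _ => by rw [homogeneousComponent_smul_real, hg.four, smul_zero]

/-! The homogeneous components of the symbols `cs X c m k`, which enter the fourth order of the star
product of exponentials. -/

include hg in
lemma component_cs_two_two : homogeneousComponent 2 (cs X c 2 2) = qs X c 1 * qs X c 1
    ∧ homogeneousComponent 1 (cs X c 2 2) = bid 1 (qs X c 1) (qs X c 1) + dirD c (qs X c 2) := by
  have h1 := qs_one_isHomogeneous hg c
  have h2 := qs_two_isHomogeneous hg c
  rw [cs_two_two, map_add, map_add, homogeneousComponent_hash (k := 0) h1 h1 rfl,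
    homogeneousComponent_hash (k := 1) h1 h1 rfl,
    homogeneousComponent_of_mem (isHomogeneous_dirD h2 c),
    homogeneousComponent_of_mem (isHomogeneous_dirD h2 c), if_neg (by decide), if_pos rfl, add_zero,
    bid_zero]
  exact ⟨rfl, rfl⟩

include hX hg in
lemma component_cs_two_three : homogeneousComponent 3 (cs X c 2 3) = (2 : ℝ) • (qs X c 1 * qs X c 2)
    ∧ homogeneousComponent 2 (cs X c 2 3) = bid 1 (qs X c 1) (qs X c 2)
      + bid 1 (qs X c 2) (qs X c 1) + dirD c (qh X c 3 3) := by
  have h1 := qs_one_isHomogeneous hg c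
  have h2 := qs_two_isHomogeneous hg c
  rw [cs_two_three, map_add, map_add, map_add, map_add, homogeneousComponent_hash (k := 0) h1 h2 rfl,
    homogeneousComponent_hash (k := 0) h2 h1 rfl, homogeneousComponent_hash (k := 1) h1 h2 rfl,
    homogeneousComponent_hash (k := 1) h2 h1 rfl, dirD_homogeneousComponent,
    dirD_homogeneousComponent, homogeneousComponent_of_degLT (qs_mem_degLT hX c 3) (by norm_num),
    dirD_zero, add_zero, bid_zero, bid_zero, mul_comm (qs X c 2), two_smul]
  exact ⟨rfl, rfl⟩

include hX hg in
lemma component_cs_two_four :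
    homogeneousComponent 4 (cs X c 2 4) = (2 : ℝ) • (qs X c 1 * qh X c 3 3) + qs X c 2 * qs X c 2
    ∧ homogeneousComponent 3 (cs X c 2 4) = (2 : ℝ) • (qs X c 1 * qh X c 3 2)
      + bid 1 (qs X c 1) (qh X c 3 3) + bid 1 (qs X c 2) (qs X c 2) + bid 1 (qh X c 3 3) (qs X c 1)
      + dirD c (qh X c 4 4)
    ∧ homogeneousComponent 2 (cs X c 2 4) = (2 : ℝ) • (qs X c 1 * qh X c 3 1)
      + bid 1 (qs X c 1) (qh X c 3 2) + bid 2 (qs X c 2) (qs X c 2) + bid 1 (qh X c 3 2) (qs X c 1)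
      + bid 2 (qh X c 3 3) (qs X c 1) + dirD c (qh X c 4 3) := by
  have h1 := qs_one_isHomogeneous hg c
  have h2 := qs_two_isHomogeneous hg c
  have h31 := qh_isHomogeneous (X := X) c 3 1
  have h32 := qh_isHomogeneous (X := X) c 3 2
  have h33 := qh_isHomogeneous (X := X) c 3 3
  rw [cs_two_four]
  simp only [map_add, dirD_homogeneousComponent]
  rw [show qs X c 3 = qh X c 3 1 + qh X c 3 2 + qh X c 3 3 from qs_three_eq hX c]
  simp only [hash_add_left, hash_add_right, map_add]
  rw [homogeneousComponent_of_degLT (qs_mem_degLT hX c 4) (by norm_num : 5 ≤ 4 + 1), dirD_zero]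
  refine ⟨?_, ?_, ?_⟩
  · rw [homogeneousComponent_hash_eq_zero h1 h31 (by norm_num),
      homogeneousComponent_hash_eq_zero h1 h32 (by norm_num),
      homogeneousComponent_hash_eq_zero h31 h1 (by norm_num),
      homogeneousComponent_hash_eq_zero h32 h1 (by norm_num),
      homogeneousComponent_hash (k := 0) h1 h33 rfl, homogeneousComponent_hash (k := 0) h33 h1 rfl,
      homogeneousComponent_hash (k := 0) h2 h2 rfl]
    simp only [bid_zero, Algebra.smul_def, map_ofNat]
    ring
  · rw [homogeneousComponent_hash_eq_zero h1 h31 (by norm_num),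
      homogeneousComponent_hash_eq_zero h31 h1 (by norm_num),
      homogeneousComponent_hash (k := 0) h1 h32 rfl, homogeneousComponent_hash (k := 0) h32 h1 rfl,
      homogeneousComponent_hash (k := 1) h1 h33 rfl, homogeneousComponent_hash (k := 1) h33 h1 rfl,
      homogeneousComponent_hash (k := 1) h2 h2 rfl]
    simp only [bid_zero, Algebra.smul_def, map_ofNat, qh]
    ring
  · rw [homogeneousComponent_hash (k := 0) h1 h31 rfl, homogeneousComponent_hash (k := 0) h31 h1 rfl,
      homogeneousComponent_hash (k := 1) h1 h32 rfl, homogeneousComponent_hash (k := 1) h32 h1 rfl,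
      homogeneousComponent_hash (k := 2) h1 h33 rfl, homogeneousComponent_hash (k := 2) h33 h1 rfl,
      homogeneousComponent_hash (k := 2) h2 h2 rfl, bid_eq_zero (isHomogeneous_mem_degLT h1)]
    simp only [bid_zero, Algebra.smul_def, map_ofNat, qh]
    ring

include hX hg in
lemma component_cs_three_three : homogeneousComponent 3 (cs X c 3 3) = qs X c 1 ^ 3 := by
  have h := homogeneousComponent_hash_top (a := 2) (b := 1) (cs_mem_degLT hX c 2 2)
    (qs_mem_degLT hX c 1)
  rw [cs_three_three hX, map_add, h, dirD_homogeneousComponent,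
    homogeneousComponent_of_degLT (cs_mem_degLT hX c 2 3) le_rfl, dirD_zero, add_zero,
    (component_cs_two_two hg c).1, homogeneousComponent_of_mem (qs_one_isHomogeneous hg c),
    if_pos rfl]
  ring

include hX hg in
lemma component_cs_four_four : homogeneousComponent 4 (cs X c 4 4) = qs X c 1 ^ 4 := by
  have h := homogeneousComponent_hash_top (a := 3) (b := 1) (cs_mem_degLT hX c 3 3)
    (qs_mem_degLT hX c 1)
  rw [cs_four_four hX, map_add, h, dirD_homogeneousComponent,
    homogeneousComponent_of_degLT (cs_mem_degLT hX c 3 4) le_rfl, dirD_zero, add_zero,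
    component_cs_three_three hX hg c, homogeneousComponent_of_mem (qs_one_isHomogeneous hg c),
    if_pos rfl]
  ring

include hX hg in
lemma component_cs_three_four :
    homogeneousComponent 4 (cs X c 3 4) = (3 : ℝ) • (qs X c 1 ^ 2 * qs X c 2)
    ∧ homogeneousComponent 3 (cs X c 3 4) = (3 : ℝ) • (qs X c 1 * bid 1 (qs X c 1) (qs X c 2)
      + qs X c 2 * bid 1 (qs X c 1) (qs X c 1) + qs X c 1 * bid 1 (qs X c 2) (qs X c 1)
      + qs X c 2 * dirD c (qs X c 2) + qs X c 1 * dirD c (qh X c 3 3)) := by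
  have h1 := qs_one_isHomogeneous hg c
  have h2 := qs_two_isHomogeneous hg c
  obtain ⟨a1, a2⟩ := component_cs_two_two hg c
  obtain ⟨b1, b2⟩ := component_cs_two_three hX hg c
  obtain ⟨d1, -, -⟩ := component_cs_two_four hX hg c
  have e1 := homogeneousComponent_hash_top (a := 2) (b := 2) (cs_mem_degLT hX c 2 2)
    (qs_mem_degLT hX c 2)
  have e2 := homogeneousComponent_hash_top (a := 3) (b := 1) (cs_mem_degLT hX c 2 3)
    (qs_mem_degLT hX c 1)
  have f1 := homogeneousComponent_hash_sub (a := 1) (b := 2) (cs_mem_degLT hX c 2 2) h2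
  have f2 := homogeneousComponent_hash_sub (a := 2) (b := 1) (cs_mem_degLT hX c 2 3) h1
  have h3 : bid 1 ((2 : ℝ) • (qs X c 1 * qs X c 2)) (qs X c 1)
      = (2 : ℝ) • (qs X c 1 * bid 1 (qs X c 2) (qs X c 1) + qs X c 2 * bid 1 (qs X c 1) (qs X c 1)) := by
    rw [two_smul, two_smul, bid_add_left, bid_one_mul_left]
  have h4 : dirD c ((2 : ℝ) • (qs X c 1 * qh X c 3 3) + qs X c 2 * qs X c 2)
      = (2 : ℝ) • (qs X c 1 * dirD c (qh X c 3 3)) + (2 : ℝ) • (qs X c 2 * dirD c (qs X c 2)) := by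
    rw [dirD_add, dirD_smul, dirD_mul, dirD_qs_one hX, dirD_mul, mul_zero, add_zero, ← two_smul ℝ]
  rw [cs_three_four hX]
  simp only [map_add, dirD_homogeneousComponent]
  constructor
  · rw [e1, e2, homogeneousComponent_of_degLT (cs_mem_degLT hX c 2 4) le_rfl, dirD_zero, a1, b1,
      homogeneousComponent_of_mem h1, homogeneousComponent_of_mem h2, if_pos rfl, if_pos rfl]
    simp only [Algebra.smul_def, map_ofNat]
    ring
  · rw [f1, f2, d1, a1, b1, a2, b2, h3, h4, bid_one_mul_left]
    simp only [Algebra.smul_def, map_ofNat]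
    ring

end components

/-! ### Symbols with symmetric coefficient tensors -/

lemma mon_cons (i : Fin N) (I : List (Fin N)) : mon (i :: I) = X i * mon I := by
  rw [mon, mon, List.map_cons, List.prod_cons]

/-- The homogeneous symbol `∑ A^{i₁…i_d} p_{i₁} ⋯ p_{i_d}`. -/
def tens (d : ℕ) (A : List (Fin N) → Smooth N) : Sym N :=
  ∑ I : Fin d → Fin N, C (A (List.ofFn I)) * mon (List.ofFn I)

lemma tens_zero (A : List (Fin N) → Smooth N) : tens 0 A = C (A []) := by
  simp [tens, mon]

lemma tens_succ (d : ℕ) (A : List (Fin N) → Smooth N) :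
    tens (d + 1) A = ∑ a, X a * tens d fun L => A (a :: L) := by
  rw [tens, sum_cons]
  refine Finset.sum_congr rfl fun a _ => ?_
  rw [tens, Finset.mul_sum]
  refine Finset.sum_congr rfl fun J _ => ?_
  rw [List.ofFn_cons, mon_cons]
  ring

lemma tens_congr {d : ℕ} {A B : List (Fin N) → Smooth N} (h : ∀ L, L.length = d → A L = B L) :
    tens d A = tens d B :=
  Finset.sum_congr rfl fun I _ => by rw [h _ List.length_ofFn]

lemma C_smul_real (t : ℝ) (a : Smooth N) : (C (t • a) : Sym N) = t • C a := by
  ext1 m; simp only [coeff_C, coeff_smul, smul_ite, smul_zero]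

lemma smul_tens (d : ℕ) (t : ℝ) (A : List (Fin N) → Smooth N) :
    t • tens d A = tens d fun L => t • A L := by
  simp only [tens, C_smul_real, Finset.smul_sum, smul_mul_assoc]

lemma sum_tens {ι : Type*} (s : Finset ι) (d : ℕ) (A : ι → List (Fin N) → Smooth N) :
    ∑ i ∈ s, tens d (A i) = tens d fun L => ∑ i ∈ s, A i L := by
  simp only [tens, map_sum, Finset.sum_mul]
  rw [Finset.sum_comm]

lemma cpd_tens (l : Fin N) (d : ℕ) (A : List (Fin N) → Smooth N) :
    cpd l (tens d A) = tens d fun L => pd l (A L) := by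
  induction d generalizing A with
  | zero => rw [tens_zero, tens_zero, cpd_C]
  | succ d ih => simp only [tens_succ, map_sum, cpd_X_mul, ih]

/-- Invariance of a tensor under the permutations of its indices. -/
def IsSymm (A : List (Fin N) → Smooth N) : Prop := ∀ L L' : List (Fin N), L.Perm L' → A L = A L'

lemma IsSymm.cons {A : List (Fin N) → Smooth N} (hA : IsSymm A) (a : Fin N) :
    IsSymm fun L => A (a :: L) := fun _ _ h => hA _ _ (h.cons a)

lemma pderiv_tens {A : List (Fin N) → Smooth N} (hA : IsSymm A) (l : Fin N) (d : ℕ) :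
    pderiv l (tens (d + 1) A) = ((d : ℝ) + 1) • tens d fun L => A (l :: L) := by
  induction d generalizing A with
  | zero =>
    simp [tens_succ, tens_zero, Pi.single_apply]
  | succ d ih =>
    have h : ∀ a, (tens d fun L => A (a :: l :: L)) = tens d fun L => A (l :: a :: L) := fun a =>
      tens_congr fun L _ => hA _ _ (List.Perm.swap l a L)
    rw [tens_succ, map_sum]
    simp only [pderiv_X_mul, ih (hA.cons _), h, mul_smul_comm, Finset.sum_add_distrib,
      Finset.sum_ite_eq, Finset.mem_univ, if_true]
    rw [← Finset.smul_sum, ← tens_succ d fun L => A (l :: L), Nat.cast_succ,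
      add_smul ((d : ℝ) + 1) 1, one_smul]

/-- The contraction `∑ u_i F^i` of a tensor with a covector. -/
def ctr {M : Type*} [AddCommMonoid M] [Module ℝ M] (u : Fin N → ℝ) (F : Fin N → M) : M :=
  ∑ i, u i • F i

lemma val_tens_zero (v : Fin N → ℝ) (A : List (Fin N) → Smooth N) : val v (tens 0 A) = A [] := by
  rw [tens_zero, val_C]

lemma val_tens_succ (v : Fin N → ℝ) (d : ℕ) (A : List (Fin N) → Smooth N) :
    val v (tens (d + 1) A) = ctr v fun a => val v (tens d fun L => A (a :: L)) := by
  simp only [tens_succ, map_sum, map_mul, val_X, ctr, Algebra.smul_def]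

lemma dirD_tens {A : List (Fin N) → Smooth N} (hA : IsSymm A) (u : Fin N → ℝ) (d : ℕ) :
    dirD u (tens (d + 1) A) = ((d : ℝ) + 1) • tens d fun L => ctr u fun l => A (l :: L) := by
  simp only [dirD, pderiv_tens hA, ctr, ← sum_tens, ← smul_tens, Finset.smul_sum]
  simp only [smul_smul, mul_comm]

lemma isSymm_ctr {A : Fin N → List (Fin N) → Smooth N} (hA : ∀ i, IsSymm (A i)) (u : Fin N → ℝ) :
    IsSymm fun L => ctr u fun i => A i L := fun L L' h => by
  simp only [fun i => hA i L L' h]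

/-! ### Symmetry of the coefficient functions -/

lemma pdl_perm {L L' : List (Fin N)} (h : L.Perm L') (q : Sym N) : pdl L q = pdl L' q :=
  h.foldl_eq' (fun _ _ _ _ _ => pderiv_comm _ _ _) q

lemma isSymm_symCoeff (q : Sym N) : IsSymm (symCoeff (op q)) := fun L L' h => by
  rw [symCoeff_op, symCoeff_op, pdl_perm h, h.length_eq]

/-- The sum over the ways of taking one element out of a list. -/
def sumPick (f : Fin N → List (Fin N) → Smooth N) (L : List (Fin N)) : Smooth N :=
  ∑ s : Fin L.length, f (L.get s) (L.eraseIdx s)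

lemma sumPick_cons (f : Fin N → List (Fin N) → Smooth N) (a : Fin N) (L : List (Fin N)) :
    sumPick f (a :: L) = f a L + sumPick (fun b L' => f b (a :: L')) L :=
  Fin.sum_univ_succ (n := L.length)
    (fun s => f ((a :: L).get s) ((a :: L).eraseIdx s))

lemma isSymm_sumPick {f : Fin N → List (Fin N) → Smooth N} (hf : ∀ a, IsSymm (f a)) :
    IsSymm (sumPick f) := fun L L' h => by
  induction h generalizing f with
  | nil => rfl
  | cons a h ih => rw [sumPick_cons, sumPick_cons, hf a _ _ h, ih fun b => (hf b).cons a]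
  | swap a b L =>
    have h : (fun c L' => f c (b :: a :: L')) = fun c L' => f c (a :: b :: L') :=
      funext fun c => funext fun L' => hf c _ _ (List.Perm.swap a b L')
    rw [sumPick_cons, sumPick_cons, sumPick_cons, sumPick_cons, h, add_left_comm]
  | trans _ _ ih₁ ih₂ => rw [ih₁ hf, ih₂ hf]

/-- The coefficient functions are symmetric in all indices, because they are symmetrised over the
position of the index that the defect takes. -/
lemma isSymm_Gam {ω : Fin N → Fin N → FormalFn N} (hω : ∀ i j, ω i j = -ω j i) (k : ℕ)
    (i : Fin N) : IsSymm (Gam ω k i) := fun L L' h => by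
  obtain ⟨g, hg, -, -⟩ := exists_symbol_defect hω
    (isDeformed_xhat hω (k + L.length - 1)) (k + L.length - 1)
  rw [Gam, Gam, ← h.length_eq, gammaOf, gammaOf]
  refine congrArg₂ (· • ·) (by rw [h.length_eq]) ?_
  refine isSymm_sumPick (f := fun a L => symCoeff (defect ω _ (xhat ω _) i a) L) (fun a => ?_) L L' h
  rw [hg]
  exact isSymm_symCoeff _

/-- The homogeneous components of the symbols of the deformed coordinates. -/
lemma homogeneousComponent_ys {ω : Fin N → Fin N → FormalFn N} (hω : ∀ i j, ω i j = -ω j i)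
    {k d m : ℕ} (hkm : k + d + 1 ≤ m) (i : Fin N) :
    homogeneousComponent (d + 1) (ys (xhat ω m) (k + d + 1) i) = tens (d + 1) (Gam ω k i) := by
  obtain ⟨g, hg, -, -⟩ := exists_symbol_defect hω (isDeformed_xhat hω (k + d)) (k + d)
  rw [ys_xhat_eq_gam hkm hg, tens_congr (B := gammaOf (defect ω (k + d) (xhat ω (k + d))) i), tens,
    sum_gammaOf_mon hg, gam, map_sum, Finset.sum_eq_single_of_mem d (by simp),
    homogeneousComponent_smul_real, map_sum]
  · congr 1
    refine Finset.sum_congr rfl fun j _ => ?_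
    rw [homogeneousComponent_X_mul, homogeneousComponent_of_mem
      (homogeneousComponent_isHomogeneous d _), if_pos rfl]
  · intro e _ hne
    rw [homogeneousComponent_smul_real, map_sum, Finset.sum_eq_zero, smul_zero]
    intro j _
    rw [homogeneousComponent_X_mul, homogeneousComponent_of_mem
      (homogeneousComponent_isHomogeneous e _), if_neg hne.symm, mul_zero]
  · intro L hL
    rw [Gam, hL]
    rfl

/-! ### The star product of exponentials -/

/-- A polynomial in a real variable with coefficients in the smooth functions vanishes only if its
coefficients do. -/
lemma eq_zero_of_sum_pow_smul {M : ℕ} {b : ℕ → Smooth N}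
    (h : ∀ s : ℝ, ∑ m ∈ range M, s ^ m • b m = 0) {m : ℕ} (hm : m < M) : b m = 0 := by
  ext x
  let p : Polynomial ℝ := ∑ m ∈ range M, Polynomial.monomial m ((b m : (Fin N → ℝ) → ℝ) x)
  have hp : p = 0 := by
    refine Polynomial.funext fun s => ?_
    have := congrArg (fun f : Smooth N => (f : (Fin N → ℝ) → ℝ) x) (h s)
    simp only [AddSubmonoidClass.coe_finsetSum, Finset.sum_apply] at this
    rw [Polynomial.eval_finsetSum, Polynomial.eval_zero]
    refine Eq.trans (Finset.sum_congr rfl fun m _ => ?_) this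
    rw [Polynomial.eval_monomial, mul_comm]
    rfl
  have := congrArg (fun q : Polynomial ℝ => q.coeff m) hp
  simp only [p, Polynomial.finsetSum_coeff, Polynomial.coeff_monomial, Polynomial.coeff_zero,
    Finset.sum_ite_eq', Finset.mem_range, hm, if_true] at this
  exact this

lemma eq_zero_of_sum_pow_pow_smul {M : ℕ} {a : ℕ → ℕ → Smooth N}
    (h : ∀ s t : ℝ, ∑ m ∈ range M, ∑ n ∈ range M, (s ^ m * t ^ n) • a m n = 0) {m n : ℕ}
    (hm : m < M) (hn : n < M) : a m n = 0 := by
  refine eq_zero_of_sum_pow_smul (b := a m) (fun t => ?_) hn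
  refine eq_zero_of_sum_pow_smul (b := fun m => ∑ n ∈ range M, t ^ n • a m n) (fun s => ?_) hm
  simpa only [Finset.smul_sum, smul_smul] using h s t

section expo

variable {X : Fin N → FormalOp N}

/-- The part of bidegree `(m, n)` in the covectors `u` and `v` of the bisymbol of `(f, g) ↦ W(f) g` in
the order `α⁴`, that is, of its value on `e^{u · x}` and `e^{v · x}` divided by these functions. -/
def bisymbol (X : Fin N → FormalOp N) (u v : Fin N → ℝ) (m n : ℕ) : Smooth N :=
  (1 / (m.factorial : ℝ)) • val v (homogeneousComponent n (cs X u m 4))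

variable (hX : IsDeformed X) (u v : Fin N → ℝ)

include hX in
/-- The bounds: centered products of more than `8` factors do not contribute, and the operators have
order at most `4`. -/
lemma coeff_four_weyl_expo : PowerSeries.coeff 4 (weyl X (expo u)) (expo v)
    = expo u * expo v * ∑ m ∈ range 9, ∑ n ∈ range 5, bisymbol X u v m n := by
  simp only [weyl, PowerSeries.coeff_mk, LinearMap.sum_apply, Finset.mul_sum]
  refine Finset.sum_congr rfl fun m _ => ?_
  rw [← Finset.mul_sum]
  have h1 : ∑ n ∈ range 5, bisymbol X u v m n = (1 / (m.factorial : ℝ)) • val v (cs X u m 4) := by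
    conv_rhs => rw [← sum_homogeneousComponent_of_mem_degLT (cs_mem_degLT hX u m 4)]
    simp only [bisymbol, map_sum, Finset.smul_sum]
  have h2 : (∑ I : Fin m → Fin N, mulOp (D (List.ofFn I) (expo u))
      * PowerSeries.coeff 4 (centered X (List.ofFn I))) (expo v)
      = expo u * (val v (cs X u m 4) * expo v) := by
    rw [← op_expo, op_cs hX, cen, map_sum, LinearMap.sum_apply, LinearMap.sum_apply,
      Finset.mul_sum]
    refine Finset.sum_congr rfl fun I _ => ?_
    rw [D_expo, List.map_ofFn, List.prod_ofFn, mulOp_smul, smul_mul_assoc, LinearMap.smul_apply,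
      PowerSeries.coeff_smul, LinearMap.smul_apply, mul_smul_comm]
    rfl
  rw [h1, LinearMap.smul_apply, h2, mul_smul_comm]
  congr 1
  ring

include hX in
lemma cs_smul (s : ℝ) (m k : ℕ) : cs X (s • u) m k = s ^ m • cs X u m k := by
  refine op_injective ?_
  rw [map_smul, op_cs hX, op_cs hX, cen, cen, map_sum, map_sum, Finset.smul_sum]
  refine Finset.sum_congr rfl fun I _ => ?_
  simp only [PowerSeries.coeff_smul, smul_smul, Pi.smul_apply, smul_eq_mul, Finset.prod_mul_distrib,
    Finset.prod_const, Finset.card_univ, Fintype.card_fin]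

include hX in
lemma bisymbol_smul (s t : ℝ) (m n : ℕ) :
    bisymbol X (s • u) (t • v) m n = (s ^ m * t ^ n) • bisymbol X u v m n := by
  rw [bisymbol, bisymbol, cs_smul hX, homogeneousComponent_smul_real, val_smul,
    val_scale (homogeneousComponent_isHomogeneous n _), smul_smul, smul_smul, smul_smul]
  congr 1
  ring

include hX in
lemma bisymbol_eq_zero_right {m n : ℕ} (hn : 5 ≤ n) : bisymbol X u v m n = 0 := by
  rw [bisymbol, homogeneousComponent_of_degLT (cs_mem_degLT hX u m 4) hn, map_zero, smul_zero]

lemma bisymbol_zero_left (n : ℕ) : bisymbol X u v 0 n = 0 := by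
  rw [bisymbol, cs, if_neg four_ne_zero, map_zero, map_zero, smul_zero]

variable (hsymm : ∀ f g, PowerSeries.coeff 4 (weyl X f) g = PowerSeries.coeff 4 (weyl X g) f)

include hX hsymm in
/-- If the order `α⁴` of the star product is symmetric, then so is each of its homogeneous parts:
scaling `u` and `v` separates the bidegrees. -/
lemma bisymbol_symm {m n : ℕ} (hm : m < 9) (hn : n < 9) :
    bisymbol X u v m n = bisymbol X v u n m := by
  have h9 : ∀ u v : Fin N → ℝ, ∑ m ∈ range 9, ∑ n ∈ range 5, bisymbol X u v m n
      = ∑ m ∈ range 9, ∑ n ∈ range 9, bisymbol X u v m n := fun u v =>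
    Finset.sum_congr rfl fun m _ => Finset.sum_subset (by simp) fun n _ hn =>
      bisymbol_eq_zero_right hX u v (by simpa using hn)
  have hs : ∀ u v : Fin N → ℝ, ∑ m ∈ range 9, ∑ n ∈ range 9, bisymbol X u v m n
      = ∑ m ∈ range 9, ∑ n ∈ range 9, bisymbol X v u m n := by
    intro u v
    have h := hsymm (expo u) (expo v)
    rw [coeff_four_weyl_expo hX, coeff_four_weyl_expo hX, mul_comm (expo v)] at h
    rw [← h9, ← h9]
    refine expo_mul_cancel (c := u) (expo_mul_cancel (c := v) ?_)
    linear_combination h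
  refine sub_eq_zero.mp (eq_zero_of_sum_pow_pow_smul
    (a := fun m n => bisymbol X u v m n - bisymbol X v u n m) (fun s t => ?_) hm hn)
  simp only [smul_sub, Finset.sum_sub_distrib]
  rw [sub_eq_zero]
  have h := hs (s • u) (t • v)
  simp only [bisymbol_smul hX] at h
  rw [h, Finset.sum_comm]
  simp only [mul_comm]

include hX hsymm in
/-- By symmetry, derivatives of `f` of order greater than `4` do not occur. -/
lemma bisymbol_eq_zero_left {m n : ℕ} (hm : 5 ≤ m) (hm' : m < 9) (hn : n < 9) :
    bisymbol X u v m n = 0 := by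
  rw [bisymbol_symm hX u v hsymm hm' hn, bisymbol_eq_zero_right hX v u hm]

include hX hsymm in
lemma coeff_four_weyl_expo_of_symm : PowerSeries.coeff 4 (weyl X (expo u)) (expo v)
    = expo u * expo v * ∑ m ∈ range 5, ∑ n ∈ range 5, bisymbol X u v m n := by
  rw [coeff_four_weyl_expo hX]
  congr 1
  refine (Finset.sum_subset (by simp) fun m hm hm' => Finset.sum_eq_zero fun n hn => ?_).symm
  rw [Finset.mem_range] at hm hm' hn
  exact bisymbol_eq_zero_left hX u v hsymm (by omega) hm (by omega)

end expo

/-! ### Bidifferential operators -/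

lemma eq_of_expo {P Q : Op N} (hP : P ∈ diffOp N) (hQ : Q ∈ diffOp N)
    (h : ∀ c : Fin N → ℝ, P (expo c) = Q (expo c)) (f : Smooth N) : P f = Q f := by
  have hz := eq_zero_of_expo (Subalgebra.add_mem _ hP (Subalgebra.smul_mem _ hQ (-1 : ℝ)))
    fun c => by
      rw [LinearMap.add_apply, LinearMap.smul_apply, h, neg_one_smul, add_neg_cancel]
  have := congrArg (fun R : Op N => R f) hz
  simp only [LinearMap.add_apply, LinearMap.smul_apply, neg_one_smul, LinearMap.zero_apply] at this
  exact add_neg_eq_zero.mp this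

/-- Maps that are differential operators in each of the two arguments. -/
structure IsBidiff (B : Smooth N → Smooth N → Smooth N) : Prop where
  left : ∀ g, ∃ P ∈ diffOp N, ∀ f, B f g = P f
  right : ∀ f, ∃ P ∈ diffOp N, ∀ g, B f g = P g

namespace IsBidiff

variable {A B : Smooth N → Smooth N → Smooth N}

/-- A bidifferential operator is determined by its values on exponential functions. -/
lemma ext (hA : IsBidiff A) (hB : IsBidiff B)
    (h : ∀ u v : Fin N → ℝ, A (expo u) (expo v) = B (expo u) (expo v)) (f g : Smooth N) :
    A f g = B f g := by
  have h1 : ∀ u g, A (expo u) g = B (expo u) g := by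
    intro u
    obtain ⟨P, hP, hP'⟩ := hA.right (expo u)
    obtain ⟨Q, hQ, hQ'⟩ := hB.right (expo u)
    intro g
    rw [hP', hQ', eq_of_expo hP hQ fun v => by rw [← hP', ← hQ', h]]
  obtain ⟨P, hP, hP'⟩ := hA.left g
  obtain ⟨Q, hQ, hQ'⟩ := hB.left g
  rw [hP', hQ', eq_of_expo hP hQ fun v => by rw [← hP', ← hQ', h1]]

lemma swap (hA : IsBidiff A) : IsBidiff fun f g => A g f := ⟨hA.right, hA.left⟩

lemma zero : IsBidiff fun _ _ : Smooth N => 0 :=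
  ⟨fun _ => ⟨0, Subalgebra.zero_mem _, fun _ => rfl⟩, fun _ => ⟨0, Subalgebra.zero_mem _, fun _ => rfl⟩⟩

lemma add (hA : IsBidiff A) (hB : IsBidiff B) : IsBidiff fun f g => A f g + B f g := by
  constructor
  · intro g
    obtain ⟨P, hP, hP'⟩ := hA.left g
    obtain ⟨Q, hQ, hQ'⟩ := hB.left g
    exact ⟨P + Q, Subalgebra.add_mem _ hP hQ, fun f => by rw [hP', hQ', LinearMap.add_apply]⟩
  · intro g
    obtain ⟨P, hP, hP'⟩ := hA.right g
    obtain ⟨Q, hQ, hQ'⟩ := hB.right g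
    exact ⟨P + Q, Subalgebra.add_mem _ hP hQ, fun f => by rw [hP', hQ', LinearMap.add_apply]⟩

lemma smul (t : ℝ) (hA : IsBidiff A) : IsBidiff fun f g => t • A f g := by
  constructor
  · intro g
    obtain ⟨P, hP, hP'⟩ := hA.left g
    exact ⟨t • P, Subalgebra.smul_mem _ hP t, fun f => by rw [hP', LinearMap.smul_apply]⟩
  · intro g
    obtain ⟨P, hP, hP'⟩ := hA.right g
    exact ⟨t • P, Subalgebra.smul_mem _ hP t, fun f => by rw [hP', LinearMap.smul_apply]⟩

lemma sum {ι : Type*} (s : Finset ι) {A : ι → Smooth N → Smooth N → Smooth N}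
    (hA : ∀ i, IsBidiff (A i)) : IsBidiff fun f g => ∑ i ∈ s, A i f g := by
  classical
  induction s using Finset.induction_on with
  | empty => simpa using zero
  | insert a s ha ih => simpa only [Finset.sum_insert ha] using (hA a).add ih

lemma D_mul_D (I J : List (Fin N)) (a : Smooth N) : IsBidiff fun f g => D I f * a * D J g :=
  ⟨fun g => ⟨mulOp (a * D J g) * D I, mem_diffOp (mul_mem_ordLT (mulOp_mem_ordLT _) (D_mem_ordLT _)),
    fun f => by rw [Module.End.mul_apply, mulOp_apply]; ring⟩,
  fun f => ⟨mulOp (D I f * a) * D J, mem_diffOp (mul_mem_ordLT (mulOp_mem_ordLT _) (D_mem_ordLT _)),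
    fun g => by rw [Module.End.mul_apply, mulOp_apply]⟩⟩

lemma weyl {X : Fin N → FormalOp N} (hX : IsDeformed X) (k : ℕ) :
    IsBidiff fun f g => PowerSeries.coeff k (weyl X f) g :=
  ⟨fun g => ⟨weylLeft X k g, weylLeft_mem_diffOp X k g, fun f => (weylLeft_apply X k f g).symm⟩,
    fun f => ⟨_, mem_diffOp (adm_weyl hX f k), fun _ => rfl⟩⟩

end IsBidiff

/-! ### The coefficient functions of the star product of exponentials -/

lemma ctr_add (u : Fin N → ℝ) (F G : Fin N → Smooth N) :
    (ctr u fun i => F i + G i) = ctr u F + ctr u G := by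
  simp only [ctr, smul_add, Finset.sum_add_distrib]

lemma ctr_smul (u : Fin N → ℝ) (t : ℝ) (F : Fin N → Smooth N) :
    (ctr u fun i => t • F i) = t • ctr u F := by
  simp only [ctr, Finset.smul_sum, smul_comm t]

lemma pd_ctr (l : Fin N) (u : Fin N → ℝ) (F : Fin N → Smooth N) :
    pd l (ctr u F) = ctr u fun i => pd l (F i) := by
  simp only [ctr, map_sum, Derivation.map_smul]

/-- The contraction of the first index of a family of tensors with a covector. -/
abbrev con (u : Fin N → ℝ) (A : Fin N → List (Fin N) → Smooth N) (L : List (Fin N)) : Smooth N :=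
  ctr u fun i => A i L

lemma bid_two (p q : Sym N) :
    bid 2 p q = (1 / 2 : ℝ) • ∑ j, ∑ k, pderiv k (pderiv j p) * cpd k (cpd j q) := by
  rw [bid_succ]
  simp only [bid_one]
  norm_num

section tens

variable {A : List (Fin N) → Smooth N} (hA : IsSymm A) (B : List (Fin N) → Smooth N)
  (v : Fin N → ℝ)

include hA in
lemma val_bid_one_tens (p q : ℕ) : val v (bid 1 (tens (p + 1) A) (tens q B))
    = ((p : ℝ) + 1) • ∑ j, val v (tens p fun L => A (j :: L))
      * val v (tens q fun L => pd j (B L)) := by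
  simp only [bid_one, map_sum, map_mul, pderiv_tens hA, cpd_tens, val_smul, Finset.smul_sum,
    smul_mul_assoc]

include hA in
lemma val_bid_two_tens (p q : ℕ) : val v (bid 2 (tens (p + 2) A) (tens q B))
    = (((p : ℝ) + 1) * ((p : ℝ) + 2) / 2) • ∑ j, ∑ k, val v (tens p fun L => A (j :: k :: L))
      * val v (tens q fun L => pd j (pd k (B L))) := by
  have h : ∀ j k, pderiv k (pderiv j (tens (p + 2) A))
      = (((p : ℝ) + 1) * ((p : ℝ) + 2)) • tens p fun L => A (j :: k :: L) := fun j k => by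
    rw [pderiv_tens hA, Derivation.map_smul_of_tower, pderiv_tens (hA.cons j), smul_smul]
    push_cast
    ring_nf
  simp only [bid_two, h, map_sum, map_mul, cpd_tens, val_smul, smul_mul_assoc, ← Finset.smul_sum,
    smul_smul]
  simp only [pd_comm]
  congr 1
  ring

end tens

section contractions

variable (u v : Fin N → ℝ)

/-- The contraction of a tensor with the covector `u` in the first index and with `v`
in the other two. -/
def contr12 (F : Fin N → Fin N → Fin N → Smooth N) :
    Smooth N :=
  ctr u fun i =>
    ctr v fun j => ctr v fun k => F i j k

lemma sum_D_expo_contr12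
    (F : Fin N → Fin N → Fin N → Smooth N) :
    ∑ i, ∑ j, ∑ k,
        D [i] (expo u) * F i j k * D [j, k] (expo v)
      = expo u * expo v * contr12 u v F := by
  simp only [D_expo, contr12, ctr, Finset.mul_sum, Finset.smul_sum, List.map_cons, List.map_nil,
    List.prod_cons, List.prod_nil, mul_one]
  repeat refine Finset.sum_congr rfl fun _ _ => ?_
  simp only [Algebra.smul_def, map_mul]
  ring

/-- The contraction of a tensor with the covector `u` in the first index and with `v`
in the other three. -/
def contr13 (F : Fin N → Fin N → Fin N → Fin N → Smooth N) :
    Smooth N :=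
  ctr u fun i =>
    ctr v fun j => ctr v fun k => ctr v fun l => F i j k l

lemma sum_D_expo_contr13
    (F : Fin N → Fin N → Fin N → Fin N → Smooth N) :
    ∑ i, ∑ j, ∑ k, ∑ l,
        D [i] (expo u) * F i j k l * D [j, k, l] (expo v)
      = expo u * expo v * contr13 u v F := by
  simp only [D_expo, contr13, ctr, Finset.mul_sum, Finset.smul_sum, List.map_cons, List.map_nil,
    List.prod_cons, List.prod_nil, mul_one]
  repeat refine Finset.sum_congr rfl fun _ _ => ?_
  simp only [Algebra.smul_def, map_mul]
  ring

/-- The contraction of a tensor with the covector `u` in the first index and with `v`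
in the other four. -/
def contr14 (F : Fin N → Fin N → Fin N → Fin N → Fin N → Smooth N) :
    Smooth N :=
  ctr u fun i =>
    ctr v fun j => ctr v fun k => ctr v fun l => ctr v fun m => F i j k l m

lemma sum_D_expo_contr14
    (F : Fin N → Fin N → Fin N → Fin N → Fin N → Smooth N) :
    ∑ i, ∑ j, ∑ k, ∑ l, ∑ m,
        D [i] (expo u) * F i j k l m * D [j, k, l, m] (expo v)
      = expo u * expo v * contr14 u v F := by
  simp only [D_expo, contr14, ctr, Finset.mul_sum, Finset.smul_sum, List.map_cons, List.map_nil,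
    List.prod_cons, List.prod_nil, mul_one]
  repeat refine Finset.sum_congr rfl fun _ _ => ?_
  simp only [Algebra.smul_def, map_mul]
  ring

/-- The contraction of a tensor with the covector `u` in the first two indices and with `v`
in the other two. -/
def contr22 (F : Fin N → Fin N → Fin N → Fin N → Smooth N) :
    Smooth N :=
  ctr u fun i => ctr u fun m =>
    ctr v fun l => ctr v fun n => F i m l n

lemma contr22_add (F G : Fin N → Fin N → Fin N → Fin N → Smooth N) :
    (contr22 u v fun i m l n => F i m l n + G i m l n)
      = contr22 u v F + contr22 u v G := by
  simp only [contr22, ctr_add]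

lemma contr22_smul (t : ℝ) (F : Fin N → Fin N → Fin N → Fin N → Smooth N) :
    (contr22 u v fun i m l n => t • F i m l n) = t • contr22 u v F := by
  simp only [contr22, ctr_smul]

lemma sum_D_expo_contr22
    (F : Fin N → Fin N → Fin N → Fin N → Smooth N) :
    ∑ i, ∑ m, ∑ l, ∑ n,
        D [i, m] (expo u) * F i m l n * D [l, n] (expo v)
      = expo u * expo v * contr22 u v F := by
  simp only [D_expo, contr22, ctr, Finset.mul_sum, Finset.smul_sum, List.map_cons, List.map_nil,
    List.prod_cons, List.prod_nil, mul_one]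
  repeat refine Finset.sum_congr rfl fun _ _ => ?_
  simp only [Algebra.smul_def, map_mul]
  ring

/-- The contraction of a tensor with the covector `u` in the first two indices and with `v`
in the other three. -/
def contr23 (F : Fin N → Fin N → Fin N → Fin N → Fin N → Smooth N) :
    Smooth N :=
  ctr u fun i => ctr u fun m =>
    ctr v fun k => ctr v fun l => ctr v fun n => F i m k l n

lemma contr23_add (F G : Fin N → Fin N → Fin N → Fin N → Fin N → Smooth N) :
    (contr23 u v fun i m k l n => F i m k l n + G i m k l n)
      = contr23 u v F + contr23 u v G := by
  simp only [contr23, ctr_add]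

lemma contr23_smul (t : ℝ) (F : Fin N → Fin N → Fin N → Fin N → Fin N → Smooth N) :
    (contr23 u v fun i m k l n => t • F i m k l n) = t • contr23 u v F := by
  simp only [contr23, ctr_smul]

lemma sum_D_expo_contr23
    (F : Fin N → Fin N → Fin N → Fin N → Fin N → Smooth N) :
    ∑ i, ∑ m, ∑ k, ∑ l, ∑ n,
        D [i, m] (expo u) * F i m k l n * D [k, l, n] (expo v)
      = expo u * expo v * contr23 u v F := by
  simp only [D_expo, contr23, ctr, Finset.mul_sum, Finset.smul_sum, List.map_cons, List.map_nil,
    List.prod_cons, List.prod_nil, mul_one]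
  repeat refine Finset.sum_congr rfl fun _ _ => ?_
  simp only [Algebra.smul_def, map_mul]
  ring

/-- The contraction of a tensor with the covector `u` in the first two indices and with `v`
in the other four. -/
def contr24 (F : Fin N → Fin N → Fin N → Fin N → Fin N → Fin N → Smooth N) :
    Smooth N :=
  ctr u fun i => ctr u fun m =>
    ctr v fun j => ctr v fun k => ctr v fun l => ctr v fun n => F i m j k l n

lemma contr24_add (F G : Fin N → Fin N → Fin N → Fin N → Fin N → Fin N → Smooth N) :
    (contr24 u v fun i m j k l n => F i m j k l n + G i m j k l n)
      = contr24 u v F + contr24 u v G := by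
  simp only [contr24, ctr_add]

lemma contr24_smul (t : ℝ) (F : Fin N → Fin N → Fin N → Fin N → Fin N → Fin N → Smooth N) :
    (contr24 u v fun i m j k l n => t • F i m j k l n) = t • contr24 u v F := by
  simp only [contr24, ctr_smul]

lemma sum_D_expo_contr24
    (F : Fin N → Fin N → Fin N → Fin N → Fin N → Fin N → Smooth N) :
    ∑ i, ∑ m, ∑ j, ∑ k, ∑ l, ∑ n,
        D [i, m] (expo u) * F i m j k l n * D [j, k, l, n] (expo v)
      = expo u * expo v * contr24 u v F := by
  simp only [D_expo, contr24, ctr, Finset.mul_sum, Finset.smul_sum, List.map_cons, List.map_nil,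
    List.prod_cons, List.prod_nil, mul_one]
  repeat refine Finset.sum_congr rfl fun _ _ => ?_
  simp only [Algebra.smul_def, map_mul]
  ring

/-- The contraction of a tensor with the covector `u` in the first three indices and with `v`
in the other three. -/
def contr33 (F : Fin N → Fin N → Fin N → Fin N → Fin N → Fin N → Smooth N) :
    Smooth N :=
  ctr u fun i => ctr u fun j => ctr u fun m =>
    ctr v fun k => ctr v fun l => ctr v fun n => F i j m k l n

lemma contr33_add (F G : Fin N → Fin N → Fin N → Fin N → Fin N → Fin N → Smooth N) :
    (contr33 u v fun i j m k l n => F i j m k l n + G i j m k l n)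
      = contr33 u v F + contr33 u v G := by
  simp only [contr33, ctr_add]

lemma contr33_smul (t : ℝ) (F : Fin N → Fin N → Fin N → Fin N → Fin N → Fin N → Smooth N) :
    (contr33 u v fun i j m k l n => t • F i j m k l n) = t • contr33 u v F := by
  simp only [contr33, ctr_smul]

lemma sum_D_expo_contr33
    (F : Fin N → Fin N → Fin N → Fin N → Fin N → Fin N → Smooth N) :
    ∑ i, ∑ j, ∑ m, ∑ k, ∑ l, ∑ n,
        D [i, j, m] (expo u) * F i j m k l n * D [k, l, n] (expo v)
      = expo u * expo v * contr33 u v F := by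
  simp only [D_expo, contr33, ctr, Finset.mul_sum, Finset.smul_sum, List.map_cons, List.map_nil,
    List.prod_cons, List.prod_nil, mul_one]
  repeat refine Finset.sum_congr rfl fun _ _ => ?_
  simp only [Algebra.smul_def, map_mul]
  ring

/-- The contraction of a tensor with the covector `u` in the first three indices and with `v`
in the other four. -/
def contr34 (F : Fin N → Fin N → Fin N → Fin N → Fin N → Fin N → Fin N → Smooth N) :
    Smooth N :=
  ctr u fun i => ctr u fun j => ctr u fun m =>
    ctr v fun a => ctr v fun k => ctr v fun l => ctr v fun n => F i j m a k l n

lemma sum_D_expo_contr34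
    (F : Fin N → Fin N → Fin N → Fin N → Fin N → Fin N → Fin N → Smooth N) :
    ∑ i, ∑ j, ∑ m, ∑ a, ∑ k, ∑ l, ∑ n,
        D [i, j, m] (expo u) * F i j m a k l n * D [a, k, l, n] (expo v)
      = expo u * expo v * contr34 u v F := by
  simp only [D_expo, contr34, ctr, Finset.mul_sum, Finset.smul_sum, List.map_cons, List.map_nil,
    List.prod_cons, List.prod_nil, mul_one]
  repeat refine Finset.sum_congr rfl fun _ _ => ?_
  simp only [Algebra.smul_def, map_mul]
  ring

/-- The contraction of a tensor with the covector `u` in the first four indices and with `v`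
in the other four. -/
def contr44 (F : Fin N → Fin N → Fin N → Fin N → Fin N → Fin N → Fin N → Fin N → Smooth N) :
    Smooth N :=
  ctr u fun i => ctr u fun j => ctr u fun m => ctr u fun n =>
    ctr v fun k => ctr v fun l => ctr v fun a => ctr v fun b => F i j m n k l a b

lemma sum_D_expo_contr44
    (F : Fin N → Fin N → Fin N → Fin N → Fin N → Fin N → Fin N → Fin N → Smooth N) :
    ∑ i, ∑ j, ∑ m, ∑ n, ∑ k, ∑ l, ∑ a, ∑ b,
        D [i, j, m, n] (expo u) * F i j m n k l a b * D [k, l, a, b] (expo v)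
      = expo u * expo v * contr44 u v F := by
  simp only [D_expo, contr44, ctr, Finset.mul_sum, Finset.smul_sum, List.map_cons, List.map_nil,
    List.prod_cons, List.prod_nil, mul_one]
  repeat refine Finset.sum_congr rfl fun _ _ => ?_
  simp only [Algebra.smul_def, map_mul]
  ring

/-! The terms of the homogeneous components of the symbols, written with contracted tensors on the
left-hand sides, are contractions of products. The proofs only reorder the sums. -/

lemma contr12_single (A : Fin N → Fin N → Fin N → Smooth N) :
    (ctr v fun j => ctr v fun k => ctr u fun i => A i j k)
      = contr12 u v fun i j k => A i j k := by
  simp only [contr12, ctr, Algebra.smul_def, Finset.mul_sum]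
  simp only [← Fintype.sum_prod_type']
  exact Finset.sum_nbij'
    (fun (j, k, i) => (i, j, k))
    (fun (i, j, k) => (j, k, i)) (fun _ _ => Finset.mem_univ _)
    (fun _ _ => Finset.mem_univ _) (fun _ _ => rfl) (fun _ _ => rfl) fun _ _ => by ring

lemma contr13_single (A : Fin N → Fin N → Fin N → Fin N → Smooth N) :
    (ctr v fun j => ctr v fun k => ctr v fun l => ctr u fun i => A i j k l)
      = contr13 u v fun i j k l => A i j k l := by
  simp only [contr13, ctr, Algebra.smul_def, Finset.mul_sum]
  simp only [← Fintype.sum_prod_type']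
  exact Finset.sum_nbij'
    (fun (j, k, l, i) => (i, j, k, l))
    (fun (i, j, k, l) => (j, k, l, i)) (fun _ _ => Finset.mem_univ _)
    (fun _ _ => Finset.mem_univ _) (fun _ _ => rfl) (fun _ _ => rfl) fun _ _ => by ring

lemma contr14_single (A : Fin N → Fin N → Fin N → Fin N → Fin N → Smooth N) :
    (ctr v fun j => ctr v fun k => ctr v fun l => ctr v fun m => ctr u fun i => A i j k l m)
      = contr14 u v fun i j k l m => A i j k l m := by
  simp only [contr14, ctr, Algebra.smul_def, Finset.mul_sum]
  simp only [← Fintype.sum_prod_type']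
  exact Finset.sum_nbij'
    (fun (j, k, l, m, i) => (i, j, k, l, m))
    (fun (i, j, k, l, m) => (j, k, l, m, i)) (fun _ _ => Finset.mem_univ _)
    (fun _ _ => Finset.mem_univ _) (fun _ _ => rfl) (fun _ _ => rfl) fun _ _ => by ring

lemma contr22_one_one
    (A : Fin N → Fin N → Smooth N) (B : Fin N → Fin N → Smooth N) :
    (ctr v fun l => ctr u fun i => A i l) * (ctr v fun n => ctr u fun m => B m n)
      = contr22 u v fun i m l n => A i l * B m n := by
  simp only [contr22, ctr, Algebra.smul_def, Finset.mul_sum, Finset.sum_mul]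
  simp only [← Fintype.sum_prod_type']
  exact Finset.sum_nbij'
    (fun (n, m, l, i) => (i, m, l, n))
    (fun (i, m, l, n) => (n, m, l, i)) (fun _ _ => Finset.mem_univ _)
    (fun _ _ => Finset.mem_univ _) (fun _ _ => rfl) (fun _ _ => rfl) fun _ _ => by ring

lemma contr22_sum_one_one
    (A : Fin N → Fin N → Fin N → Smooth N)
    (B : Fin N → Fin N → Fin N → Smooth N) :
    ∑ j, (ctr v fun l => ctr u fun i => A i j l) * (ctr v fun n => ctr u fun m => B j m n)
      = contr22 u v fun i m l n => ∑ j, A i j l * B j m n := by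
  simp only [contr22, ctr, Algebra.smul_def, Finset.mul_sum, Finset.sum_mul]
  simp only [← Fintype.sum_prod_type']
  exact Finset.sum_nbij'
    (fun (j, n, m, l, i) => (i, m, l, n, j))
    (fun (i, m, l, n, j) => (j, n, m, l, i)) (fun _ _ => Finset.mem_univ _)
    (fun _ _ => Finset.mem_univ _) (fun _ _ => rfl) (fun _ _ => rfl) fun _ _ => by ring

lemma contr22_sum_zero_two
    (A : Fin N → Fin N → Smooth N)
    (B : Fin N → Fin N → Fin N → Fin N → Smooth N) :
    ∑ j, (ctr u fun i => A i j) * (ctr v fun n => ctr v fun l => ctr u fun m => B j m n l)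
      = contr22 u v fun i m l n => ∑ j, A i j * B j m n l := by
  simp only [contr22, ctr, Algebra.smul_def, Finset.mul_sum, Finset.sum_mul]
  simp only [← Fintype.sum_prod_type']
  exact Finset.sum_nbij'
    (fun (j, n, l, m, i) => (i, m, l, n, j))
    (fun (i, m, l, n, j) => (j, n, l, m, i)) (fun _ _ => Finset.mem_univ _)
    (fun _ _ => Finset.mem_univ _) (fun _ _ => rfl) (fun _ _ => rfl) fun _ _ => by ring

lemma contr22_sum_sum_one_one
    (A : Fin N → Fin N → Fin N → Fin N → Smooth N)
    (B : Fin N → Fin N → Fin N → Fin N → Smooth N) :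
    ∑ j, ∑ k, (ctr v fun l => ctr u fun i => A i j k l)
      * (ctr v fun n => ctr u fun m => B j k m n)
      = contr22 u v fun i m l n => ∑ j, ∑ k, A i j k l * B j k m n := by
  simp only [contr22, ctr, Algebra.smul_def, Finset.mul_sum, Finset.sum_mul]
  simp only [← Fintype.sum_prod_type']
  exact Finset.sum_nbij'
    (fun (j, k, n, m, l, i) => (i, m, l, n, j, k))
    (fun (i, m, l, n, j, k) => (j, k, n, m, l, i)) (fun _ _ => Finset.mem_univ _)
    (fun _ _ => Finset.mem_univ _) (fun _ _ => rfl) (fun _ _ => rfl) fun _ _ => by ring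

lemma contr22_sum_sum_zero_two
    (A : Fin N → Fin N → Fin N → Smooth N)
    (B : Fin N → Fin N → Fin N → Fin N → Fin N → Smooth N) :
    ∑ j, ∑ k, (ctr u fun i => A i j k)
      * (ctr v fun n => ctr v fun l => ctr u fun m => B j k m n l)
      = contr22 u v fun i m l n => ∑ j, ∑ k, A i j k * B j k m n l := by
  simp only [contr22, ctr, Algebra.smul_def, Finset.mul_sum, Finset.sum_mul]
  simp only [← Fintype.sum_prod_type']
  exact Finset.sum_nbij'
    (fun (j, k, n, l, m, i) => (i, m, l, n, j, k))
    (fun (i, m, l, n, j, k) => (j, k, n, l, m, i)) (fun _ _ => Finset.mem_univ _)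
    (fun _ _ => Finset.mem_univ _) (fun _ _ => rfl) (fun _ _ => rfl) fun _ _ => by ring

lemma contr22_single (A : Fin N → Fin N → Fin N → Fin N → Smooth N) :
    (ctr v fun n => ctr v fun l => ctr u fun m => ctr u fun i => A i m n l)
      = contr22 u v fun i m l n => A i m n l := by
  simp only [contr22, ctr, Algebra.smul_def, Finset.mul_sum]
  simp only [← Fintype.sum_prod_type']
  exact Finset.sum_nbij'
    (fun (n, l, m, i) => (i, m, l, n))
    (fun (i, m, l, n) => (n, l, m, i)) (fun _ _ => Finset.mem_univ _)
    (fun _ _ => Finset.mem_univ _) (fun _ _ => rfl) (fun _ _ => rfl) fun _ _ => by ring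

lemma contr23_sum_zero_three
    (A : Fin N → Fin N → Smooth N)
    (B : Fin N → Fin N → Fin N → Fin N → Fin N → Smooth N) :
    ∑ j, (ctr u fun i => A i j)
      * (ctr v fun n => ctr v fun k => ctr v fun l => ctr u fun m => B j m n k l)
      = contr23 u v fun i m k l n => ∑ j, A i j * B j m n k l := by
  simp only [contr23, ctr, Algebra.smul_def, Finset.mul_sum, Finset.sum_mul]
  simp only [← Fintype.sum_prod_type']
  exact Finset.sum_nbij'
    (fun (j, n, k, l, m, i) => (i, m, k, l, n, j))
    (fun (i, m, k, l, n, j) => (j, n, k, l, m, i)) (fun _ _ => Finset.mem_univ _)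
    (fun _ _ => Finset.mem_univ _) (fun _ _ => rfl) (fun _ _ => rfl) fun _ _ => by ring

lemma contr23_one_two
    (A : Fin N → Fin N → Smooth N) (B : Fin N → Fin N → Fin N → Smooth N) :
    (ctr v fun n => ctr u fun m => A m n)
      * (ctr v fun l => ctr v fun k => ctr u fun i => B i l k)
      = contr23 u v fun i m k l n => A m n * B i l k := by
  simp only [contr23, ctr, Algebra.smul_def, Finset.mul_sum, Finset.sum_mul]
  simp only [← Fintype.sum_prod_type']
  exact Finset.sum_nbij'
    (fun (l, k, i, n, m) => (i, m, k, l, n))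
    (fun (i, m, k, l, n) => (l, k, i, n, m)) (fun _ _ => Finset.mem_univ _)
    (fun _ _ => Finset.mem_univ _) (fun _ _ => rfl) (fun _ _ => rfl) fun _ _ => by ring

lemma contr23_sum_two_one
    (A : Fin N → Fin N → Fin N → Fin N → Smooth N)
    (B : Fin N → Fin N → Fin N → Smooth N) :
    ∑ j, (ctr v fun k => ctr v fun l => ctr u fun i => A i j k l)
      * (ctr v fun n => ctr u fun m => B j m n)
      = contr23 u v fun i m k l n => ∑ j, A i j k l * B j m n := by
  simp only [contr23, ctr, Algebra.smul_def, Finset.mul_sum, Finset.sum_mul]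
  simp only [← Fintype.sum_prod_type']
  exact Finset.sum_nbij'
    (fun (j, n, m, k, l, i) => (i, m, k, l, n, j))
    (fun (i, m, k, l, n, j) => (j, n, m, k, l, i)) (fun _ _ => Finset.mem_univ _)
    (fun _ _ => Finset.mem_univ _) (fun _ _ => rfl) (fun _ _ => rfl) fun _ _ => by ring

lemma contr23_sum_one_two
    (A : Fin N → Fin N → Fin N → Smooth N)
    (B : Fin N → Fin N → Fin N → Fin N → Smooth N) :
    ∑ j, (ctr v fun k => ctr u fun i => A i j k)
      * (ctr v fun n => ctr v fun l => ctr u fun m => B j m n l)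
      = contr23 u v fun i m k l n => ∑ j, A i j k * B j m n l := by
  simp only [contr23, ctr, Algebra.smul_def, Finset.mul_sum, Finset.sum_mul]
  simp only [← Fintype.sum_prod_type']
  exact Finset.sum_nbij'
    (fun (j, n, l, m, k, i) => (i, m, k, l, n, j))
    (fun (i, m, k, l, n, j) => (j, n, l, m, k, i)) (fun _ _ => Finset.mem_univ _)
    (fun _ _ => Finset.mem_univ _) (fun _ _ => rfl) (fun _ _ => rfl) fun _ _ => by ring

lemma contr23_single (A : Fin N → Fin N → Fin N → Fin N → Fin N → Smooth N) :
    (ctr v fun k => ctr v fun l => ctr v fun n => ctr u fun m => ctr u fun i => A i m k l n)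
      = contr23 u v fun i m k l n => A i m k l n := by
  simp only [contr23, ctr, Algebra.smul_def, Finset.mul_sum]
  simp only [← Fintype.sum_prod_type']
  exact Finset.sum_nbij'
    (fun (k, l, n, m, i) => (i, m, k, l, n))
    (fun (i, m, k, l, n) => (k, l, n, m, i)) (fun _ _ => Finset.mem_univ _)
    (fun _ _ => Finset.mem_univ _) (fun _ _ => rfl) (fun _ _ => rfl) fun _ _ => by ring

lemma contr24_one_three
    (A : Fin N → Fin N → Smooth N)
    (B : Fin N → Fin N → Fin N → Fin N → Smooth N) :
    (ctr v fun j => ctr u fun i => A i j)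
      * (ctr v fun n => ctr v fun k => ctr v fun l => ctr u fun m => B m n k l)
      = contr24 u v fun i m j k l n => A i j * B m n k l := by
  simp only [contr24, ctr, Algebra.smul_def, Finset.mul_sum, Finset.sum_mul]
  simp only [← Fintype.sum_prod_type']
  exact Finset.sum_nbij'
    (fun (n, k, l, m, j, i) => (i, m, j, k, l, n))
    (fun (i, m, j, k, l, n) => (n, k, l, m, j, i)) (fun _ _ => Finset.mem_univ _)
    (fun _ _ => Finset.mem_univ _) (fun _ _ => rfl) (fun _ _ => rfl) fun _ _ => by ring

lemma contr24_two_two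
    (A : Fin N → Fin N → Fin N → Smooth N)
    (B : Fin N → Fin N → Fin N → Smooth N) :
    (ctr v fun j => ctr v fun k => ctr u fun i => A i j k)
      * (ctr v fun n => ctr v fun l => ctr u fun m => B m n l)
      = contr24 u v fun i m j k l n => A i j k * B m n l := by
  simp only [contr24, ctr, Algebra.smul_def, Finset.mul_sum, Finset.sum_mul]
  simp only [← Fintype.sum_prod_type']
  exact Finset.sum_nbij'
    (fun (n, l, m, j, k, i) => (i, m, j, k, l, n))
    (fun (i, m, j, k, l, n) => (n, l, m, j, k, i)) (fun _ _ => Finset.mem_univ _)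
    (fun _ _ => Finset.mem_univ _) (fun _ _ => rfl) (fun _ _ => rfl) fun _ _ => by ring

lemma contr33_sum_zero_one_two
    (A : Fin N → Fin N → Smooth N) (B : Fin N → Fin N → Fin N → Smooth N)
    (C : Fin N → Fin N → Fin N → Smooth N) :
    ∑ a, (ctr u fun i => A i a) * (ctr v fun k => ctr u fun j => B a j k)
      * (ctr v fun n => ctr v fun l => ctr u fun m => C m n l)
      = contr33 u v fun i j m k l n => ∑ a, A i a * B a j k * C m n l := by
  simp only [contr33, ctr, Algebra.smul_def, Finset.mul_sum, Finset.sum_mul]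
  simp only [← Fintype.sum_prod_type']
  exact Finset.sum_nbij'
    (fun (a, n, l, m, k, j, i) => (i, j, m, k, l, n, a))
    (fun (i, j, m, k, l, n, a) => (a, n, l, m, k, j, i)) (fun _ _ => Finset.mem_univ _)
    (fun _ _ => Finset.mem_univ _) (fun _ _ => rfl) (fun _ _ => rfl) fun _ _ => by ring

lemma contr33_sum_zero_one_two' 
    (A : Fin N → Fin N → Smooth N) (B : Fin N → Fin N → Smooth N)
    (C : Fin N → Fin N → Fin N → Fin N → Smooth N) :
    ∑ a, (ctr u fun i => A i a) * (ctr v fun k => ctr u fun j => B j k)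
      * (ctr v fun n => ctr v fun l => ctr u fun m => C a m n l)
      = contr33 u v fun i j m k l n => ∑ a, A i a * B j k * C a m n l := by
  simp only [contr33, ctr, Algebra.smul_def, Finset.mul_sum, Finset.sum_mul]
  simp only [← Fintype.sum_prod_type']
  exact Finset.sum_nbij'
    (fun (a, n, l, m, k, j, i) => (i, j, m, k, l, n, a))
    (fun (i, j, m, k, l, n, a) => (a, n, l, m, k, j, i)) (fun _ _ => Finset.mem_univ _)
    (fun _ _ => Finset.mem_univ _) (fun _ _ => rfl) (fun _ _ => rfl) fun _ _ => by ring

lemma contr33_sum_one_one_one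
    (A : Fin N → Fin N → Smooth N) (B : Fin N → Fin N → Fin N → Smooth N)
    (C : Fin N → Fin N → Fin N → Smooth N) :
    ∑ a, (ctr v fun k => ctr u fun i => A i k) * (ctr v fun l => ctr u fun j => B a j l)
      * (ctr v fun n => ctr u fun m => C a m n)
      = contr33 u v fun i j m k l n => ∑ a, A i k * B a j l * C a m n := by
  simp only [contr33, ctr, Algebra.smul_def, Finset.mul_sum, Finset.sum_mul]
  simp only [← Fintype.sum_prod_type']
  exact Finset.sum_nbij'
    (fun (a, n, m, l, j, k, i) => (i, j, m, k, l, n, a))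
    (fun (i, j, m, k, l, n, a) => (a, n, m, l, j, k, i)) (fun _ _ => Finset.mem_univ _)
    (fun _ _ => Finset.mem_univ _) (fun _ _ => rfl) (fun _ _ => rfl) fun _ _ => by ring

lemma contr33_two_one
    (A : Fin N → Fin N → Fin N → Smooth N)
    (B : Fin N → Fin N → Fin N → Smooth N) :
    (ctr v fun n => ctr v fun l => ctr u fun m => A m n l)
      * (ctr v fun k => ctr u fun j => ctr u fun i => B i j k)
      = contr33 u v fun i j m k l n => A m n l * B i j k := by
  simp only [contr33, ctr, Algebra.smul_def, Finset.mul_sum, Finset.sum_mul]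
  simp only [← Fintype.sum_prod_type']
  exact Finset.sum_nbij'
    (fun (k, j, i, n, l, m) => (i, j, m, k, l, n))
    (fun (i, j, m, k, l, n) => (k, j, i, n, l, m)) (fun _ _ => Finset.mem_univ _)
    (fun _ _ => Finset.mem_univ _) (fun _ _ => rfl) (fun _ _ => rfl) fun _ _ => by ring

lemma contr33_one_two
    (A : Fin N → Fin N → Smooth N)
    (B : Fin N → Fin N → Fin N → Fin N → Smooth N) :
    (ctr v fun n => ctr u fun m => A m n)
      * (ctr v fun k => ctr v fun l => ctr u fun j => ctr u fun i => B i j k l)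
      = contr33 u v fun i j m k l n => A m n * B i j k l := by
  simp only [contr33, ctr, Algebra.smul_def, Finset.mul_sum, Finset.sum_mul]
  simp only [← Fintype.sum_prod_type']
  exact Finset.sum_nbij'
    (fun (k, l, j, i, n, m) => (i, j, m, k, l, n))
    (fun (i, j, m, k, l, n) => (k, l, j, i, n, m)) (fun _ _ => Finset.mem_univ _)
    (fun _ _ => Finset.mem_univ _) (fun _ _ => rfl) (fun _ _ => rfl) fun _ _ => by ring

lemma contr34_one_one_two
    (A : Fin N → Fin N → Smooth N) (B : Fin N → Fin N → Smooth N)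
    (C : Fin N → Fin N → Fin N → Smooth N) :
    (ctr v fun a => ctr u fun i => A i a) * (ctr v fun k => ctr u fun j => B j k)
      * (ctr v fun n => ctr v fun l => ctr u fun m => C m n l)
      = contr34 u v fun i j m a k l n => A i a * B j k * C m n l := by
  simp only [contr34, ctr, Algebra.smul_def, Finset.mul_sum, Finset.sum_mul]
  simp only [← Fintype.sum_prod_type']
  exact Finset.sum_nbij'
    (fun (n, l, m, k, j, a, i) => (i, j, m, a, k, l, n))
    (fun (i, j, m, a, k, l, n) => (n, l, m, k, j, a, i)) (fun _ _ => Finset.mem_univ _)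
    (fun _ _ => Finset.mem_univ _) (fun _ _ => rfl) (fun _ _ => rfl) fun _ _ => by ring

lemma contr44_one_one_one_one
    (A : Fin N → Fin N → Smooth N) (B : Fin N → Fin N → Smooth N)
    (C : Fin N → Fin N → Smooth N) (E : Fin N → Fin N → Smooth N) :
    (ctr v fun k => ctr u fun i => A i k) * (ctr v fun l => ctr u fun j => B j l)
      * (ctr v fun a => ctr u fun m => C m a) * (ctr v fun b => ctr u fun n => E n b)
      = contr44 u v fun i j m n k l a b => A i k * B j l * C m a * E n b := by
  simp only [contr44, ctr, Algebra.smul_def, Finset.mul_sum, Finset.sum_mul]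
  simp only [← Fintype.sum_prod_type']
  exact Finset.sum_nbij'
    (fun (b, n, a, m, l, j, k, i) => (i, j, m, n, k, l, a, b))
    (fun (i, j, m, n, k, l, a, b) => (b, n, a, m, l, j, k, i)) (fun _ _ => Finset.mem_univ _)
    (fun _ _ => Finset.mem_univ _) (fun _ _ => rfl) (fun _ _ => rfl) fun _ _ => by ring

end contractions

/-! ### The homogeneous parts of the bisymbol

The hypothesis `hq` says that `G k` are the coefficient functions of the deformed coordinates: the
component of degree `d + 1` of the symbol of order `k + d + 1` has the coefficients `G k`. -/

section formulas

variable {X : Fin N → FormalOp N} (hX : IsDeformed X) (hg : IsParityGraded X)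
  {G : ℕ → Fin N → List (Fin N) → Smooth N} (hG : ∀ k i, IsSymm (G k i))
  (hq : ∀ u k d, k + d + 1 ≤ 4 → qh X u (k + d + 1) (d + 1) = tens (d + 1) (con u (G k)))
  (u v : Fin N → ℝ)

include hg hq in
lemma qs_one_eq : qs X u 1 = tens 1 (con u (G 0)) := by
  rw [← hq u 0 0 (by norm_num), qh, homogeneousComponent_of_mem (qs_one_isHomogeneous hg u),
    if_pos rfl]

include hg hq in
lemma qs_two_eq : qs X u 2 = tens 2 (con u (G 0)) := by
  rw [← hq u 0 1 (by norm_num), qh, homogeneousComponent_of_mem (qs_two_isHomogeneous hg u),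
    if_pos rfl]

include hX hg hG hq in
lemma bisymbol_two_two : bisymbol X u v 2 2 = contr22 u v fun i m l n =>
    (∑ j, G 1 i [j, l] * pd j (G 0 m [n]))
      + (3 / 2 : ℝ) • (∑ j, ∑ k, G 0 i [j, k, l] * pd j (pd k (G 0 m [n])))
      + (1 / 2 : ℝ) • (∑ j, G 0 i [j] * pd j (G 1 m [n, l]))
      + (1 / 2 : ℝ) • (∑ j, ∑ k, G 0 i [j, k] * pd j (pd k (G 0 m [n, l])))
      + (3 / 2 : ℝ) • G 1 i [m, n, l] + G 0 i [l] * G 2 m [n] := by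
  have e1 := contr22_one_one u v (fun i l => G 0 i [l]) (fun m n => G 2 m [n])
  have e2 := contr22_sum_one_one u v (fun i j l => G 1 i [j, l]) (fun j m n => pd j (G 0 m [n]))
  have e3 := contr22_sum_zero_two u v (fun i j => G 0 i [j]) (fun j m n l => pd j (G 1 m [n, l]))
  have e4 := contr22_sum_sum_one_one u v (fun i j k l => G 0 i [j, k, l])
    (fun j k m n => pd j (pd k (G 0 m [n])))
  have e5 := contr22_sum_sum_zero_two u v (fun i j k => G 0 i [j, k])
    (fun j k m n l => pd j (pd k (G 0 m [n, l])))
  have e6 := contr22_single u v (fun i m n l => G 1 i [m, n, l])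
  have s := fun k => isSymm_ctr (hG k) u
  rw [bisymbol, (component_cs_two_four hX hg u).2.2, qs_one_eq hg hq, qs_two_eq hg hq,
    hq u 2 0 (by norm_num), hq u 1 1 (by norm_num), hq u 0 2 (by norm_num), hq u 1 2 (by norm_num)]
  simp only [map_add, val_smul, map_mul, val_bid_one_tens (s _), val_bid_two_tens (s _),
    dirD_tens (s _), val_tens_succ, val_tens_zero, pd_ctr, e1, e2, e3, e4, e5, e6,
    contr22_add, contr22_smul]
  norm_num [Nat.factorial]
  module

include hX hg hG hq in
lemma bisymbol_two_three : bisymbol X u v 2 3 = contr23 u v fun i m k l n =>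
    (1 / 2 : ℝ) • (∑ j, G 0 i [j] * pd j (G 0 m [n, k, l])) + G 1 i [l, k] * G 0 m [n]
      + (3 / 2 : ℝ) • (∑ j, G 0 i [j, k, l] * pd j (G 0 m [n]))
      + (∑ j, G 0 i [j, k] * pd j (G 0 m [n, l])) + (2 : ℝ) • G 0 i [m, k, l, n] := by
  have e1 := contr23_sum_zero_three u v (fun i j => G 0 i [j]) (fun j m n k l => pd j (G 0 m [n, k, l]))
  have e2 := contr23_one_two u v (fun m n => G 0 m [n]) (fun i l k => G 1 i [l, k])
  have e3 := contr23_sum_two_one u v (fun i j k l => G 0 i [j, k, l]) (fun j m n => pd j (G 0 m [n]))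
  have e4 := contr23_sum_one_two u v (fun i j k => G 0 i [j, k]) (fun j m n l => pd j (G 0 m [n, l]))
  have e5 := contr23_single u v (fun i m k l n => G 0 i [m, k, l, n])
  have s := fun k => isSymm_ctr (hG k) u
  rw [bisymbol, (component_cs_two_four hX hg u).2.1, qs_one_eq hg hq, qs_two_eq hg hq,
    hq u 1 1 (by norm_num), hq u 0 2 (by norm_num), hq u 0 3 (by norm_num)]
  simp only [map_add, val_smul, map_mul, val_bid_one_tens (s _), dirD_tens (s _), val_tens_succ,
    val_tens_zero, pd_ctr, e1, e2, e3, e4, e5, contr23_add, contr23_smul, mul_comm (G 1 _ _)]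
  norm_num [Nat.factorial]
  module

include hX hg hq in
lemma bisymbol_two_four : bisymbol X u v 2 4 = contr24 u v fun i m j k l n =>
    G 0 i [j] * G 0 m [n, k, l] + (1 / 2 : ℝ) • (G 0 i [j, k] * G 0 m [n, l]) := by
  have e1 := contr24_one_three u v (fun i j => G 0 i [j]) (fun m n k l => G 0 m [n, k, l])
  have e2 := contr24_two_two u v (fun i j k => G 0 i [j, k]) (fun m n l => G 0 m [n, l])
  rw [bisymbol, (component_cs_two_four hX hg u).1, qs_one_eq hg hq, qs_two_eq hg hq,
    hq u 0 2 (by norm_num)]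
  simp only [map_add, val_smul, map_mul, val_tens_succ, val_tens_zero, e1, e2, contr24_add,
    contr24_smul]
  norm_num [Nat.factorial]
  module

include hX hg hG hq in
lemma bisymbol_three_three : bisymbol X u v 3 3 = contr33 u v fun i j m k l n =>
    (1 / 2 : ℝ) • (∑ a, G 0 i [a] * pd a (G 0 j [k]) * G 0 m [n, l])
      + (1 / 2 : ℝ) • (∑ a, G 0 i [a] * G 0 j [k] * pd a (G 0 m [n, l]))
      + (∑ a, G 0 i [k] * G 0 j [a, l] * pd a (G 0 m [n])) + G 0 m [n, l] * G 0 i [j, k]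
      + (3 / 2 : ℝ) • (G 0 m [n] * G 0 i [j, k, l]) := by
  have e1 := contr33_sum_zero_one_two u v (fun i a => G 0 i [a]) (fun a j k => pd a (G 0 j [k]))
    (fun m n l => G 0 m [n, l])
  have e2 := contr33_sum_zero_one_two' u v (fun i a => G 0 i [a]) (fun j k => G 0 j [k])
    (fun a m n l => pd a (G 0 m [n, l]))
  have e3 := contr33_sum_one_one_one u v (fun i k => G 0 i [k]) (fun a j l => G 0 j [a, l])
    (fun a m n => pd a (G 0 m [n]))
  have e4 := contr33_two_one u v (fun m n l => G 0 m [n, l]) (fun i j k => G 0 i [j, k])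
  have e5 := contr33_one_two u v (fun m n => G 0 m [n]) (fun i j k l => G 0 i [j, k, l])
  have s := fun k => isSymm_ctr (hG k) u
  rw [bisymbol, (component_cs_three_four hX hg u).2, qs_one_eq hg hq, qs_two_eq hg hq,
    hq u 0 2 (by norm_num)]
  simp only [contr33_add, contr33_smul, ← e1, ← e2, ← e3, ← e4, ← e5]
  simp only [map_add, val_smul, map_mul, val_bid_one_tens (s _), dirD_tens (s _), val_tens_succ,
    val_tens_zero, pd_ctr, con, mul_smul_comm, Finset.mul_sum]
  norm_num [Nat.factorial]
  simp only [mul_assoc, mul_comm, mul_left_comm]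
  module

include hX hg hq in
lemma bisymbol_three_four : bisymbol X u v 3 4 = (1 / 2 : ℝ) • contr34 u v fun i j m a k l n =>
    G 0 i [a] * G 0 j [k] * G 0 m [n, l] := by
  rw [bisymbol, (component_cs_three_four hX hg u).1, qs_one_eq hg hq, qs_two_eq hg hq,
    ← contr34_one_one_two u v (fun i a => G 0 i [a]) (fun j k => G 0 j [k]) (fun m n l => G 0 m [n, l])]
  simp only [val_smul, map_mul, val_tens_succ, val_tens_zero, sq, smul_smul]
  norm_num [Nat.factorial]

include hX hg hq in
lemma bisymbol_four_four : bisymbol X u v 4 4 = (1 / 24 : ℝ) • contr44 u v fun i j m n k l a b =>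
    G 0 i [k] * G 0 j [l] * G 0 m [a] * G 0 n [b] := by
  rw [bisymbol, component_cs_four_four hX hg u, qs_one_eq hg hq,
    ← contr44_one_one_one_one u v (fun i k => G 0 i [k]) (fun j l => G 0 j [l])
      (fun m a => G 0 m [a]) (fun n b => G 0 n [b])]
  simp only [map_mul, val_tens_succ, val_tens_zero, pow_succ, pow_zero, one_mul]
  norm_num [Nat.factorial]

include hq in
lemma bisymbol_one_two : bisymbol X u v 1 2 = contr12 u v fun i j k => G 2 i [j, k] := by
  rw [bisymbol, cs_one u four_ne_zero, ← qh, hq u 2 1 (by norm_num),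
    ← contr12_single u v (fun i j k => G 2 i [j, k])]
  simp [val_tens_succ, val_tens_zero]

include hq in
lemma bisymbol_one_three : bisymbol X u v 1 3 = contr13 u v fun i j k l => G 1 i [j, k, l] := by
  rw [bisymbol, cs_one u four_ne_zero, ← qh, hq u 1 2 (by norm_num),
    ← contr13_single u v (fun i j k l => G 1 i [j, k, l])]
  simp [val_tens_succ, val_tens_zero]

include hq in
lemma bisymbol_one_four : bisymbol X u v 1 4 = contr14 u v fun i j k l m => G 0 i [j, k, l, m] := by
  rw [bisymbol, cs_one u four_ne_zero, ← qh, hq u 0 3 (by norm_num),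
    ← contr14_single u v (fun i j k l m => G 0 i [j, k, l, m])]
  simp [val_tens_succ, val_tens_zero]

include hg in
lemma bisymbol_one_one : bisymbol X u v 1 1 = 0 := by
  rw [bisymbol, cs_one u four_ne_zero, ← qh, qh_four_one hg, map_zero, smul_zero]

end formulas

/-! ### The fourth order of the star product -/

section fourth

variable {ω₀ ω₂ : Fin N → Fin N → Smooth N} (h₀ : ∀ i j, ω₀ i j = -ω₀ j i)
  (h₂ : ∀ i j, ω₂ i j = -ω₂ j i)

include h₀ h₂ in
lemma isSymm_Γ (k : ℕ) (i : Fin N) : IsSymm (Γ ω₀ ω₂ k i) :=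
  isSymm_Gam (correctedOmega_skew h₀ h₂) k i

include h₀ h₂ in
/-- The functions `Γ` are the coefficients of the deformed coordinates of fourth order. -/
lemma homogeneousComponent_ys_four {k d : ℕ} (h : k + d + 1 ≤ 4) (i : Fin N) :
    homogeneousComponent (d + 1) (ys (xhat (correctedOmega ω₀ ω₂) 4) (k + d + 1) i)
      = tens (d + 1) (Γ ω₀ ω₂ k i) :=
  homogeneousComponent_ys (correctedOmega_skew h₀ h₂) h i

include h₀ h₂ in
lemma qh_eq_tens (u : Fin N → ℝ) (k d : ℕ) (h : k + d + 1 ≤ 4) :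
    qh (xhat (correctedOmega ω₀ ω₂) 4) u (k + d + 1) (d + 1)
      = tens (d + 1) (con u (Γ ω₀ ω₂ k)) := by
  rw [qh, qs, map_sum]
  simp only [homogeneousComponent_smul_real, homogeneousComponent_ys_four h₀ h₂ h, smul_tens, sum_tens]
  rfl

include h₀ h₂ in
lemma Γ_singleton_eq {η : Fin N → Fin N → Smooth N} {k : ℕ} (hk : k + 1 ≤ 4) {i : Fin N}
    (h : homogeneousComponent 1 (ys (xhat (correctedOmega ω₀ ω₂) 4) (k + 1) i) = hamSym η i)
    (j : Fin N) : Γ ω₀ ω₂ k i [j] = η i j := by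
  have h1 := congrArg (pderiv j) ((homogeneousComponent_ys_four h₀ h₂ (d := 0) hk i).symm.trans h)
  rw [pderiv_tens (isSymm_Γ h₀ h₂ k i), pderiv_hamSym, Nat.cast_zero, zero_add, one_smul,
    tens_zero] at h1
  exact C_injective _ _ h1

include h₀ h₂ in
lemma Γ_zero_singleton (i j : Fin N) : Γ ω₀ ω₂ 0 i [j] = ω₀ i j := by
  refine Γ_singleton_eq h₀ h₂ (by norm_num) ?_ j
  rw [ys_one h₀ h₂ (by norm_num), homogeneousComponent_of_mem (hamSym_isHomogeneous i), if_pos rfl]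

include h₀ h₂ in
lemma Γ_two_singleton (i j : Fin N) : Γ ω₀ ω₂ 2 i [j] = ω₂ i j := by
  refine Γ_singleton_eq h₀ h₂ (by norm_num) ?_ j
  have a1 : (∑ l, ∑ m, hamSym ω₀ m * hamSym ω₀ l * cpd l (cpd m (hamSym ω₀ i))).IsHomogeneous 3 :=
    IsHomogeneous.sum _ _ _ fun l _ => IsHomogeneous.sum _ _ _ fun m _ =>
      ((hamSym_isHomogeneous m).mul (hamSym_isHomogeneous l)).mul
        (cpd_isHomogeneous (cpd_isHomogeneous (hamSym_isHomogeneous i) m) l)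
  have a3 : ∀ m l, (∑ r, C (ω₀ m r) * cpd r (hamSym ω₀ l)).IsHomogeneous 1 := fun m l =>
    IsHomogeneous.sum _ _ _ fun r _ => by
      simpa only [zero_add] using
        (isHomogeneous_C (Fin N) (ω₀ m r)).mul (cpd_isHomogeneous (hamSym_isHomogeneous l) r)
  have a2 : (∑ l, ∑ m, cpd l (cpd m (hamSym ω₀ i)) *
      ∑ r, C (ω₀ m r) * cpd r (hamSym ω₀ l)).IsHomogeneous 2 :=
    IsHomogeneous.sum _ _ _ fun l _ => IsHomogeneous.sum _ _ _ fun m _ =>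
      (cpd_isHomogeneous (cpd_isHomogeneous (hamSym_isHomogeneous i) m) l).mul
        (a3 m l)
  rw [ys_three h₀ h₂ (by norm_num), map_add, map_add, homogeneousComponent_smul_real,
    homogeneousComponent_smul_real, homogeneousComponent_of_mem a1, homogeneousComponent_of_mem a2,
    homogeneousComponent_of_mem (hamSym_isHomogeneous i), if_neg (by norm_num),
    if_neg (by norm_num), if_pos rfl, smul_zero, smul_zero, zero_add, zero_add]

include h₀ h₂ in
/-- There are no vector fields in the order `α⁴` of the deformed coordinates, because the
`α³`-coefficient of `ω` vanishes. -/
lemma Γ_three_singleton (i j : Fin N) : Γ ω₀ ω₂ 3 i [j] = 0 := by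
  have hω := correctedOmega_skew h₀ h₂
  have hX := isDeformed_xhat hω 3
  have hmul : ∀ a b, PowerSeries.coeff 4 (xhat (correctedOmega ω₀ ω₂) 3 a *
      xhat (correctedOmega ω₀ ω₂) 3 b) 1 = 0 := by
    intro a b
    rw [PowerSeries.coeff_mul, LinearMap.sum_apply]
    refine Finset.sum_eq_zero fun x hx => ?_
    rw [HasAntidiagonal.mem_antidiagonal] at hx
    rw [Module.End.mul_apply]
    rcases eq_or_ne x.2 0 with h | h
    · rw [coeff_xhat_of_lt _ (by omega), LinearMap.zero_apply]
    · rw [hX.one b _ h, map_zero]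
  -- the coordinates annihilate constants, so the function part of the defect is `2 α ω` in the order `α⁴`
  have hd : defect (correctedOmega ω₀ ω₂) 3 (xhat (correctedOmega ω₀ ω₂) 3) i j 1 = 0 := by
    rw [defect, map_sub, map_sub, coeff_two_X_mul, if_neg (by norm_num), LinearMap.sub_apply,
      LinearMap.sub_apply, hmul, hmul, sub_zero, sub_zero, LinearMap.smul_apply,
      Nat.add_sub_cancel, coeff_weylSeries_apply_one hX, correctedOmega_even _ _ _ _ _ (by decide),
      smul_zero]
  have : Γ ω₀ ω₂ 3 i [j] = gammaOf (defect (correctedOmega ω₀ ω₂) 3 (xhat (correctedOmega ω₀ ω₂) 3))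
    i [j] := rfl
  rw [this, gammaOf]
  simp [symCoeff, bracketCoord, hd]

include h₀ h₂ in
lemma isParityGraded_xhat_four : IsParityGraded (xhat (correctedOmega ω₀ ω₂) 4) where
  one i := by rw [ys_one h₀ h₂ (by norm_num)]; exact hamSym_isHomogeneous i
  two i := by
    rw [ys_two h₀ h₂ (by norm_num)]
    exact smul_isHomogeneous (IsHomogeneous.sum _ _ _ fun l _ =>
      (hamSym_isHomogeneous l).mul (cpd_isHomogeneous (hamSym_isHomogeneous i) l)) _
  four i := by
    rw [show (4 : ℕ) = 3 + 0 + 1 from rfl, show (1 : ℕ) = 0 + 1 from rfl,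
      homogeneousComponent_ys_four h₀ h₂ (by norm_num), tens_congr (B := fun _ => 0), tens]
    · simp
    · intro L hL
      obtain ⟨j, rfl⟩ := List.length_eq_one_iff.mp hL
      exact Γ_three_singleton h₀ h₂ i j

section bidiff

lemma isBidiff_L12 : IsBidiff (L12 ω₀ ω₂) :=
  .sum _ fun _ => .sum _ fun _ => .sum _ fun _ => .D_mul_D _ _ _

lemma isBidiff_L13 : IsBidiff (L13 ω₀ ω₂) :=
  .sum _ fun _ => .sum _ fun _ => .sum _ fun _ => .sum _ fun _ => .D_mul_D _ _ _

lemma isBidiff_L14 : IsBidiff (L14 ω₀ ω₂) :=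
  .sum _ fun _ => .sum _ fun _ => .sum _ fun _ => .sum _ fun _ => .sum _ fun _ => .D_mul_D _ _ _

lemma isBidiff_L22 : IsBidiff (L22 ω₀ ω₂) :=
  .sum _ fun _ => .sum _ fun _ => .sum _ fun _ => .sum _ fun _ => .D_mul_D _ _ _

lemma isBidiff_L23 : IsBidiff (L23 ω₀ ω₂) :=
  .sum _ fun _ => .sum _ fun _ => .sum _ fun _ => .sum _ fun _ => .sum _ fun _ => .D_mul_D _ _ _

lemma isBidiff_L24 : IsBidiff (L24 ω₀ ω₂) :=
  .sum _ fun _ => .sum _ fun _ => .sum _ fun _ => .sum _ fun _ => .sum _ fun _ => .sum _ fun _ =>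
    .D_mul_D _ _ _

lemma isBidiff_L33 : IsBidiff (L33 ω₀ ω₂) :=
  .sum _ fun _ => .sum _ fun _ => .sum _ fun _ => .sum _ fun _ => .sum _ fun _ => .sum _ fun _ =>
    .D_mul_D _ _ _

lemma isBidiff_L34 : IsBidiff (L34 ω₀ ω₂) :=
  .smul _ <| .sum _ fun _ => .sum _ fun _ => .sum _ fun _ => .sum _ fun _ => .sum _ fun _ =>
    .sum _ fun _ => .sum _ fun _ => .D_mul_D _ _ _

lemma isBidiff_L44 : IsBidiff (L44 ω₀) :=
  .smul _ <| .sum _ fun _ => .sum _ fun _ => .sum _ fun _ => .sum _ fun _ => .sum _ fun _ =>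
    .sum _ fun _ => .sum _ fun _ => .sum _ fun _ => .D_mul_D _ _ _

end bidiff

lemma cases_of_le_four {m n : ℕ} (hm : 1 ≤ m) (hmn : m ≤ n) (hn : n ≤ 4) :
    m = 1 ∧ n = 1 ∨ m = 1 ∧ n = 2 ∨ m = 1 ∧ n = 3 ∨ m = 1 ∧ n = 4 ∨ m = 2 ∧ n = 2 ∨
      m = 2 ∧ n = 3 ∨ m = 2 ∧ n = 4 ∨ m = 3 ∧ n = 3 ∨ m = 3 ∧ n = 4 ∨ m = 4 ∧ n = 4 := by
  omega

lemma L_zero_left (n : ℕ) (f g : Smooth N) : L ω₀ ω₂ 0 n f g = 0 := rfl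

lemma L_zero_right (m : ℕ) (f g : Smooth N) : L ω₀ ω₂ m 0 f g = 0 := by
  rcases m with _ | _ | _ | _ | _ | m <;> rfl

lemma L_eq_zero_left {m : ℕ} (hm : 5 ≤ m) (n : ℕ) (f g : Smooth N) : L ω₀ ω₂ m n f g = 0 := by
  obtain ⟨m, rfl⟩ := Nat.exists_eq_add_of_le' hm
  rfl

lemma L_eq_zero_right (m : ℕ) {n : ℕ} (hn : 5 ≤ n) (f g : Smooth N) : L ω₀ ω₂ m n f g = 0 := by
  obtain ⟨n, rfl⟩ := Nat.exists_eq_add_of_le' hn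
  rcases m with _ | _ | _ | _ | _ | m <;> rfl

lemma L_swap {m n : ℕ} (h : m < n) (f g : Smooth N) : L ω₀ ω₂ n m f g = L ω₀ ω₂ m n g f := by
  rcases Nat.eq_zero_or_pos m with rfl | hm
  · rw [L_zero_left, L_zero_right]
  rcases le_or_gt 5 n with hn | hn
  · rw [L_eq_zero_left hn, L_eq_zero_right _ hn]
  rcases cases_of_le_four hm h.le (by omega) with ⟨rfl, rfl⟩ | ⟨rfl, rfl⟩ | ⟨rfl, rfl⟩ | ⟨rfl, rfl⟩ |
    ⟨rfl, rfl⟩ | ⟨rfl, rfl⟩ | ⟨rfl, rfl⟩ | ⟨rfl, rfl⟩ | ⟨rfl, rfl⟩ | ⟨rfl, rfl⟩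
  · exact absurd h (lt_irrefl _)
  · rfl
  · rfl
  · rfl
  · exact absurd h (lt_irrefl _)
  · rfl
  · rfl
  · exact absurd h (lt_irrefl _)
  · rfl
  · exact absurd h (lt_irrefl _)

lemma isBidiff_L (m n : ℕ) : IsBidiff (L ω₀ ω₂ m n) := by
  have key : ∀ m n, m ≤ n → IsBidiff (L ω₀ ω₂ m n) := by
    intro m n hmn
    rcases Nat.eq_zero_or_pos m with rfl | hm
    · exact .zero
    rcases le_or_gt 5 n with hn | hn
    · rw [show L ω₀ ω₂ m n = fun _ _ => 0 from
        funext fun f => funext fun g => L_eq_zero_right m hn f g]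
      exact .zero
    rcases cases_of_le_four hm hmn (by omega) with ⟨rfl, rfl⟩ | ⟨rfl, rfl⟩ | ⟨rfl, rfl⟩ | ⟨rfl, rfl⟩ |
      ⟨rfl, rfl⟩ | ⟨rfl, rfl⟩ | ⟨rfl, rfl⟩ | ⟨rfl, rfl⟩ | ⟨rfl, rfl⟩ | ⟨rfl, rfl⟩
    · exact .zero
    · exact isBidiff_L12
    · exact isBidiff_L13
    · exact isBidiff_L14
    · exact isBidiff_L22
    · exact isBidiff_L23
    · exact isBidiff_L24
    · exact isBidiff_L33
    · exact isBidiff_L34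
    · exact isBidiff_L44
  rcases le_or_gt m n with h | h
  · exact key m n h
  · rw [show L ω₀ ω₂ m n = fun f g => L ω₀ ω₂ n m g f from
      funext fun f => funext fun g => L_swap h f g]
    exact (key n m h.le).swap

/-- The terms `L_{m,n}`, evaluated on exponential functions, are the homogeneous parts of the
bisymbol. -/
lemma L_expo_of_le (h₀ : ∀ i j, ω₀ i j = -ω₀ j i) (h₂ : ∀ i j, ω₂ i j = -ω₂ j i)
    (u v : Fin N → ℝ) {m n : ℕ} (hm : 1 ≤ m) (hmn : m ≤ n) (hn : n ≤ 4) :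
    L ω₀ ω₂ m n (expo u) (expo v)
      = expo u * expo v * bisymbol (xhat (correctedOmega ω₀ ω₂) 4) u v m n := by
  have hX := isDeformed_xhat (correctedOmega_skew h₀ h₂) 4
  have hg := isParityGraded_xhat_four h₀ h₂
  have hG := isSymm_Γ h₀ h₂
  have hq := qh_eq_tens h₀ h₂
  rcases cases_of_le_four hm hmn hn with ⟨rfl, rfl⟩ | ⟨rfl, rfl⟩ | ⟨rfl, rfl⟩ | ⟨rfl, rfl⟩ | ⟨rfl, rfl⟩ | ⟨rfl, rfl⟩ |
    ⟨rfl, rfl⟩ | ⟨rfl, rfl⟩ | ⟨rfl, rfl⟩ | ⟨rfl, rfl⟩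
  · rw [bisymbol_one_one hg, mul_zero]; rfl
  · rw [bisymbol_one_two hq, ← sum_D_expo_contr12]; rfl
  · rw [bisymbol_one_three hq, ← sum_D_expo_contr13]; rfl
  · rw [bisymbol_one_four hq, ← sum_D_expo_contr14]; rfl
  · rw [bisymbol_two_two hX hg hG hq, ← sum_D_expo_contr22]
    simp only [L, L22, D_one, D_two, Γ_zero_singleton h₀ h₂, Γ_two_singleton h₀ h₂]
  · rw [bisymbol_two_three hX hg hG hq, ← sum_D_expo_contr23]
    simp only [L, L23, D_one, Γ_zero_singleton h₀ h₂]
  · rw [bisymbol_two_four hX hg hq, ← sum_D_expo_contr24]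
    simp only [L, L24, Γ_zero_singleton h₀ h₂]
  · rw [bisymbol_three_three hX hg hG hq, ← sum_D_expo_contr33]
    simp only [L, L33, D_one, Γ_zero_singleton h₀ h₂]
  · rw [bisymbol_three_four hX hg hq, mul_smul_comm, ← sum_D_expo_contr34]
    simp only [L, L34, Γ_zero_singleton h₀ h₂]
  · rw [bisymbol_four_four hX hg hq, mul_smul_comm, ← sum_D_expo_contr44]
    simp only [L, L44, Γ_zero_singleton h₀ h₂]

section symm

variable (hsymm : ∀ f g, PowerSeries.coeff 4 (weyl (xhat (correctedOmega ω₀ ω₂) 4) f) g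
  = PowerSeries.coeff 4 (weyl (xhat (correctedOmega ω₀ ω₂) 4) g) f)

include h₀ h₂ hsymm in
lemma L_expo (u v : Fin N → ℝ) {m n : ℕ} (hm : m < 5) (hn : n < 5) :
    L ω₀ ω₂ m n (expo u) (expo v)
      = expo u * expo v * bisymbol (xhat (correctedOmega ω₀ ω₂) 4) u v m n := by
  have hX := isDeformed_xhat (correctedOmega_skew h₀ h₂) 4
  have key : ∀ u v : Fin N → ℝ, ∀ m n, m ≤ n → n < 5 → L ω₀ ω₂ m n (expo u) (expo v)
      = expo u * expo v * bisymbol (xhat (correctedOmega ω₀ ω₂) 4) u v m n := by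
    intro u v m n hmn hn
    rcases Nat.eq_zero_or_pos m with rfl | h
    · rw [L_zero_left, bisymbol_zero_left, mul_zero]
    · exact L_expo_of_le h₀ h₂ u v h hmn (by omega)
  rcases le_or_gt m n with h | h
  · exact key u v m n h hn
  · rw [L_swap h, key v u n m h.le hm, bisymbol_symm hX v u hsymm (by omega) (by omega),
      mul_comm (expo v)]

include h₀ h₂ hsymm in
/-- Both sides are bidifferential operators, and they agree on exponential functions. -/
theorem coeff_four_weyl_eq_sum_L (f g : Smooth N) :
    PowerSeries.coeff 4 (weyl (xhat (correctedOmega ω₀ ω₂) 4) f) g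
      = ∑ m ∈ range 5, ∑ n ∈ range 5, L ω₀ ω₂ m n f g := by
  have hX := isDeformed_xhat (correctedOmega_skew h₀ h₂) 4
  refine (IsBidiff.weyl hX 4).ext (.sum _ fun m => .sum _ fun n => isBidiff_L m n) (fun u v => ?_) f g
  rw [coeff_four_weyl_expo_of_symm hX u v hsymm, Finset.mul_sum]
  refine Finset.sum_congr rfl fun m hm => ?_
  rw [Finset.mul_sum]
  exact Finset.sum_congr rfl fun n hn => (L_expo h₀ h₂ hsymm u v (Finset.mem_range.mp hm)
    (Finset.mem_range.mp hn)).symm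

include h₀ h₂ hsymm in
/-- For `m ≠ n` this holds by the definition of `L`; for `m = n` it is the symmetry of the homogeneous
part of bidegree `(m, m)`. -/
theorem L_symm (m n : ℕ) (f g : Smooth N) : L ω₀ ω₂ m n f g = L ω₀ ω₂ n m g f := by
  have hX := isDeformed_xhat (correctedOmega_skew h₀ h₂) 4
  rcases lt_trichotomy m n with h | rfl | h
  · exact (L_swap h g f).symm
  · rcases le_or_gt 5 m with hm | hm
    · rw [L_eq_zero_left hm, L_eq_zero_left hm]
    · refine (isBidiff_L m m).ext (isBidiff_L m m).swap (fun u v => ?_) f g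
      rw [L_expo h₀ h₂ hsymm u v hm hm, L_expo h₀ h₂ hsymm v u hm hm,
        bisymbol_symm hX u v hsymm (by omega) (by omega), mul_comm (expo u)]
  · exact L_swap h f g

end symm

end fourth

/-! ### The coordinates in the fourth order -/

/-- The operator with the coefficients `gammaOf G i` of up to four indices, written out, if it has no
vector field part. -/
lemma sum_Icc_four_eq (G : Fin N → Fin N → Op N) (i : Fin N) (h : ∀ j, gammaOf G i [j] = 0) :
    ∑ p ∈ Finset.Icc 1 4, ∑ I : Fin p → Fin N, mulOp (gammaOf G i (List.ofFn I)) * D (List.ofFn I)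
      = (∑ j, ∑ k, mulOp (gammaOf G i [j, k]) * D [j, k])
        + (∑ j, ∑ k, ∑ l, mulOp (gammaOf G i [j, k, l]) * D [j, k, l])
        + (∑ j, ∑ k, ∑ l, ∑ m, mulOp (gammaOf G i [j, k, l, m]) * D [j, k, l, m]) := by
  rw [show Finset.Icc 1 4 = {1, 2, 3, 4} from rfl, Finset.sum_insert (by decide),
    Finset.sum_insert (by decide), Finset.sum_insert (by decide), Finset.sum_singleton]
  have h1 : ∑ I : Fin 1 → Fin N, mulOp (gammaOf G i (List.ofFn I)) * D (List.ofFn I) = 0 := by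
    rw [sum_fin_one]
    refine Finset.sum_eq_zero fun j _ => ?_
    rw [ofFn_one, h, mulOp_zero, zero_mul]
  rw [h1, zero_add, ← add_assoc]
  refine congrArg₂ (· + ·) (congrArg₂ (· + ·) ?_ ?_) ?_
  · rw [sum_cons]
    refine Finset.sum_congr rfl fun j _ => ?_
    rw [sum_fin_one]
    rfl
  · rw [sum_cons]
    refine Finset.sum_congr rfl fun j _ => ?_
    rw [sum_cons]
    refine Finset.sum_congr rfl fun k _ => ?_
    rw [sum_fin_one]
    rfl
  · rw [sum_cons]
    refine Finset.sum_congr rfl fun j _ => ?_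
    rw [sum_cons]
    refine Finset.sum_congr rfl fun k _ => ?_
    rw [sum_cons]
    refine Finset.sum_congr rfl fun l _ => ?_
    rw [sum_fin_one]
    rfl

end

end WeylStar

open WeylStar in
theorem mainTheorem1 (N : ℕ) (ω₀ : Fin N → Fin N → Smooth N) (hω₀ : IsPoisson ω₀) :
    -- a correction exists
    IsCorrection ω₀ (omegaTwo ω₀) ∧
    ∀ ω₂ : Fin N → Fin N → Smooth N, IsCorrection ω₀ ω₂ →
      -- the order `α^4` of the deformed coordinates
      (∀ i, PowerSeries.coeff 4 (xhat (correctedOmega ω₀ ω₂) 4 i) =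
        (∑ j, ∑ k, mulOp (Γ ω₀ ω₂ 2 i [j, k]) * D [j, k])
        + (∑ j, ∑ k, ∑ l, mulOp (Γ ω₀ ω₂ 1 i [j, k, l]) * D [j, k, l])
        + (∑ j, ∑ k, ∑ l, ∑ m, mulOp (Γ ω₀ ω₂ 0 i [j, k, l, m]) * D [j, k, l, m])) ∧
      -- the deformed coordinates satisfy the commutation relation
      CommutationRelation (correctedOmega ω₀ ω₂) 4 ∧
      -- `W` is the symmetric ordering: `(c · x)^n` is sent to `(c · x̂)^n`
      (∀ (c : Fin N → ℝ) (n : ℕ),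
        weyl (xhat (correctedOmega ω₀ ω₂) 4) ((∑ i, c i • coord i) ^ n) =
          (∑ i, c i • xhat (correctedOmega ω₀ ω₂) 4 i) ^ n) ∧
      -- the fourth order of the star product
      (∀ f g : Smooth N, starPart (correctedOmega ω₀ ω₂) 4 f g =
        ∑ m ∈ Finset.range 5, ∑ n ∈ Finset.range 5, L ω₀ ω₂ m n f g) ∧
      (∀ (m n : ℕ) (f g : Smooth N), L ω₀ ω₂ m n f g = L ω₀ ω₂ n m g f) ∧
      (∀ f g : Smooth N, starPart (correctedOmega ω₀ ω₂) 4 f g =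
        starPart (correctedOmega ω₀ ω₂) 4 g f) ∧
      -- the consistency condition in the fourth order, without a further correction
      ConsistencyCondition (correctedOmega ω₀ ω₂) 4 := by
  refine ⟨isCorrection_omegaTwo hω₀, fun ω₂ h => ?_⟩
  have h₀ := hω₀.skew
  have h₂ := h.skew
  have hω := correctedOmega_skew h₀ h₂
  have heven := correctedOmega_even ω₀ ω₂
  have hX := isDeformed_xhat hω 4
  have hcomm : CommutationRelation (correctedOmega ω₀ ω₂) 4 :=
    h.consistent.commutationRelation hω 4 le_rfl
  have hsymm : ∀ f g, PowerSeries.coeff 4 (weyl (xhat (correctedOmega ω₀ ω₂) 4) f) g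
      = PowerSeries.coeff 4 (weyl (xhat (correctedOmega ω₀ ω₂) 4) g) f := fun f g => by
    rw [coeff_weyl_apply_comm hX (hcomm.commute_altX hω heven) (by norm_num),
      Even.neg_one_pow (by decide), one_smul]
  refine ⟨fun i => ?_, hcomm, fun c n => weyl_lin_pow hX c n,
    coeff_four_weyl_eq_sum_L h₀ h₂ hsymm, L_symm h₀ h₂ hsymm, hsymm,
    h.consistent.succ_of_even hω heven (by decide)⟩
  rw [coeff_xhat_self]
  exact sum_Icc_four_eq _ i (Γ_three_singleton h₀ h₂ i)
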